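/- **Pure types, domains, terms.** The pure types $P,Q$ are the closed expressions generated by $\mathtt{Unit}$, $P\times Q$, $Q\to P$, $P+Q$, type variables $\alpha$ and $\mathrm{rec}\,\alpha.P$. Let $[\![P]\!]$ be the cpos (posets with a least element and all directed suprema) given by the canonical (bilimit of embedding-projection pairs) simultaneous solution of the domain equations: $[\![\mathtt{Unit}]\!]\cong\{\bot<\top\}$; $[\![P\times Q]\!]\cong[\![P]\!]\times[\![Q]\!]$; $[\![Q\to P]\!]\cong$ the Scott-continuous functions $[\![Q]\!]\to[\![P]\!]$ with the pointwise order; $[\![P+Q]\!]\cong$ the disjoint union of $[\![P]\!]$ and $[\![Q]\!]$ with a new least element; $[\![\mathrm{rec}\,\alpha.P]\!]\cong[\![P[\mathrm{rec}\,\alpha.P/\alpha]]\!]$ (via $\mathrm{fold}$, $\mathrm{unfold}$). Terms are $\langle\rangle$, $\langle M,N\rangle$, $\pi_i(M)$, $x$, $\lambda x.M$, $MN$, $\mathrm{fix}\,x.M$, $\mathrm{fold}(M)$, $\mathrm{unfold}(M)$, $\mathrm{in}_i(M)$, $\mathrm{case}\ M\,[x_1\mapsto N_1\mid x_2\mapsto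 N_2]$, with the usual typing rules $x_1:P_1,\dots,x_n:P_n\vdash M:P$ (where $\Gamma,x:P\vdash M:P$ gives $\Gamma\vdash\mathrm{fix}\,x.M:P$) and the usual Scott-continuous interpretation $[\![M]\!]:[\![P_1]\!]\times\dots\times[\![P_n]\!]\to[\![P]\!]$: $[\![\langle\rangle]\!]=\top$, $\mathrm{fix}$ is the least fixpoint $\bigvee_k f^k(\bot)$, and $\mathrm{case}$ is $\bot$ on $\bot$. **Formulae.** Iteration terms are $t::=k\mid 0\mid t+1$, with $k$ an iteration variable. The formulae of type $P$ are generated by: $\top$, $\bot$, $\varphi\wedge\psi$, $\varphi\vee\psi$ and fixpoint variables $p$ at each type; $\langle\rangle$ at $\mathtt{Unit}$; $\langle m\rangle\varphi$ for $m\in\{\pi_1,\pi_2\}$ (at $P_1\times P_2$, $\varphi$ of type $P_i$), $m\in\{\mathrm{in}_1,\mathrm{in}_2\}$ (at $P_1+P_2$, $\varphi$ of type $P_i$), $m=\mathrm{fold}$ (at $\mathrm{rec}\,\alpha.P$, $\varphi$ of type $P[\mathrm{rec}\,\alpha.P/\alpha]$); bounded iterations $(\mu^t p)\varphi$, $(\nu^t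 p)\varphi$; quantifiers $(\exists k)\varphi$, $(\forall k)\varphi$ over iteration variables; and $\psi\Rightarrow\varphi$ at $Q\to P$, with $\psi$ of type $Q$ and $\varphi$ of type $P$ without free fixpoint variables. The languages $\mathcal L^{s}$, $s\in\{\pm,+,-\}$, are the formulae such that: $\exists$ occurs only in $\mathcal L^+$ and applied to a formula of $\mathcal L^+$ in which $k$ is positive; $\forall$ occurs only in $\mathcal L^-$ and applied to a formula of $\mathcal L^-$ in which $k$ is negative; $\psi\Rightarrow\varphi\in\mathcal L^s$ iff $\psi\in\mathcal L^{-s}$, $\varphi\in\mathcal L^s$ (with $-(\pm)=\pm$); all other constructors preserve $\mathcal L^s$. Here $k$ is positive (negative) in each formula in which it is not free; positivity and negativity are preserved by $\wedge,\vee,\langle m\rangle$; $k$ is positive (negative) in $\psi\Rightarrow\varphi$ if it is negative (positive) in $\psi$ and positive (negative) in $\varphi$; positivity is preserved by $\exists$, $\mu^t$, and by $\nu^t$ if $k\notin t$; negativity is preserved by $\forall$, $\nu^t$, and by $\mu^t$ if $k\notin t$. The *conjunctive fragment* $\mathcal L^\wedge$ consists of the formulae built from $\top,\bot,\wedge,\langle\rangle,\langle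 m\rangle,\Rightarrow$ only. *Semantics* $[\![\varphi]\!]\subseteq[\![P]\!]$: $\top,\bot,\wedge,\vee$ are the whole set, $\emptyset$, $\cap$, $\cup$; $[\![\langle\rangle]\!]=\{\top\}$; $[\![\langle\pi_i\rangle\varphi]\!]=\{x\mid x_i\in[\![\varphi]\!]\}$; $[\![\langle\mathrm{in}_i\rangle\varphi]\!]=\{\mathrm{in}_i(x)\mid x\in[\![\varphi]\!]\}$; $[\![\langle\mathrm{fold}\rangle\varphi]\!]=\{x\mid\mathrm{unfold}(x)\in[\![\varphi]\!]\}$; $[\![\psi\Rightarrow\varphi]\!]=\{f\mid\forall x\in[\![\psi]\!],\ f(x)\in[\![\varphi]\!]\}$; $\exists k,\forall k$ are $\bigcup_{k\in\mathbb N},\bigcap_{k\in\mathbb N}$; $(\mu^tp)\varphi$ and $(\nu^tp)\varphi$ are the $t$-fold iterates of $S\mapsto[\![\varphi]\!](p:=S)$ from $\emptyset$ and from the whole set. **Deduction** $\psi\vdash\varphi$ (for each $s$, between formulae of $\mathcal L^s$ of the same type; all formulae in a rule are in $\mathcal L^s$, unless said otherwise; $k$ is not free in $\theta$, nor in the unquantified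 side of a rule). Identity and cut; the usual introduction and elimination rules of $\wedge,\top,\vee,\bot$; $\psi\wedge(\varphi\vee\theta)\vdash(\psi\wedge\varphi)\vee(\psi\wedge\theta)$. Modalities: $\langle\mathrm{in}_1\rangle\varphi\wedge\langle\mathrm{in}_2\rangle\psi\vdash\bot$; $\langle m\rangle$ is monotone; $\langle m\rangle\varphi_1\wedge\langle m\rangle\varphi_2\vdash\langle m\rangle(\varphi_1\wedge\varphi_2)$; $\top\vdash\langle m\rangle\top$ for $m\neq\mathrm{in}_i$; $(\forall k)\langle m\rangle\varphi\vdash\langle m\rangle(\forall k)\varphi$; $\langle m\rangle(\varphi_1\vee\varphi_2)\vdash\langle m\rangle\varphi_1\vee\langle m\rangle\varphi_2$; $\langle m\rangle\bot\vdash\bot$; $\langle m\rangle(\exists k)\varphi\vdash(\exists k)\langle m\rangle\varphi$. Quantifiers: $\psi\vdash\varphi[t/k]$ gives $\psi\vdash(\exists k)\varphi$; $\theta\wedge\varphi\vdash\psi$ gives $\theta\wedge(\exists k)\varphi\vdash\psi$; $(\exists k)(\exists\ell)\varphi\vdash(\exists k)\varphi[k/\ell]$; $\varphi[t/k]\vdash\psi$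 gives $(\forall k)\varphi\vdash\psi$; $\psi\vdash\varphi\vee\theta$ gives $\psi\vdash(\forall k)\varphi\vee\theta$; $(\forall k)\varphi[k/\ell]\vdash(\forall k)(\forall\ell)\varphi$; for $\xi\in\{\mu,\nu\}$ and $k\notin t$, $(\xi^tp)(\exists k)\varphi\vdash(\exists k)(\xi^tp)\varphi$ and $(\forall k)(\xi^tp)\varphi\vdash(\xi^tp)(\forall k)\varphi$. Iterations: $(\mu^0p)\varphi\vdash\bot$; $(\mu^tp)\varphi\vdash\psi$ gives $(\mu^{t+1}p)\varphi\vdash\varphi[\psi/p]$; $\varphi[(\mu^tp)\varphi/p]\vdash(\mu^{t+1}p)\varphi$; $\mu^t$ is monotone; $\top\vdash(\nu^0p)\varphi$; $\psi\vdash(\nu^tp)\varphi$ gives $\varphi[\psi/p]\vdash(\nu^{t+1}p)\varphi$; $(\nu^{t+1}p)\varphi\vdash\varphi[(\nu^tp)\varphi/p]$; $\nu^t$ is monotone. Implication: if $\psi'\vdash\psi$ in $\mathcal L^{-s}$ and $\varphi\vdash\varphi'$ then $\psi\Rightarrow\varphi\vdash\psi'\Rightarrow\varphi'$; $((\forall k)\psi)\Rightarrow\varphi\vdash(\exists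 k)(\psi\Rightarrow\varphi)$; $\psi\Rightarrow(\exists k)\varphi\vdash(\exists k)(\psi\Rightarrow\varphi)$ for $\psi\in\mathcal L^\pm$; $(\forall k)(\psi\Rightarrow\varphi)\vdash((\exists k)\psi)\Rightarrow\varphi$; $(\forall k)(\psi\Rightarrow\varphi)\vdash\psi\Rightarrow(\forall k)\varphi$; $(\psi\Rightarrow\varphi_1)\wedge(\psi\Rightarrow\varphi_2)\vdash\psi\Rightarrow(\varphi_1\wedge\varphi_2)$; $\top\vdash\psi\Rightarrow\top$; $(\psi_1\Rightarrow\varphi)\wedge(\psi_2\Rightarrow\varphi)\vdash(\psi_1\vee\psi_2)\Rightarrow\varphi$; $\top\vdash\bot\Rightarrow\varphi$; and for $\delta\in\mathcal L^\wedge$: $\delta\Rightarrow(\varphi_1\vee\varphi_2)\vdash(\delta\Rightarrow\varphi_1)\vee(\delta\Rightarrow\varphi_2)$, and $\delta\Rightarrow\bot\vdash\bot$ if $\mathsf C(\delta)$. The predicate $\mathsf C$ is defined simultaneously and inductively: $\mathsf C(\langle\rangle)$; $\mathsf C(\top)$; $\mathsf C(\varphi)$ gives $\mathsf C(\langle\mathrm{fold}\rangle\varphi)$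 and $\mathsf C(\langle\mathrm{in}_i\rangle\varphi)$; $\mathsf C(\varphi)$ and $\mathsf C(\psi)$ give $\mathsf C(\langle\pi_1\rangle\varphi\wedge\langle\pi_2\rangle\psi)$; $\mathsf C(\psi)$ and $\psi\vdash\varphi$ in $\mathcal L^\pm$ with $\varphi\in\mathcal L^\wedge$ give $\mathsf C(\varphi)$; and, for finite $I$, $\mathsf C(\bigwedge_{i\in I}(\psi_i\Rightarrow\varphi_i))$ if all $\mathsf C(\psi_i)$, $\mathsf C(\varphi_i)$ hold and for each $J\subseteq I$ either $\bigwedge_{j\in J}\psi_j\vdash\bot$ in $\mathcal L^\pm$ or $\mathsf C(\bigwedge_{j\in J}\varphi_j)$. **Refinement types.** $T,U::=P\mid\{P\mid\varphi\}\mid T\times U\mid U\to T$, with $\varphi$ a closed formula of type $P$ in $\mathcal L^\pm\cup\mathcal L^+\cup\mathcal L^-$. Write $|T|$ and $|\Gamma|$ for the underlying pure type and context. $[\![T]\!]\subseteq[\![|T|]\!]$ is given by $[\![P]\!]$, $[\![\{P\mid\varphi\}]\!]=[\![\varphi]\!]$, $[\![T\times U]\!]=[\![T]\!]\times[\![U]\!]$,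 $[\![U\to T]\!]=\{f\mid\forall x\in[\![U]\!],\ f(x)\in[\![T]\!]\}$. *Subtyping* (between types with the same underlying pure type) is the least preorder with: $T\preceq|T|$; $P\preceq\{P\mid\top\}$; $\{P\mid\psi\}\preceq\{P\mid\varphi\}$ if $\psi\vdash\varphi$; $\times$ covariant; $\to$ contravariant on the left and covariant on the right; and, in both directions, $\{P\mid\varphi\}\times\{Q\mid\psi\}\simeq\{P\times Q\mid\langle\pi_1\rangle\varphi\wedge\langle\pi_2\rangle\psi\}$ and $\{Q\mid\psi\}\to\{P\mid\varphi\}\simeq\{Q\to P\mid\psi\Rightarrow\varphi\}$. *Typing* $\Gamma\vdash M:T$ is derived by: the usual rules for variables, $\lambda$, application, pairs and projections, over refinement types; $\Gamma\vdash M:P$ if $|\Gamma|\vdash M:P$; if $\Gamma\vdash M:T$, $T\preceq T'$ and $\Gamma'\preceq\Gamma$ componentwise, then $\Gamma'\vdash M:T'$; $\Gamma\vdash\langle\rangle:\{\mathtt{Unit}\mid\langle\rangle\}$; $\Gamma\vdash M_i:\{P_i\mid\varphi\}$ and $|\Gamma|\vdash M_{3-i}:P_{3-i}$ give $\Gamma\vdash\langle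 M_1,M_2\rangle:\{P_1\times P_2\mid\langle\pi_i\rangle\varphi\}$; $\Gamma\vdash M:\{P_1\times P_2\mid\langle\pi_i\rangle\varphi\}$ gives $\Gamma\vdash\pi_i(M):\{P_i\mid\varphi\}$; $M:\{P[\mathrm{rec}\,\alpha.P/\alpha]\mid\varphi\}$ gives $\mathrm{fold}(M):\{\mathrm{rec}\,\alpha.P\mid\langle\mathrm{fold}\rangle\varphi\}$ and $M:\{\mathrm{rec}\,\alpha.P\mid\langle\mathrm{fold}\rangle\varphi\}$ gives $\mathrm{unfold}(M):\{P[\mathrm{rec}\,\alpha.P/\alpha]\mid\varphi\}$; $M:\{P_i\mid\varphi\}$ gives $\mathrm{in}_i(M):\{P_1+P_2\mid\langle\mathrm{in}_i\rangle\varphi\}$; $\Gamma\vdash M:\{P_1+P_2\mid\langle\mathrm{in}_i\rangle\psi\}$, $\Gamma,x_i:\{P_i\mid\psi\}\vdash N_i:T$ and $|\Gamma|,x_{3-i}:P_{3-i}\vdash N_{3-i}:|T|$ give $\Gamma\vdash\mathrm{case}\ M\,[x_1\mapsto N_1\mid x_2\mapsto N_2]:T$; $\Gamma\vdash\mathrm{fix}\,x.M:\{P\mid\psi\}$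 and $\Gamma,x:\{P\mid\psi\}\vdash M:\{P\mid\varphi\}$ give $\Gamma\vdash\mathrm{fix}\,x.M:\{P\mid\varphi\}$; $M:\{P\mid\varphi\}$ and $M:\{P\mid\psi\}$ give $M:\{P\mid\varphi\wedge\psi\}$; $\Gamma\vdash M:T$ if $|\Gamma|\vdash M:|T|$ and $\Gamma$ contains some $x:\{Q\mid\bot\}$; and $\Gamma,x:\{Q\mid\psi_1\vee\psi_2\},\Gamma'\vdash M:T$ if the same judgement holds with $\psi_1$ and with $\psi_2$ in place of $\psi_1\vee\psi_2$. A judgement $\Gamma\vdash M:T$ with $\Gamma=x_1:U_1,\dots,x_n:U_n$ is *sound* if $|\Gamma|\vdash M:|T|$ is derivable and $[\![M]\!](u_1,\dots,u_n)\in[\![T]\!]$ for all $u_1\in[\![U_1]\!],\dots,u_n\in[\![U_n]\!]$. **Theorem.** Let $\Gamma\vdash M:T$ be a judgement all of whose formulae (in the types of $\Gamma$ and in $T$) belong to the conjunctive fragment $\mathcal L^\wedge$. If $\Gamma\vdash M:T$ is sound, then it is derivable. -/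

import Mathlib

namespace FPC

noncomputable section

/-! ## Complete partial orders and Scott-continuous functions -/

/-- A cpo (poset with a least element and all directed suprema), bundled. -/
structure Cpo : Type 1 where
  carrier : Type
  [str : CompletePartialOrder carrier]

instance : CoeSort Cpo Type := ⟨Cpo.carrier⟩

instance (X : Cpo) : CompletePartialOrder X := X.str

/-- Scott-continuous functions. -/
structure SHom (X Y : Type) [CompletePartialOrder X] [CompletePartialOrder Y] where
  toFun : X → Y
  cont : ScottContinuous toFun

section Basic

variable {X Y Z W : Type} [CompletePartialOrder X] [CompletePartialOrder Y]
  [CompletePartialOrder Z] [CompletePartialOrder W]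

instance : CoeFun (SHom X Y) (fun _ => X → Y) := ⟨SHom.toFun⟩

@[ext] theorem SHom.ext {f g : SHom X Y} (h : ∀ x, f x = g x) : f = g := by
  cases f; cases g; congr; exact funext h

theorem SHom.mono (f : SHom X Y) : Monotone f := f.cont.monotone

/-- The pointwise order. -/
instance : PartialOrder (SHom X Y) where
  le f g := ∀ x, f x ≤ g x
  le_refl _ _ := le_rfl
  le_trans _ _ _ h h' x := (h x).trans (h' x)
  le_antisymm _ _ h h' := SHom.ext fun x => (h x).antisymm (h' x)

theorem SHom.directed_apply {F : Set (SHom X Y)} (hF : DirectedOn (· ≤ ·) F) (x : X) :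
    DirectedOn (· ≤ ·) ((fun f : SHom X Y => f x) '' F) := by
  rintro _ ⟨f, hf, rfl⟩ _ ⟨g, hg, rfl⟩
  obtain ⟨k, hk, h1, h2⟩ := hF f hf g hg
  exact ⟨k x, ⟨k, hk, rfl⟩, h1 x, h2 x⟩

/-- Directed suprema of Scott-continuous functions are computed pointwise. -/
def SHom.dSup (F : Set (SHom X Y)) (hF : DirectedOn (· ≤ ·) F) : SHom X Y where
  toFun x := sSup ((fun f : SHom X Y => f x) '' F)
  cont := by
    intro d hne hd a ha
    constructor
    · rintro _ ⟨x, hx, rfl⟩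
      refine (SHom.directed_apply hF x).sSup_le ?_
      rintro _ ⟨f, hf, rfl⟩
      exact (f.mono (ha.1 hx)).trans ((SHom.directed_apply hF a).le_sSup ⟨f, hf, rfl⟩)
    · intro b hb
      refine (SHom.directed_apply hF a).sSup_le ?_
      rintro _ ⟨f, hf, rfl⟩
      refine (f.cont hne hd ha).2 ?_
      rintro _ ⟨x, hx, rfl⟩
      exact ((SHom.directed_apply hF x).le_sSup ⟨f, hf, rfl⟩).trans (hb ⟨x, hx, rfl⟩)

def SHom.const (X : Type) [CompletePartialOrder X] (y : Y) : SHom X Y :=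
  ⟨fun _ => y, ScottContinuous.const y⟩

open Classical in
instance : CompletePartialOrder (SHom X Y) where
  bot := SHom.const X ⊥
  bot_le _ _ := bot_le
  sSup F := if hF : DirectedOn (· ≤ ·) F then SHom.dSup F hF else SHom.const X ⊥
  lubOfDirected F hF := by
    rw [dif_pos hF]
    constructor
    · intro f hf x
      exact (SHom.directed_apply hF x).le_sSup ⟨f, hf, rfl⟩
    · intro g hg x
      refine (SHom.directed_apply hF x).sSup_le ?_
      rintro _ ⟨f, hf, rfl⟩
      exact hg hf x

open Classical in
theorem SHom.sSup_apply {F : Set (SHom X Y)} (hF : DirectedOn (· ≤ ·) F) (x : X) :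
    (sSup F : SHom X Y) x = sSup ((fun f : SHom X Y => f x) '' F) := by
  show (if hF : DirectedOn (· ≤ ·) F then SHom.dSup F hF else SHom.const X ⊥).toFun x = _
  rw [dif_pos hF]; rfl

def SHom.id (X : Type) [CompletePartialOrder X] : SHom X X := ⟨fun x => x, ScottContinuous.id⟩

def SHom.comp (g : SHom Y Z) (f : SHom X Y) : SHom X Z := ⟨fun x => g (f x), f.cont.comp g.cont⟩

/-- Componentwise directed suprema in the Cartesian product. -/
instance : CompletePartialOrder (X × Y) where
  sSup s := (sSup (Prod.fst '' s), sSup (Prod.snd '' s))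
  bot_le _ := bot_le
  lubOfDirected s hs := by
    have h1 : DirectedOn (· ≤ ·) (Prod.fst '' s) := by
      rintro _ ⟨a, ha, rfl⟩ _ ⟨b, hb, rfl⟩
      obtain ⟨c, hc, h, h'⟩ := hs a ha b hb
      exact ⟨c.1, ⟨c, hc, rfl⟩, h.1, h'.1⟩
    have h2 : DirectedOn (· ≤ ·) (Prod.snd '' s) := by
      rintro _ ⟨a, ha, rfl⟩ _ ⟨b, hb, rfl⟩
      obtain ⟨c, hc, h, h'⟩ := hs a ha b hb
      exact ⟨c.2, ⟨c, hc, rfl⟩, h.2, h'.2⟩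
    exact isLUB_prod.2 ⟨h1.isLUB_sSup, h2.isLUB_sSup⟩

def SHom.fst : SHom (X × Y) X := ⟨Prod.fst, ScottContinuous.fst⟩

def SHom.snd : SHom (X × Y) Y := ⟨Prod.snd, ScottContinuous.snd⟩

def SHom.pair (f : SHom Z X) (g : SHom Z Y) : SHom Z (X × Y) :=
  ⟨fun z => (f z, g z), f.cont.prodMk g.cont⟩

/-- A function of two variables is Scott-continuous if it is so in each of them. -/
theorem SHom.cont_two {f : X × Y → Z} (h1 : ∀ y, ScottContinuous fun x => f (x, y))
    (h2 : ∀ x, ScottContinuous fun y => f (x, y)) : ScottContinuous f := by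
  have hm : Monotone f := fun a b hab =>
    ((h1 a.2).monotone hab.1).trans ((h2 b.1).monotone hab.2)
  intro d hne hd a ha
  obtain ⟨ha1, ha2⟩ := isLUB_prod.1 ha
  refine ⟨?_, fun b hb => ?_⟩
  · rintro _ ⟨x, hx, rfl⟩
    exact hm (ha.1 hx)
  · have d1 : DirectedOn (· ≤ ·) (Prod.fst '' d) := by
      rintro _ ⟨a, ha, rfl⟩ _ ⟨b, hb, rfl⟩
      obtain ⟨c, hc, h, h'⟩ := hd a ha b hb
      exact ⟨c.1, ⟨c, hc, rfl⟩, h.1, h'.1⟩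
    have d2 : DirectedOn (· ≤ ·) (Prod.snd '' d) := by
      rintro _ ⟨a, ha, rfl⟩ _ ⟨b, hb, rfl⟩
      obtain ⟨c, hc, h, h'⟩ := hd a ha b hb
      exact ⟨c.2, ⟨c, hc, rfl⟩, h.2, h'.2⟩
    refine (h1 a.2 (hne.image _) d1 ha1).2 ?_
    rintro _ ⟨_, ⟨x, hx, rfl⟩, rfl⟩
    refine (h2 x.1 (hne.image _) d2 ha2).2 ?_
    rintro _ ⟨_, ⟨y, hy, rfl⟩, rfl⟩
    obtain ⟨z, hz, hxz, hyz⟩ := hd x hx y hy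
    exact (hm (show (x.1, y.2) ≤ z from ⟨hxz.1, hyz.2⟩)).trans (hb ⟨z, hz, rfl⟩)

theorem SHom.cont_apply (x : X) : ScottContinuous fun f : SHom X Y => f x := by
  rw [CompletePartialOrder.scottContinuous]
  intro F _ hF
  rw [SHom.sSup_apply hF]
  exact (SHom.directed_apply hF x).isLUB_sSup

/-- Evaluation. -/
def SHom.eval : SHom (SHom X Y × X) Y :=
  ⟨fun p => p.1 p.2, SHom.cont_two (fun x => SHom.cont_apply x) (fun f => f.cont)⟩

theorem SHom.cont_of_pointwise {f : X → SHom Y Z} (h : ∀ y, ScottContinuous fun x => f x y) :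
    ScottContinuous f := by
  intro d hne hd a ha
  constructor
  · rintro _ ⟨x, hx, rfl⟩ y
    exact (h y).monotone (ha.1 hx)
  · intro g hg y
    refine (h y hne hd ha).2 ?_
    rintro _ ⟨x, hx, rfl⟩
    exact hg ⟨x, hx, rfl⟩ y

/-- Currying. The new variable is the first component. -/
def SHom.curry (f : SHom (X × Y) Z) : SHom Y (SHom X Z) where
  toFun y := ⟨fun x => f (x, y), ((ScottContinuous.id).prodMk (ScottContinuous.const y)).comp f.cont⟩
  cont := SHom.cont_of_pointwise fun x =>
    ((ScottContinuous.const x).prodMk (ScottContinuous.id)).comp f.cont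

/-- An order isomorphism is Scott-continuous. -/
def SHom.ofIso (e : X ≃o Y) : SHom X Y := ⟨e, fun _ _ _ _ ha => e.isLUB_image'.2 ha⟩

/-- The map taking `f` to its `n`-th iterate at the least element. -/
def SHom.iter (X : Type) [CompletePartialOrder X] : ℕ → SHom (SHom X X) X
  | 0 => SHom.const _ ⊥
  | n + 1 => SHom.comp SHom.eval (SHom.pair (SHom.id _) (SHom.iter X n))

/-- The fixpoint combinator taking `f` to the supremum of its iterates at the least element. -/
def SHom.lfp (X : Type) [CompletePartialOrder X] : SHom (SHom X X) X := ⨆ n, SHom.iter X n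

/-! ### The weak sum -/

/-- The disjoint union of `X` and `Y` with a new least element. -/
inductive LSum (X Y : Type) : Type
  | bot : LSum X Y
  | inl (x : X) : LSum X Y
  | inr (y : Y) : LSum X Y

namespace LSum

def le : LSum X Y → LSum X Y → Prop
  | bot, _ => True
  | inl x, inl x' => x ≤ x'
  | inr y, inr y' => y ≤ y'
  | _, _ => False

instance : PartialOrder (LSum X Y) where
  le := le
  le_refl a := by cases a <;> simp [le]
  le_trans a b c := by
    cases a <;> cases b <;> cases c <;> simp only [le, imp_self, implies_true, false_imp_iff,
      imp_false] <;> exact fun h h' => le_trans h h'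
  le_antisymm a b := by
    cases a <;> cases b <;> simp only [le, imp_self, implies_true, false_imp_iff] <;>
      (intro h h'; rw [le_antisymm h h'])

theorem bot_le' (a : LSum X Y) : bot ≤ a := trivial
@[simp] theorem inl_le_inl {x x' : X} : (inl x : LSum X Y) ≤ inl x' ↔ x ≤ x' := Iff.rfl
@[simp] theorem inr_le_inr {y y' : Y} : (inr y : LSum X Y) ≤ inr y' ↔ y ≤ y' := Iff.rfl

theorem inl_le {x : X} {a : LSum X Y} : inl x ≤ a ↔ ∃ x', a = inl x' ∧ x ≤ x' := by
  cases a with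
  | bot => exact ⟨False.elim, by rintro ⟨_, h, _⟩; cases h⟩
  | inl x' => exact ⟨fun h => ⟨x', rfl, h⟩, by rintro ⟨_, h, h'⟩; cases h; exact h'⟩
  | inr y => exact ⟨False.elim, by rintro ⟨_, h, _⟩; cases h⟩

theorem inr_le {y : Y} {a : LSum X Y} : inr y ≤ a ↔ ∃ y', a = inr y' ∧ y ≤ y' := by
  cases a with
  | bot => exact ⟨False.elim, by rintro ⟨_, h, _⟩; cases h⟩
  | inr y' => exact ⟨fun h => ⟨y', rfl, h⟩, by rintro ⟨_, h, h'⟩; cases h; exact h'⟩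
  | inl y => exact ⟨False.elim, by rintro ⟨_, h, _⟩; cases h⟩

theorem directed_inl {D : Set (LSum X Y)} (hD : DirectedOn (· ≤ ·) D) :
    DirectedOn (· ≤ ·) {x | inl x ∈ D} := by
  intro x hx x' hx'
  obtain ⟨c, hc, h, h'⟩ := hD _ hx _ hx'
  obtain ⟨z, rfl, hz⟩ := inl_le.1 h
  exact ⟨z, hc, hz, h'⟩

theorem directed_inr {D : Set (LSum X Y)} (hD : DirectedOn (· ≤ ·) D) :
    DirectedOn (· ≤ ·) {y | inr y ∈ D} := by
  intro x hx x' hx'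
  obtain ⟨c, hc, h, h'⟩ := hD _ hx _ hx'
  obtain ⟨z, rfl, hz⟩ := inr_le.1 h
  exact ⟨z, hc, hz, h'⟩

open Classical in
instance : CompletePartialOrder (LSum X Y) where
  bot := bot
  bot_le := bot_le'
  sSup D :=
    if ∃ x, inl x ∈ D then inl (sSup {x | inl x ∈ D})
    else if ∃ y, inr y ∈ D then inr (sSup {y | inr y ∈ D})
    else bot
  lubOfDirected D hD := by
    split_ifs with h1 h2
    · obtain ⟨x, hx⟩ := h1
      constructor
      · intro a ha
        cases a with
        | bot => exact bot_le' _
        | inl x' => exact (directed_inl hD).le_sSup ha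
        | inr y =>
          obtain ⟨c, _, h, h'⟩ := hD _ hx _ ha
          obtain ⟨z, rfl, _⟩ := inl_le.1 h
          exact h'.elim
      · intro b hb
        obtain ⟨z, rfl, _⟩ := inl_le.1 (hb hx)
        exact (directed_inl hD).sSup_le fun x' hx' => hb hx'
    · obtain ⟨y, hy⟩ := h2
      constructor
      · intro a ha
        cases a with
        | bot => exact bot_le' _
        | inl x => exact (h1 ⟨x, ha⟩).elim
        | inr y' => exact (directed_inr hD).le_sSup ha
      · intro b hb
        obtain ⟨z, rfl, _⟩ := inr_le.1 (hb hy)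
        exact (directed_inr hD).sSup_le fun x' hx' => hb hx'
    · constructor
      · intro a ha
        cases a with
        | bot => exact bot_le' _
        | inl x => exact (h1 ⟨x, ha⟩).elim
        | inr y => exact (h2 ⟨y, ha⟩).elim
      · exact fun b _ => bot_le' b

/-- Copairing, strict in its argument. -/
def elim (f : X → Z) (g : Y → Z) : LSum X Y → Z
  | bot => ⊥
  | inl x => f x
  | inr y => g y

theorem inl_cont : ScottContinuous (inl : X → LSum X Y) := by
  intro d hne hd a ha
  constructor
  · rintro _ ⟨x, hx, rfl⟩
    exact ha.1 hx
  · intro b hb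
    obtain ⟨x, hx⟩ := hne
    obtain ⟨z, rfl, _⟩ := inl_le.1 (hb ⟨x, hx, rfl⟩)
    exact ha.2 fun x' hx' => hb ⟨x', hx', rfl⟩

theorem inr_cont : ScottContinuous (inr : Y → LSum X Y) := by
  intro d hne hd a ha
  constructor
  · rintro _ ⟨x, hx, rfl⟩
    exact ha.1 hx
  · intro b hb
    obtain ⟨x, hx⟩ := hne
    obtain ⟨z, rfl, _⟩ := inr_le.1 (hb ⟨x, hx, rfl⟩)
    exact ha.2 fun x' hx' => hb ⟨x', hx', rfl⟩

theorem elim_mono (f : SHom X Z) (g : SHom Y Z) : Monotone (elim f g) := by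
  intro a b h
  cases a with
  | bot => exact bot_le
  | inl x => obtain ⟨z, rfl, hz⟩ := inl_le.1 h; exact f.mono hz
  | inr x => obtain ⟨z, rfl, hz⟩ := inr_le.1 h; exact g.mono hz

theorem elim_cont (f : SHom X Z) (g : SHom Y Z) : ScottContinuous (elim f g) := by
  intro d hne hd a ha
  refine ⟨?_, fun b hb => ?_⟩
  · rintro _ ⟨x, hx, rfl⟩
    exact elim_mono f g (ha.1 hx)
  · cases a with
    | bot => exact bot_le
    | inl x =>
      have hne' : {x | inl x ∈ d}.Nonempty := by
        by_contra hcon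
        have : (inl x : LSum X Y) ≤ bot := ha.2 fun c hc => by
          cases c with
          | bot => exact le_rfl
          | inl z => exact (hcon ⟨z, hc⟩).elim
          | inr z => exact (ha.1 hc).elim
        exact this.elim
      have hl : IsLUB {x | inl x ∈ d} x := by
        refine ⟨fun z hz => ha.1 hz, fun u hu => ?_⟩
        refine inl_le_inl.1 ((isLUB_le_iff (b := inl u) ha).2 fun c hc => ?_)
        cases c with
        | bot => exact bot_le' _
        | inl z => exact hu hc
        | inr z => exact (ha.1 hc).elim
      refine (f.cont hne' (directed_inl hd) hl).2 ?_
      rintro _ ⟨z, hz, rfl⟩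
      exact hb ⟨_, hz, rfl⟩
    | inr x =>
      have hne' : {x | inr x ∈ d}.Nonempty := by
        by_contra hcon
        have : (inr x : LSum X Y) ≤ bot := ha.2 fun c hc => by
          cases c with
          | bot => exact le_rfl
          | inr z => exact (hcon ⟨z, hc⟩).elim
          | inl z => exact (ha.1 hc).elim
        exact this.elim
      have hl : IsLUB {x | inr x ∈ d} x := by
        refine ⟨fun z hz => ha.1 hz, fun u hu => ?_⟩
        refine inr_le_inr.1 ((isLUB_le_iff (b := inr u) ha).2 fun c hc => ?_)
        cases c with
        | bot => exact bot_le' _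
        | inr z => exact hu hc
        | inl z => exact (ha.1 hc).elim
      refine (g.cont hne' (directed_inr hd) hl).2 ?_
      rintro _ ⟨z, hz, rfl⟩
      exact hb ⟨_, hz, rfl⟩

end LSum

def SHom.inl : SHom X (LSum X Y) := ⟨LSum.inl, LSum.inl_cont⟩

def SHom.inr : SHom Y (LSum X Y) := ⟨LSum.inr, LSum.inr_cont⟩

def SHom.copair (f : SHom X Z) (g : SHom Y Z) : SHom (LSum X Y) Z := ⟨LSum.elim f g, LSum.elim_cont f g⟩

/-- Copairing with parameters. -/
def SHom.case (m : SHom W (LSum X Y)) (f : SHom (X × W) Z) (g : SHom (Y × W) Z) : SHom W Z where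
  toFun w := SHom.copair (f.curry w) (g.curry w) (m w)
  cont := by
    have h : ScottContinuous fun p : W × LSum X Y =>
        SHom.copair (f.curry p.1) (g.curry p.1) p.2 := by
      refine SHom.cont_two (fun a => ?_) fun w => (SHom.copair (f.curry w) (g.curry w)).cont
      cases a with
      | bot => exact ScottContinuous.const ⊥
      | inl x => exact ((ScottContinuous.const x).prodMk (ScottContinuous.id)).comp f.cont
      | inr y => exact ((ScottContinuous.const y).prodMk (ScottContinuous.id)).comp g.cont
    exact ((ScottContinuous.id).prodMk m.cont).comp h

/-! ### Embedding-projection pairs -/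

/-- An embedding-projection pair from `X` to `Y`. -/
structure EP (X Y : Type) [CompletePartialOrder X] [CompletePartialOrder Y] where
  e : SHom X Y
  p : SHom Y X
  pe : ∀ x, p (e x) = x
  ep : ∀ y, e (p y) ≤ y

theorem EP.p_bot (f : EP X Y) : f.p ⊥ = ⊥ :=
  le_bot_iff.1 ((f.p.mono (bot_le : ⊥ ≤ f.e ⊥)).trans (f.pe ⊥).le)

theorem EP.e_bot (f : EP X Y) : f.e ⊥ = ⊥ :=
  le_bot_iff.1 ((f.e.mono (bot_le : ⊥ ≤ f.p ⊥)).trans (f.ep ⊥))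

end Basic

instance : CompletePartialOrder PUnit where
  sSup _ := PUnit.unit
  lubOfDirected _ _ := ⟨fun _ _ => le_rfl, fun _ _ => le_rfl⟩

abbrev Cpo.one : Cpo := ⟨PUnit⟩
/-- The two-element domain. -/
abbrev Cpo.two : Cpo := ⟨Bool⟩
abbrev Cpo.prod (X Y : Cpo) : Cpo := ⟨X × Y⟩
abbrev Cpo.arr (X Y : Cpo) : Cpo := ⟨SHom X Y⟩
abbrev Cpo.sum (X Y : Cpo) : Cpo := ⟨LSum X Y⟩

def EP.refl (X : Cpo) : EP X X := ⟨SHom.id X, SHom.id X, fun _ => rfl, fun _ => le_rfl⟩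

/-- The one-point cpo is initial for embedding-projection pairs. -/
def EP.init (X : Cpo) : EP Cpo.one X :=
  ⟨SHom.const _ ⊥, SHom.const _ PUnit.unit, fun _ => rfl, fun _ => bot_le⟩

def EP.prod {X X' Y Y' : Cpo} (f : EP X X') (g : EP Y Y') : EP (X.prod Y) (X'.prod Y') where
  e := SHom.pair (SHom.comp f.e SHom.fst) (SHom.comp g.e SHom.snd)
  p := SHom.pair (SHom.comp f.p SHom.fst) (SHom.comp g.p SHom.snd)
  pe x := Prod.ext (f.pe x.1) (g.pe x.2)
  ep y := ⟨f.ep y.1, g.ep y.2⟩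

def EP.arr {X X' Y Y' : Cpo} (f : EP X X') (g : EP Y Y') : EP (X.arr Y) (X'.arr Y') where
  e := ⟨fun h => SHom.comp g.e (SHom.comp h f.p), SHom.cont_of_pointwise fun x =>
    (SHom.cont_apply (f.p x)).comp g.e.cont⟩
  p := ⟨fun h => SHom.comp g.p (SHom.comp h f.e), SHom.cont_of_pointwise fun x =>
    (SHom.cont_apply (f.e x)).comp g.p.cont⟩
  pe h := SHom.ext fun x => by
    show g.p (g.e (SHom.toFun h (f.p (f.e x)))) = SHom.toFun h x
    rw [g.pe, f.pe]
  ep h x := (g.ep _).trans (SHom.mono h (f.ep x))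

def EP.sum {X X' Y Y' : Cpo} (f : EP X X') (g : EP Y Y') : EP (X.sum Y) (X'.sum Y') where
  e := SHom.copair (SHom.comp SHom.inl f.e) (SHom.comp SHom.inr g.e)
  p := SHom.copair (SHom.comp SHom.inl f.p) (SHom.comp SHom.inr g.p)
  pe x := by
    cases x with
    | bot => rfl
    | inl x => exact congrArg LSum.inl (f.pe x)
    | inr x => exact congrArg LSum.inr (g.pe x)
  ep x := by
    cases x with
    | bot => exact le_rfl
    | inl x => exact f.ep x
    | inr x => exact g.ep x

/-! ### Bilimits -/

/-- An `ω`-chain of embedding-projection pairs. -/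
structure Chain : Type 1 where
  X : ℕ → Cpo
  ep : ∀ n, EP (X n) (X (n + 1))

abbrev Chain.shift (C : Chain) : Chain := ⟨fun n => C.X (n + 1), fun n => C.ep (n + 1)⟩
abbrev Chain.const (X : Cpo) : Chain := ⟨fun _ => X, fun _ => EP.refl X⟩
abbrev Chain.prod (C C' : Chain) : Chain :=
  ⟨fun n => (C.X n).prod (C'.X n), fun n => (C.ep n).prod (C'.ep n)⟩
abbrev Chain.arr (C C' : Chain) : Chain :=
  ⟨fun n => (C.X n).arr (C'.X n), fun n => (C.ep n).arr (C'.ep n)⟩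
abbrev Chain.sum (C C' : Chain) : Chain :=
  ⟨fun n => (C.X n).sum (C'.X n), fun n => (C.ep n).sum (C'.ep n)⟩

/-- The limit of the projections of a chain, which is also the colimit of its embeddings. -/
structure Lim (C : Chain) : Type where
  seq : ∀ n, C.X n
  compat : ∀ n, (C.ep n).p (seq (n + 1)) = seq n

namespace Lim

variable {C C' : Chain}

@[ext] theorem ext {x y : Lim C} (h : ∀ n, x.seq n = y.seq n) : x = y := by
  cases x; cases y; congr; exact funext h

/-- The componentwise order. -/
instance : PartialOrder (Lim C) where
  le x y := ∀ n, x.seq n ≤ y.seq n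
  le_refl _ _ := le_rfl
  le_trans _ _ _ h h' n := (h n).trans (h' n)
  le_antisymm _ _ h h' := ext fun n => (h n).antisymm (h' n)

theorem directed_seq {d : Set (Lim C)} (hd : DirectedOn (· ≤ ·) d) (n : ℕ) :
    DirectedOn (· ≤ ·) ((fun x : Lim C => x.seq n) '' d) := by
  rintro _ ⟨f, hf, rfl⟩ _ ⟨g, hg, rfl⟩
  obtain ⟨k, hk, h1, h2⟩ := hd f hf g hg
  exact ⟨_, ⟨k, hk, rfl⟩, h1 n, h2 n⟩

/-- Directed suprema are computed componentwise. -/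
def dSup (d : Set (Lim C)) (hne : d.Nonempty) (hd : DirectedOn (· ≤ ·) d) : Lim C where
  seq n := sSup ((fun x : Lim C => x.seq n) '' d)
  compat n := by
    have h := ((C.ep n).p.cont (hne.image _) (directed_seq hd (n + 1))
      (directed_seq hd (n + 1)).isLUB_sSup)
    refine h.unique ?_
    rw [Set.image_image]
    simp only [compat]
    exact (directed_seq hd n).isLUB_sSup

open Classical in
instance : CompletePartialOrder (Lim C) where
  bot := ⟨fun _ => ⊥, fun n => (C.ep n).p_bot⟩
  bot_le _ _ := bot_le
  sSup d := if h : d.Nonempty ∧ DirectedOn (· ≤ ·) d then dSup d h.1 h.2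
    else ⟨fun _ => ⊥, fun n => (C.ep n).p_bot⟩
  lubOfDirected d hd := by
    split_ifs with h
    · constructor
      · intro x hx n
        exact (directed_seq hd n).le_sSup ⟨x, hx, rfl⟩
      · intro y hy n
        refine (directed_seq hd n).sSup_le ?_
        rintro _ ⟨x, hx, rfl⟩
        exact hy hx n
    · have : d = ∅ := Set.not_nonempty_iff_eq_empty.1 fun hne => h ⟨hne, hd⟩
      subst this
      exact ⟨fun _ hx => hx.elim, fun _ _ _ => bot_le⟩

/-- Deleting the first term of a chain does not change its bilimit. -/
def shiftIso (C : Chain) : Lim C ≃o Lim C.shift where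
  toFun x := ⟨fun n => x.seq (n + 1), fun n => x.compat (n + 1)⟩
  invFun y := ⟨fun n => match n with
    | 0 => (C.ep 0).p (y.seq 0)
    | n + 1 => y.seq n, fun n => match n with
    | 0 => rfl
    | n + 1 => y.compat n⟩
  left_inv x := ext fun n => match n with
    | 0 => x.compat 0
    | _ + 1 => rfl
  right_inv _ := rfl
  map_rel_iff' {x y} := ⟨fun h n => match n with
    | 0 => by rw [← x.compat 0, ← y.compat 0]; exact (C.ep 0).p.mono (h 0)
    | n + 1 => h n, fun h n => h (n + 1)⟩

/-- The embedding of the first term of a chain into another one. -/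
def up (C : Chain) : ∀ m, SHom (C.X 0) (C.X m)
  | 0 => SHom.id _
  | m + 1 => SHom.comp (C.ep m).e (up C m)

/-- The projection of the bilimit onto a term of the chain. -/
def proj (C : Chain) (n : ℕ) : SHom (Lim C) (C.X n) where
  toFun x := x.seq n
  cont := by
    rw [CompletePartialOrder.scottContinuous]
    intro d hne hd
    have : (sSup d : Lim C) = dSup d hne hd := dif_pos ⟨hne, hd⟩
    rw [this]
    exact (directed_seq hd n).isLUB_sSup

theorem cont_of_seq {Z : Type} [CompletePartialOrder Z] {f : Z → Lim C}
    (h : ∀ n, ScottContinuous fun z => (f z).seq n) : ScottContinuous f := by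
  intro d hne hd a ha
  constructor
  · rintro _ ⟨x, hx, rfl⟩ n
    exact (h n).monotone (ha.1 hx)
  · intro g hg n
    refine (h n hne hd ha).2 ?_
    rintro _ ⟨x, hx, rfl⟩
    exact hg ⟨x, hx, rfl⟩ n

/-- The embedding of a term of the chain into the bilimit. -/
def emb : ∀ (C : Chain) (n : ℕ), SHom (C.X n) (Lim C)
  | C, 0 => ⟨fun x => ⟨fun m => up C m x, fun m => (C.ep m).pe _⟩,
      cont_of_seq fun m => (up C m).cont⟩
  | C, n + 1 => SHom.comp (SHom.ofIso (shiftIso C).symm) (emb C.shift n)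

theorem up_shift (C : Chain) (m : ℕ) (x : C.X 0) :
    up C.shift m ((C.ep 0).e x) = up C (m + 1) x := by
  induction m with
  | zero => rfl
  | succ m ih => exact congrArg (C.ep (m + 1)).e ih

theorem proj_emb (C : Chain) (n : ℕ) (x : C.X n) : (emb C n x).seq n = x := by
  induction n generalizing C with
  | zero => rfl
  | succ n ih => exact ih C.shift x

theorem emb_succ (C : Chain) (n : ℕ) (x : C.X n) : emb C (n + 1) ((C.ep n).e x) = emb C n x := by
  induction n generalizing C with
  | zero =>
    ext m
    cases m with
    | zero => exact (C.ep 0).pe x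
    | succ m => exact up_shift C m x
  | succ n ih => exact congrArg (shiftIso C).symm (ih C.shift x)

theorem emb_proj_le (C : Chain) (n : ℕ) (x : Lim C) : emb C n (x.seq n) ≤ x := by
  induction n generalizing C with
  | zero =>
    intro m
    induction m with
    | zero => exact le_rfl
    | succ m ih =>
      refine ((C.ep m).e.mono ih).trans ?_
      rw [← x.compat m]
      exact (C.ep m).ep _
  | succ n ih =>
    have h := (shiftIso C).symm.monotone (ih C.shift (shiftIso C x))
    rw [OrderIso.symm_apply_apply] at h
    exact h

theorem emb_proj_mono (x : Lim C) : Monotone fun n => emb C n (x.seq n) := by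
  refine monotone_nat_of_le_succ fun n => ?_
  rw [← emb_succ, ← x.compat n]
  exact (emb C (n + 1)).mono ((C.ep n).ep _)

theorem seq_emb_proj {m n : ℕ} (h : m ≤ n) (x : Lim C) : (emb C n (x.seq n)).seq m = x.seq m := by
  refine (emb_proj_le C n x m).antisymm ?_
  have := emb_proj_mono x h m
  rwa [proj_emb] at this

/-- Each element of a bilimit is the supremum of its projections. -/
theorem isLUB_emb_proj (x : Lim C) : IsLUB (Set.range fun n => emb C n (x.seq n)) x := by
  constructor
  · rintro _ ⟨n, rfl⟩
    exact emb_proj_le C n x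
  · intro y hy n
    have := hy ⟨n, rfl⟩ n
    rwa [proj_emb] at this

/-- The bilimit of a constant chain. -/
def constIso (X : Cpo) : X ≃o Lim (Chain.const X) :=
  RelIso.ofSurjective (r := (· ≤ ·)) (s := (· ≤ ·))
    ⟨⟨fun x => ⟨fun _ => x, fun _ => rfl⟩, fun x y h => congrArg (fun z => z.seq 0) h⟩,
      fun {x y} => ⟨fun h => h 0, fun h _ => h⟩⟩
    (by
      intro z
      refine ⟨z.seq 0, ext fun n => ?_⟩
      induction n with
      | zero => rfl
      | succ n ih => exact ih.trans (z.compat n).symm)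

/-- Bilimits commute with products. -/
def prodIso (C C' : Chain) : Lim C × Lim C' ≃o Lim (C.prod C') where
  toFun x := ⟨fun n => (x.1.seq n, x.2.seq n), fun n => Prod.ext (x.1.compat n) (x.2.compat n)⟩
  invFun z := (⟨fun n => (z.seq n).1, fun n => congrArg Prod.fst (z.compat n)⟩,
    ⟨fun n => (z.seq n).2, fun n => congrArg Prod.snd (z.compat n)⟩)
  left_inv _ := rfl
  right_inv _ := rfl
  map_rel_iff' := ⟨fun h => ⟨fun n => (h n).1, fun n => (h n).2⟩, fun h n => ⟨h.1 n, h.2 n⟩⟩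

def ofSum (C C' : Chain) : LSum (Lim C) (Lim C') → Lim (C.sum C')
  | .bot => ⟨fun _ => .bot, fun _ => rfl⟩
  | .inl x => ⟨fun n => .inl (x.seq n), fun n => congrArg LSum.inl (x.compat n)⟩
  | .inr y => ⟨fun n => .inr (y.seq n), fun n => congrArg LSum.inr (y.compat n)⟩

theorem ofSum_le (C C' : Chain) (a b : LSum (Lim C) (Lim C')) :
    ofSum C C' a ≤ ofSum C C' b ↔ a ≤ b := by
  cases a <;> cases b
  case inl.inl => exact Iff.rfl
  case inr.inr => exact Iff.rfl
  case bot.bot => exact ⟨fun _ => trivial, fun _ _ => trivial⟩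
  case bot.inl => exact ⟨fun _ => trivial, fun _ _ => trivial⟩
  case bot.inr => exact ⟨fun _ => trivial, fun _ _ => trivial⟩
  all_goals exact ⟨fun h => (h 0).elim, fun h => h.elim⟩

theorem ofSum_surj (C C' : Chain) : Function.Surjective (ofSum C C') := by
  intro z
  have tag : ∀ n (a : (C.X (n + 1)).sum (C'.X (n + 1))) (b : (C.X n).sum (C'.X n)),
      ((C.sum C').ep n).p a = b →
      (a = LSum.bot ∧ b = LSum.bot) ∨ (∃ x y, a = LSum.inl x ∧ b = LSum.inl y) ∨
      (∃ x y, a = LSum.inr x ∧ b = LSum.inr y) := by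
    rintro n (_ | x | x) _ rfl
    · exact Or.inl ⟨rfl, rfl⟩
    · exact Or.inr (Or.inl ⟨x, _, rfl, rfl⟩)
    · exact Or.inr (Or.inr ⟨x, _, rfl, rfl⟩)
  rcases h0 : z.seq 0 with _ | x | x
  · have h : ∀ n, z.seq n = LSum.bot := by
      intro n
      induction n with
      | zero => exact h0
      | succ n ih =>
        rcases tag n _ _ (z.compat n) with h | ⟨_, _, _, h⟩ | ⟨_, _, _, h⟩
        · exact h.1
        · rw [ih] at h; cases h
        · rw [ih] at h; cases h
    exact ⟨.bot, ext fun n => (h n).symm⟩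
  · have h : ∀ n, ∃ y, z.seq n = LSum.inl y := by
      intro n
      induction n with
      | zero => exact ⟨x, h0⟩
      | succ n ih =>
        obtain ⟨y, ih⟩ := ih
        rcases tag n _ _ (z.compat n) with h | ⟨u, _, h, _⟩ | ⟨_, _, _, h⟩
        · rw [ih] at h; cases h.2
        · exact ⟨u, h⟩
        · rw [ih] at h; cases h
    choose y hy using h
    refine ⟨.inl ⟨y, fun n => ?_⟩, ext fun n => (hy n).symm⟩
    have := z.compat n
    rw [hy, hy] at this
    exact LSum.inl.inj this
  · have h : ∀ n, ∃ y, z.seq n = LSum.inr y := by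
      intro n
      induction n with
      | zero => exact ⟨x, h0⟩
      | succ n ih =>
        obtain ⟨y, ih⟩ := ih
        rcases tag n _ _ (z.compat n) with h | ⟨_, _, _, h⟩ | ⟨u, _, h, _⟩
        · rw [ih] at h; cases h.2
        · rw [ih] at h; cases h
        · exact ⟨u, h⟩
    choose y hy using h
    refine ⟨.inr ⟨y, fun n => ?_⟩, ext fun n => (hy n).symm⟩
    have := z.compat n
    rw [hy, hy] at this
    exact LSum.inr.inj this

/-- Bilimits commute with weak sums. -/
def sumIso (C C' : Chain) : LSum (Lim C) (Lim C') ≃o Lim (C.sum C') :=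
  RelIso.ofSurjective (r := (· ≤ ·)) (s := (· ≤ ·))
    ⟨⟨ofSum C C', fun a b h => le_antisymm ((ofSum_le C C' a b).1 h.le)
      ((ofSum_le C C' b a).1 h.ge)⟩, fun {a b} => ofSum_le C C' a b⟩ (ofSum_surj C C')

theorem arr_mono (f : Lim (C.arr C')) (x : Lim C) :
    Monotone fun n => emb C' n ((SHom.toFun (f.seq n)) (x.seq n)) := by
  refine monotone_nat_of_le_succ fun n => ?_
  have h : (SHom.toFun (f.seq n)) (x.seq n) =
      (C'.ep n).p ((SHom.toFun (f.seq (n + 1))) ((C.ep n).e (x.seq n))) := by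
    conv_lhs => rw [← f.compat n]
    rfl
  show emb C' n ((SHom.toFun (f.seq n)) (x.seq n)) ≤ _
  rw [h, ← emb_succ]
  refine (emb C' (n + 1)).mono (((C'.ep n).ep _).trans (SHom.mono _ ?_))
  rw [← x.compat n]
  exact (C.ep n).ep _

/-- The Scott-continuous function given by a compatible family of functions. -/
def toHom (f : Lim (C.arr C')) : SHom (Lim C) (Lim C') :=
  ⨆ n, SHom.comp (emb C' n) (SHom.comp (f.seq n) (proj C n))

theorem isLUB_toHom (f : Lim (C.arr C')) (x : Lim C) :
    IsLUB (Set.range fun n => emb C' n ((SHom.toFun (f.seq n)) (x.seq n))) (toHom f x) := by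
  have hm : Monotone fun n => SHom.comp (emb C' n) (SHom.comp (f.seq n) (proj C n)) :=
    fun _ _ h x => arr_mono f x h
  have hd := hm.directed_le.directedOn_range
  have h : toHom f x = sSup _ := SHom.sSup_apply hd x
  rw [h]
  have h' := (SHom.directed_apply hd x).isLUB_sSup
  rw [← Set.range_comp] at h' ⊢
  exact h'

/-- The compatible family of functions given by a Scott-continuous function. -/
def ofHom (g : SHom (Lim C) (Lim C')) : Lim (C.arr C') where
  seq n := SHom.comp (proj C' n) (SHom.comp g (emb C n))
  compat n := SHom.ext fun x => by
    show (C'.ep n).p ((g (emb C (n + 1) ((C.ep n).e x))).seq (n + 1)) = (g (emb C n x)).seq n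
    rw [emb_succ, (g (emb C n x)).compat n]

theorem ofHom_toHom (f : Lim (C.arr C')) : ofHom (toHom f) = f := by
  refine ext fun n => SHom.ext fun x => ?_
  have key : ∀ k, n ≤ k →
      (emb C' k ((SHom.toFun (f.seq k)) ((emb C n x).seq k))).seq n = (SHom.toFun (f.seq n)) x := by
    intro k hk
    induction k, hk using Nat.le_induction with
    | base => rw [proj_emb, proj_emb]
    | succ k hk ih =>
      have h1 : emb C k ((emb C n x).seq k) = emb C n x := by
        refine (emb_proj_le C k _).antisymm ?_
        have := emb_proj_mono (emb C n x) hk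
        simpa only [proj_emb] using this
      have h2 : (emb C n x).seq (k + 1) = (C.ep k).e ((emb C n x).seq k) := by
        conv_lhs => rw [← h1, ← emb_succ, proj_emb]
      have h3 : ∀ z, (emb C' (k + 1) z).seq n = (emb C' k ((C'.ep k).p z)).seq n := by
        intro z
        rw [← seq_emb_proj hk (emb C' (k + 1) z), ← (emb C' (k + 1) z).compat k, proj_emb]
      rw [h3, h2, ← ih]
      conv_rhs => rw [← f.compat k]
      rfl
  have hl := (proj C' n).cont (Set.range_nonempty _)
    ((arr_mono f (emb C n x)).directed_le.directedOn_range) (isLUB_toHom f (emb C n x))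
  refine hl.unique ⟨?_, fun b hb => ?_⟩
  · rintro _ ⟨_, ⟨k, rfl⟩, rfl⟩
    refine le_trans ?_ (key (max n k) (le_max_left _ _)).le
    exact arr_mono f (emb C n x) (le_max_right n k) n
  · rw [← key n le_rfl]
    exact hb ⟨_, ⟨n, rfl⟩, rfl⟩

theorem toHom_ofHom (g : SHom (Lim C) (Lim C')) : toHom (ofHom g) = g := by
  refine SHom.ext fun x => (isLUB_toHom (ofHom g) x).unique ⟨?_, fun b hb => ?_⟩
  · rintro _ ⟨n, rfl⟩
    exact (emb_proj_le C' n _).trans (g.mono (emb_proj_le C n x))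
  · refine (g.cont (Set.range_nonempty _) (emb_proj_mono x).directed_le.directedOn_range
      (isLUB_emb_proj x)).2 ?_
    rintro _ ⟨_, ⟨k, rfl⟩, rfl⟩
    refine (isLUB_emb_proj _).2 ?_
    rintro _ ⟨m, rfl⟩
    refine le_trans ?_ (hb ⟨max k m, rfl⟩)
    refine (emb_proj_mono _ (le_max_right k m)).trans ?_
    exact (emb C' _).mono (g.mono (emb_proj_mono x (le_max_left k m)) _)

/-- Bilimits commute with function spaces. -/
def arrIso (C C' : Chain) : SHom (Lim C) (Lim C') ≃o Lim (C.arr C') where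
  toFun := ofHom
  invFun := toHom
  left_inv := toHom_ofHom
  right_inv := ofHom_toHom
  map_rel_iff' {g h} := by
    refine ⟨fun hle x => ?_, fun hle n x => hle _ n⟩
    have e1 : toHom (ofHom g) x ≤ toHom (ofHom h) x := by
      refine (isLUB_toHom (ofHom g) x).2 ?_
      rintro _ ⟨n, rfl⟩
      exact ((emb C' n).mono (hle n _)).trans ((isLUB_toHom (ofHom h) x).1 ⟨n, rfl⟩)
    rwa [toHom_ofHom, toHom_ofHom] at e1

end Lim

abbrev Cpo.lim (C : Chain) : Cpo := ⟨Lim C⟩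

/-! ## Pure types and their interpretation -/

/-- Type expressions with `n` free type variables (de Bruijn); `mu` binds a type variable. -/
inductive Ty : ℕ → Type
  | unit {n : ℕ} : Ty n
  | prod {n : ℕ} (P Q : Ty n) : Ty n
  | arr {n : ℕ} (Q P : Ty n) : Ty n
  | sum {n : ℕ} (P Q : Ty n) : Ty n
  | var {n : ℕ} (i : Fin n) : Ty n
  | mu {n : ℕ} (P : Ty (n + 1)) : Ty n

namespace Ty

def rename : {n m : ℕ} → (Fin n → Fin m) → Ty n → Ty m
  | _, _, _, unit => unit
  | _, _, r, prod P Q => prod (rename r P) (rename r Q)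
  | _, _, r, arr Q P => arr (rename r Q) (rename r P)
  | _, _, r, sum P Q => sum (rename r P) (rename r Q)
  | _, _, r, var i => var (r i)
  | _, _, r, mu P => mu (rename (Fin.cases 0 fun i => (r i).succ) P)

def subst : {n m : ℕ} → (Fin n → Ty m) → Ty n → Ty m
  | _, _, _, unit => unit
  | _, _, σ, prod P Q => prod (subst σ P) (subst σ Q)
  | _, _, σ, arr Q P => arr (subst σ Q) (subst σ P)
  | _, _, σ, sum P Q => sum (subst σ P) (subst σ Q)
  | _, _, σ, var i => σ i
  | _, _, σ, mu P => mu (subst (Fin.cases (var 0) fun i => rename Fin.succ (σ i)) P)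

/-- `P[mu P]`. -/
def unfold (P : Ty 1) : Ty 0 := subst (fun _ => mu P) P

end Ty

/-- Pure types are the closed type expressions. -/
abbrev PTy : Type := Ty 0

/-- The finite approximations of the domains of all pure types. They are obtained by iterating,
from the one-point cpo at each type, the functor which is given on families of domains indexed by
pure types by the domain equations
`D unit = two`, `D (P × Q) = D P × D Q`, `D (Q → P) = (D Q → D P)`, `D (P + Q) = (D P ⨿ D Q)_⊥`,
`D (mu P) = D (P[mu P])`. -/
def approx : ℕ → PTy → Cpo
  | 0, _ => Cpo.one
  | _ + 1, .unit => Cpo.two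
  | n + 1, .prod P Q => (approx n P).prod (approx n Q)
  | n + 1, .arr Q P => (approx n Q).arr (approx n P)
  | n + 1, .sum P Q => (approx n P).sum (approx n Q)
  | n + 1, .mu P => approx n P.unfold

/-- The action of that functor on the unique pair out of the initial family. -/
def approxEP : ∀ (n : ℕ) (P : PTy), EP (approx n P) (approx (n + 1) P)
  | 0, _ => EP.init _
  | _ + 1, .unit => EP.refl _
  | n + 1, .prod P Q => (approxEP n P).prod (approxEP n Q)
  | n + 1, .arr Q P => (approxEP n Q).arr (approxEP n P)
  | n + 1, .sum P Q => (approxEP n P).sum (approxEP n Q)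
  | n + 1, .mu P => approxEP n P.unfold

abbrev tyChain (P : PTy) : Chain := ⟨fun n => approx n P, fun n => approxEP n P⟩

/-- The domain interpreting a pure type: the canonical (bilimit) simultaneous solution
of the above domain equations, whose isomorphisms are given below. -/
abbrev dom (P : PTy) : Cpo := Cpo.lim (tyChain P)

def unitIso : Bool ≃o dom .unit :=
  (Lim.constIso Cpo.two).trans (Lim.shiftIso (tyChain .unit)).symm

def prodIso (P Q : PTy) : (dom P × dom Q) ≃o dom (.prod P Q) :=
  (Lim.prodIso (tyChain P) (tyChain Q)).trans (Lim.shiftIso (tyChain (.prod P Q))).symm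

def arrIso (Q P : PTy) : SHom (dom Q) (dom P) ≃o dom (.arr Q P) :=
  (Lim.arrIso (tyChain Q) (tyChain P)).trans (Lim.shiftIso (tyChain (.arr Q P))).symm

def sumIso (P Q : PTy) : LSum (dom P) (dom Q) ≃o dom (.sum P Q) :=
  (Lim.sumIso (tyChain P) (tyChain Q)).trans (Lim.shiftIso (tyChain (.sum P Q))).symm

/-- `fold` from left to right, `unfold` from right to left. -/
def muIso (P : Ty 1) : dom P.unfold ≃o dom (.mu P) :=
  (Lim.shiftIso (tyChain (.mu P))).symm

/-! ## Terms and pure typing -/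

/-- Raw terms, with de Bruijn indices for variables; `lam` and `fix` bind one variable, `case`
binds one variable in each of its two branches. -/
inductive Tm : Type
  | star : Tm
  | pair (M N : Tm) : Tm
  | fst (M : Tm) : Tm
  | snd (M : Tm) : Tm
  | var (i : ℕ) : Tm
  | lam (M : Tm) : Tm
  | app (M N : Tm) : Tm
  | fix (M : Tm) : Tm
  | fold (M : Tm) : Tm
  | unfold (M : Tm) : Tm
  | inl (M : Tm) : Tm
  | inr (M : Tm) : Tm
  | case (M N₁ N₂ : Tm) : Tm

/-- Occurrences of `a` in a list. -/
inductive Var {α : Type} : List α → α → Type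
  | zero {l : List α} {a : α} : Var (a :: l) a
  | succ {l : List α} {a b : α} (v : Var l a) : Var (b :: l) a

/-- The position of an occurrence. -/
def Var.idx {α : Type} : {l : List α} → {a : α} → Var l a → ℕ
  | _, _, .zero => 0
  | _, _, .succ v => v.idx + 1

/-- Families over the occurrences in a list with one more element. -/
def Var.elim {α : Type} {F : α → Type} {l : List α} {a : α} (z : F a)
    (s : ∀ b, Var l b → F b) : ∀ b, Var (a :: l) b → F b
  | _, .zero => z
  | _, .succ v => s _ v

/-- Derivations of `Γ ⊢ M : P` in the pure system. -/
inductive PTyping : List PTy → Tm → PTy → Type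
  | var {Γ : List PTy} {P : PTy} (v : Var Γ P) : PTyping Γ (.var v.idx) P
  | star {Γ : List PTy} : PTyping Γ .star .unit
  | pair {Γ : List PTy} {M N : Tm} {P Q : PTy} :
      PTyping Γ M P → PTyping Γ N Q → PTyping Γ (.pair M N) (.prod P Q)
  | fst {Γ : List PTy} {M : Tm} {P Q : PTy} : PTyping Γ M (.prod P Q) → PTyping Γ (.fst M) P
  | snd {Γ : List PTy} {M : Tm} {P Q : PTy} : PTyping Γ M (.prod P Q) → PTyping Γ (.snd M) Q
  | lam {Γ : List PTy} {M : Tm} {P Q : PTy} :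
      PTyping (Q :: Γ) M P → PTyping Γ (.lam M) (.arr Q P)
  | app {Γ : List PTy} {M N : Tm} {P Q : PTy} :
      PTyping Γ M (.arr Q P) → PTyping Γ N Q → PTyping Γ (.app M N) P
  | fix {Γ : List PTy} {M : Tm} {P : PTy} : PTyping (P :: Γ) M P → PTyping Γ (.fix M) P
  | fold {Γ : List PTy} {M : Tm} {P : Ty 1} :
      PTyping Γ M P.unfold → PTyping Γ (.fold M) (.mu P)
  | unfold {Γ : List PTy} {M : Tm} {P : Ty 1} :
      PTyping Γ M (.mu P) → PTyping Γ (.unfold M) P.unfold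
  | inl {Γ : List PTy} {M : Tm} {P Q : PTy} : PTyping Γ M P → PTyping Γ (.inl M) (.sum P Q)
  | inr {Γ : List PTy} {M : Tm} {P Q : PTy} : PTyping Γ M Q → PTyping Γ (.inr M) (.sum P Q)
  | case {Γ : List PTy} {M N₁ N₂ : Tm} {P₁ P₂ Q : PTy} :
      PTyping Γ M (.sum P₁ P₂) → PTyping (P₁ :: Γ) N₁ Q → PTyping (P₂ :: Γ) N₂ Q →
      PTyping Γ (.case M N₁ N₂) Q

/-- The domain interpreting a pure typing context. -/
def ctxDom : List PTy → Cpo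
  | [] => Cpo.one
  | P :: Γ => (dom P).prod (ctxDom Γ)

def Var.sem : {Γ : List PTy} → {P : PTy} → Var Γ P → SHom (ctxDom Γ) (dom P)
  | _, _, .zero => SHom.fst
  | _, _, .succ v => SHom.comp v.sem SHom.snd

/-- The Scott-continuous function interpreting a typed term. -/
def PTyping.sem : {Γ : List PTy} → {M : Tm} → {P : PTy} → PTyping Γ M P →
    SHom (ctxDom Γ) (dom P)
  | _, _, _, .var v => v.sem
  | _, _, _, .star => SHom.const _ (unitIso true)
  | _, _, _, .pair (P := P) (Q := Q) d d' =>
      SHom.comp (SHom.ofIso (prodIso P Q)) (SHom.pair d.sem d'.sem)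
  | _, _, _, .fst (P := P) (Q := Q) d =>
      SHom.comp SHom.fst (SHom.comp (SHom.ofIso (prodIso P Q).symm) d.sem)
  | _, _, _, .snd (P := P) (Q := Q) d =>
      SHom.comp SHom.snd (SHom.comp (SHom.ofIso (prodIso P Q).symm) d.sem)
  | _, _, _, .lam (P := P) (Q := Q) d =>
      SHom.comp (SHom.ofIso (arrIso Q P)) (SHom.curry d.sem)
  | _, _, _, .app (P := P) (Q := Q) d d' =>
      SHom.comp SHom.eval
        (SHom.pair (SHom.comp (SHom.ofIso (arrIso Q P).symm) d.sem) d'.sem)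
  | _, _, _, .fix d => SHom.comp (SHom.lfp _) (SHom.curry d.sem)
  | _, _, _, .fold (P := P) d => SHom.comp (SHom.ofIso (muIso P)) d.sem
  | _, _, _, .unfold (P := P) d => SHom.comp (SHom.ofIso (muIso P).symm) d.sem
  | _, _, _, .inl (P := P) (Q := Q) d =>
      SHom.comp (SHom.ofIso (sumIso P Q)) (SHom.comp SHom.inl d.sem)
  | _, _, _, .inr (P := P) (Q := Q) d =>
      SHom.comp (SHom.ofIso (sumIso P Q)) (SHom.comp SHom.inr d.sem)
  | _, _, _, .case (P₁ := P₁) (P₂ := P₂) d d₁ d₂ =>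
      SHom.case (SHom.comp (SHom.ofIso (sumIso P₁ P₂).symm) d.sem) d₁.sem d₂.sem

/-! ## Formulae -/

/-- Iteration terms with `k` free iteration variables. -/
inductive ItTm (k : ℕ) : Type
  | var (i : Fin k) : ItTm k
  | zero : ItTm k
  | succ (t : ItTm k) : ItTm k

namespace ItTm

def subst {k k' : ℕ} (σ : Fin k → ItTm k') : ItTm k → ItTm k'
  | var i => σ i
  | zero => zero
  | succ t => succ (subst σ t)

/-- The substitution under a binder. -/
def lift {k k' : ℕ} (σ : Fin k → ItTm k') : Fin (k + 1) → ItTm (k' + 1) :=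
  Fin.cases (var 0) fun i => (σ i).subst fun j => var j.succ

def Free {k : ℕ} (i : Fin k) : ItTm k → Prop
  | var j => i = j
  | zero => False
  | succ t => Free i t

def sem {k : ℕ} (ρ : Fin k → ℕ) : ItTm k → ℕ
  | var i => ρ i
  | zero => 0
  | succ t => sem ρ t + 1

end ItTm

/-- The modalities taking formulae of type `P` to formulae of type `Q`. -/
inductive Modality : PTy → PTy → Type
  | fst {P Q : PTy} : Modality P (.prod P Q)
  | snd {P Q : PTy} : Modality Q (.prod P Q)
  | inl {P Q : PTy} : Modality P (.sum P Q)
  | inr {P Q : PTy} : Modality Q (.sum P Q)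
  | fold {P : Ty 1} : Modality P.unfold (.mu P)

/-- Being one of the two injections. -/
def Modality.IsInj : {P Q : PTy} → Modality P Q → Prop
  | _, _, .inl => True
  | _, _, .inr => True
  | _, _, _ => False

/-- The type-correct formulae of type `P` with `k` free iteration variables over the fixpoint
context `Δ`, regardless of polarities. `mu t φ` and `nu t φ` are the bounded iterations,
which bind a fixpoint variable; `ex` and `all` bind an iteration variable. -/
inductive Fm : ℕ → List PTy → PTy → Type
  | tru {k : ℕ} {Δ : List PTy} {P : PTy} : Fm k Δ P
  | fls {k : ℕ} {Δ : List PTy} {P : PTy} : Fm k Δ P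
  | and {k : ℕ} {Δ : List PTy} {P : PTy} (φ ψ : Fm k Δ P) : Fm k Δ P
  | or {k : ℕ} {Δ : List PTy} {P : PTy} (φ ψ : Fm k Δ P) : Fm k Δ P
  | star {k : ℕ} {Δ : List PTy} : Fm k Δ .unit
  | mod {k : ℕ} {Δ : List PTy} {P Q : PTy} (m : Modality P Q) (φ : Fm k Δ P) : Fm k Δ Q
  | fp {k : ℕ} {Δ : List PTy} {P : PTy} (v : Var Δ P) : Fm k Δ P
  | mu {k : ℕ} {Δ : List PTy} {P : PTy} (t : ItTm k) (φ : Fm k (P :: Δ) P) : Fm k Δ P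
  | nu {k : ℕ} {Δ : List PTy} {P : PTy} (t : ItTm k) (φ : Fm k (P :: Δ) P) : Fm k Δ P
  | ex {k : ℕ} {Δ : List PTy} {P : PTy} (φ : Fm (k + 1) Δ P) : Fm k Δ P
  | all {k : ℕ} {Δ : List PTy} {P : PTy} (φ : Fm (k + 1) Δ P) : Fm k Δ P
  | imp {k : ℕ} {Δ : List PTy} {Q P : PTy} (ψ : Fm k [] Q) (φ : Fm k [] P) : Fm k Δ (.arr Q P)

namespace Fm

/-- Substitution of iteration terms for iteration variables. -/
def substIt : {k k' : ℕ} → {Δ : List PTy} → {P : PTy} → (Fin k → ItTm k') → Fm k Δ P → Fm k' Δ P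
  | _, _, _, _, _, tru => tru
  | _, _, _, _, _, fls => fls
  | _, _, _, _, σ, and φ ψ => and (substIt σ φ) (substIt σ ψ)
  | _, _, _, _, σ, or φ ψ => or (substIt σ φ) (substIt σ ψ)
  | _, _, _, _, _, star => star
  | _, _, _, _, σ, mod m φ => mod m (substIt σ φ)
  | _, _, _, _, _, fp v => fp v
  | _, _, _, _, σ, mu t φ => mu (t.subst σ) (substIt σ φ)
  | _, _, _, _, σ, nu t φ => nu (t.subst σ) (substIt σ φ)
  | _, _, _, _, σ, ex φ => ex (substIt (ItTm.lift σ) φ)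
  | _, _, _, _, σ, all φ => all (substIt (ItTm.lift σ) φ)
  | _, _, _, _, σ, imp ψ φ => imp (substIt σ ψ) (substIt σ φ)

/-- Weakening by one iteration variable, which then does not occur freely. -/
def wkIt {k : ℕ} {Δ : List PTy} {P : PTy} (φ : Fm k Δ P) : Fm (k + 1) Δ P :=
  substIt (fun i => .var i.succ) φ

/-- `φ[t]`, where `t` replaces the iteration variable with index `0`. -/
def instIt {k : ℕ} {Δ : List PTy} {P : PTy} (φ : Fm (k + 1) Δ P) (t : ItTm k) : Fm k Δ P :=
  substIt (Fin.cases t fun i => .var i) φ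

/-- Identification of the iteration variables with indices `0` and `1`. -/
def mergeIt {k : ℕ} {Δ : List PTy} {P : PTy} (φ : Fm (k + 2) Δ P) : Fm (k + 1) Δ P :=
  φ.instIt (.var 0)

/-- Renaming of fixpoint variables. -/
def renFp : {k : ℕ} → {Δ Δ' : List PTy} → {P : PTy} → (∀ Q, Var Δ Q → Var Δ' Q) →
    Fm k Δ P → Fm k Δ' P
  | _, _, _, _, _, tru => tru
  | _, _, _, _, _, fls => fls
  | _, _, _, _, r, and φ ψ => and (renFp r φ) (renFp r ψ)
  | _, _, _, _, r, or φ ψ => or (renFp r φ) (renFp r ψ)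
  | _, _, _, _, _, star => star
  | _, _, _, _, r, mod m φ => mod m (renFp r φ)
  | _, _, _, _, r, fp v => fp (r _ v)
  | _, _, _, _, r, mu t φ => mu t (renFp (Var.elim .zero fun _ v => .succ (r _ v)) φ)
  | _, _, _, _, r, nu t φ => nu t (renFp (Var.elim .zero fun _ v => .succ (r _ v)) φ)
  | _, _, _, _, r, ex φ => ex (renFp r φ)
  | _, _, _, _, r, all φ => all (renFp r φ)
  | _, _, _, _, _, imp ψ φ => imp ψ φ

/-- Substitution of formulae for fixpoint variables. -/
def substFp : {k : ℕ} → {Δ Δ' : List PTy} → {P : PTy} → (∀ Q, Var Δ Q → Fm k Δ' Q) →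
    Fm k Δ P → Fm k Δ' P
  | _, _, _, _, _, tru => tru
  | _, _, _, _, _, fls => fls
  | _, _, _, _, σ, and φ ψ => and (substFp σ φ) (substFp σ ψ)
  | _, _, _, _, σ, or φ ψ => or (substFp σ φ) (substFp σ ψ)
  | _, _, _, _, _, star => star
  | _, _, _, _, σ, mod m φ => mod m (substFp σ φ)
  | _, _, _, _, σ, fp v => σ _ v
  | _, _, _, _, σ, mu t φ => mu t (substFp (Var.elim (fp .zero) fun _ v => renFp (fun _ => .succ) (σ _ v)) φ)
  | _, _, _, _, σ, nu t φ => nu t (substFp (Var.elim (fp .zero) fun _ v => renFp (fun _ => .succ) (σ _ v)) φ)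
  | _, _, _, _, σ, ex φ => ex (substFp (fun _ v => wkIt (σ _ v)) φ)
  | _, _, _, _, σ, all φ => all (substFp (fun _ v => wkIt (σ _ v)) φ)
  | _, _, _, _, _, imp ψ φ => imp ψ φ

/-- `φ[ψ]`, where `ψ` replaces the last fixpoint variable. -/
def instFp {k : ℕ} {Δ : List PTy} {P Q : PTy} (φ : Fm k (Q :: Δ) P) (ψ : Fm k Δ Q) : Fm k Δ P :=
  substFp (Var.elim ψ fun _ v => fp v) φ

/-- The iteration variable `i` occurs freely. -/
def Free : {k : ℕ} → {Δ : List PTy} → {P : PTy} → Fin k → Fm k Δ P → Prop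
  | _, _, _, _, tru => False
  | _, _, _, _, fls => False
  | _, _, _, i, and φ ψ => Free i φ ∨ Free i ψ
  | _, _, _, i, or φ ψ => Free i φ ∨ Free i ψ
  | _, _, _, _, star => False
  | _, _, _, i, mod _ φ => Free i φ
  | _, _, _, _, fp _ => False
  | _, _, _, i, mu t φ => t.Free i ∨ Free i φ
  | _, _, _, i, nu t φ => t.Free i ∨ Free i φ
  | _, _, _, i, ex φ => Free i.succ φ
  | _, _, _, i, all φ => Free i.succ φ
  | _, _, _, i, imp ψ φ => Free i ψ ∨ Free i φ

/-- The conjunctive fragment: `⊤`, `⊥`, conjunctions, modalities and realizability implications. -/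
def IsConj : {k : ℕ} → {Δ : List PTy} → {P : PTy} → Fm k Δ P → Prop
  | _, _, _, tru => True
  | _, _, _, fls => True
  | _, _, _, and φ ψ => IsConj φ ∧ IsConj ψ
  | _, _, _, star => True
  | _, _, _, mod _ φ => IsConj φ
  | _, _, _, imp ψ φ => IsConj ψ ∧ IsConj φ
  | _, _, _, _ => False

/-- Finite conjunctions. -/
def bigAnd {k : ℕ} {Δ : List PTy} {P : PTy} : List (Fm k Δ P) → Fm k Δ P
  | [] => tru
  | φ :: l => and φ (bigAnd l)

end Fm

mutual

/-- The iteration variable `i` is positive in a formula. -/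
inductive Pos : {k : ℕ} → {Δ : List PTy} → {P : PTy} → Fin k → Fm k Δ P → Prop
  | notFree {k : ℕ} {Δ : List PTy} {P : PTy} {i : Fin k} {φ : Fm k Δ P} : ¬ φ.Free i → Pos i φ
  | and {k : ℕ} {Δ : List PTy} {P : PTy} {i : Fin k} {φ ψ : Fm k Δ P} :
      Pos i φ → Pos i ψ → Pos i (φ.and ψ)
  | or {k : ℕ} {Δ : List PTy} {P : PTy} {i : Fin k} {φ ψ : Fm k Δ P} :
      Pos i φ → Pos i ψ → Pos i (φ.or ψ)
  | mod {k : ℕ} {Δ : List PTy} {P Q : PTy} {i : Fin k} {m : Modality P Q} {φ : Fm k Δ P} :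
      Pos i φ → Pos i (φ.mod m)
  | imp {k : ℕ} {Δ : List PTy} {P Q : PTy} {i : Fin k} {ψ : Fm k [] Q} {φ : Fm k [] P} :
      Neg i ψ → Pos i φ → Pos i (Fm.imp (Δ := Δ) ψ φ)
  | ex {k : ℕ} {Δ : List PTy} {P : PTy} {i : Fin k} {φ : Fm (k + 1) Δ P} :
      Pos i.succ φ → Pos i φ.ex
  | mu {k : ℕ} {Δ : List PTy} {P : PTy} {i : Fin k} {t : ItTm k} {φ : Fm k (P :: Δ) P} :
      Pos i φ → Pos i (φ.mu t)
  | nu {k : ℕ} {Δ : List PTy} {P : PTy} {i : Fin k} {t : ItTm k} {φ : Fm k (P :: Δ) P} :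
      Pos i φ → ¬ t.Free i → Pos i (φ.nu t)

/-- The iteration variable `i` is negative in a formula. -/
inductive Neg : {k : ℕ} → {Δ : List PTy} → {P : PTy} → Fin k → Fm k Δ P → Prop
  | notFree {k : ℕ} {Δ : List PTy} {P : PTy} {i : Fin k} {φ : Fm k Δ P} : ¬ φ.Free i → Neg i φ
  | and {k : ℕ} {Δ : List PTy} {P : PTy} {i : Fin k} {φ ψ : Fm k Δ P} :
      Neg i φ → Neg i ψ → Neg i (φ.and ψ)
  | or {k : ℕ} {Δ : List PTy} {P : PTy} {i : Fin k} {φ ψ : Fm k Δ P} :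
      Neg i φ → Neg i ψ → Neg i (φ.or ψ)
  | mod {k : ℕ} {Δ : List PTy} {P Q : PTy} {i : Fin k} {m : Modality P Q} {φ : Fm k Δ P} :
      Neg i φ → Neg i (φ.mod m)
  | imp {k : ℕ} {Δ : List PTy} {P Q : PTy} {i : Fin k} {ψ : Fm k [] Q} {φ : Fm k [] P} :
      Pos i ψ → Neg i φ → Neg i (Fm.imp (Δ := Δ) ψ φ)
  | all {k : ℕ} {Δ : List PTy} {P : PTy} {i : Fin k} {φ : Fm (k + 1) Δ P} :
      Neg i.succ φ → Neg i φ.all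
  | nu {k : ℕ} {Δ : List PTy} {P : PTy} {i : Fin k} {t : ItTm k} {φ : Fm k (P :: Δ) P} :
      Neg i φ → Neg i (φ.nu t)
  | mu {k : ℕ} {Δ : List PTy} {P : PTy} {i : Fin k} {t : ItTm k} {φ : Fm k (P :: Δ) P} :
      Neg i φ → ¬ t.Free i → Neg i (φ.mu t)

end

/-- Polarities: neutral, positive, negative. -/
inductive Sign : Type
  | neutral | pos | neg

/-- The opposite polarity. -/
def Sign.opp : Sign → Sign
  | neutral => neutral
  | pos => neg
  | neg => pos

/-- `InL s φ`: the formula `φ` belongs to the language of polarity `s`. -/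
inductive InL : {k : ℕ} → {Δ : List PTy} → {P : PTy} → Sign → Fm k Δ P → Prop
  | tru {k : ℕ} {Δ : List PTy} {P : PTy} {s : Sign} : InL s (Fm.tru : Fm k Δ P)
  | fls {k : ℕ} {Δ : List PTy} {P : PTy} {s : Sign} : InL s (Fm.fls : Fm k Δ P)
  | and {k : ℕ} {Δ : List PTy} {P : PTy} {s : Sign} {φ ψ : Fm k Δ P} :
      InL s φ → InL s ψ → InL s (φ.and ψ)
  | or {k : ℕ} {Δ : List PTy} {P : PTy} {s : Sign} {φ ψ : Fm k Δ P} :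
      InL s φ → InL s ψ → InL s (φ.or ψ)
  | star {k : ℕ} {Δ : List PTy} {s : Sign} : InL s (Fm.star : Fm k Δ .unit)
  | mod {k : ℕ} {Δ : List PTy} {P Q : PTy} {s : Sign} {m : Modality P Q} {φ : Fm k Δ P} :
      InL s φ → InL s (φ.mod m)
  | fp {k : ℕ} {Δ : List PTy} {P : PTy} {s : Sign} {v : Var Δ P} : InL s (Fm.fp v : Fm k Δ P)
  | mu {k : ℕ} {Δ : List PTy} {P : PTy} {s : Sign} {t : ItTm k} {φ : Fm k (P :: Δ) P} :
      InL s φ → InL s (φ.mu t)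
  | nu {k : ℕ} {Δ : List PTy} {P : PTy} {s : Sign} {t : ItTm k} {φ : Fm k (P :: Δ) P} :
      InL s φ → InL s (φ.nu t)
  | ex {k : ℕ} {Δ : List PTy} {P : PTy} {φ : Fm (k + 1) Δ P} :
      InL .pos φ → Pos 0 φ → InL .pos φ.ex
  | all {k : ℕ} {Δ : List PTy} {P : PTy} {φ : Fm (k + 1) Δ P} :
      InL .neg φ → Neg 0 φ → InL .neg φ.all
  | imp {k : ℕ} {Δ : List PTy} {P Q : PTy} {s : Sign} {ψ : Fm k [] Q} {φ : Fm k [] P} :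
      InL s.opp ψ → InL s φ → InL s (Fm.imp (Δ := Δ) ψ φ)

/-! ## Deduction -/

mutual

/-- Derivable sequents `ψ ⊢ φ` between formulae of polarity `s`. -/
inductive Ded : {k : ℕ} → {Δ : List PTy} → {P : PTy} → Sign → Fm k Δ P → Fm k Δ P → Prop
  -- propositional rules
  | id {k : ℕ} {Δ : List PTy} {P : PTy} {s : Sign} {φ : Fm k Δ P} : InL s φ → Ded s φ φ
  | cut {k : ℕ} {Δ : List PTy} {P : PTy} {s : Sign} {ψ θ φ : Fm k Δ P} :
      Ded s ψ θ → Ded s θ φ → Ded s ψ φ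
  | distr {k : ℕ} {Δ : List PTy} {P : PTy} {s : Sign} {ψ φ θ : Fm k Δ P} :
      InL s ψ → InL s φ → InL s θ →
      Ded s (ψ.and (φ.or θ)) ((ψ.and φ).or (ψ.and θ))
  | andR {k : ℕ} {Δ : List PTy} {P : PTy} {s : Sign} {ψ φ₁ φ₂ : Fm k Δ P} :
      Ded s ψ φ₁ → Ded s ψ φ₂ → Ded s ψ (φ₁.and φ₂)
  | andL₁ {k : ℕ} {Δ : List PTy} {P : PTy} {s : Sign} {ψ₁ ψ₂ φ : Fm k Δ P} :
      InL s ψ₂ → Ded s ψ₁ φ → Ded s (ψ₁.and ψ₂) φ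
  | andL₂ {k : ℕ} {Δ : List PTy} {P : PTy} {s : Sign} {ψ₁ ψ₂ φ : Fm k Δ P} :
      InL s ψ₁ → Ded s ψ₂ φ → Ded s (ψ₁.and ψ₂) φ
  | truR {k : ℕ} {Δ : List PTy} {P : PTy} {s : Sign} {ψ : Fm k Δ P} : InL s ψ → Ded s ψ .tru
  | orR₁ {k : ℕ} {Δ : List PTy} {P : PTy} {s : Sign} {ψ φ₁ φ₂ : Fm k Δ P} :
      InL s φ₂ → Ded s ψ φ₁ → Ded s ψ (φ₁.or φ₂)
  | orR₂ {k : ℕ} {Δ : List PTy} {P : PTy} {s : Sign} {ψ φ₁ φ₂ : Fm k Δ P} :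
      InL s φ₁ → Ded s ψ φ₂ → Ded s ψ (φ₁.or φ₂)
  | orL {k : ℕ} {Δ : List PTy} {P : PTy} {s : Sign} {ψ₁ ψ₂ φ : Fm k Δ P} :
      Ded s ψ₁ φ → Ded s ψ₂ φ → Ded s (ψ₁.or ψ₂) φ
  | flsL {k : ℕ} {Δ : List PTy} {P : PTy} {s : Sign} {φ : Fm k Δ P} : InL s φ → Ded s .fls φ
  -- modal rules
  | injDisj {k : ℕ} {Δ : List PTy} {P Q : PTy} {s : Sign} {φ : Fm k Δ P} {ψ : Fm k Δ Q} :
      InL s φ → InL s ψ → Ded s ((φ.mod .inl).and (ψ.mod .inr)) .fls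
  | modMono {k : ℕ} {Δ : List PTy} {P Q : PTy} {s : Sign} {m : Modality P Q} {ψ φ : Fm k Δ P} :
      Ded s ψ φ → Ded s (ψ.mod m) (φ.mod m)
  | modAnd {k : ℕ} {Δ : List PTy} {P Q : PTy} {s : Sign} {m : Modality P Q} {φ₁ φ₂ : Fm k Δ P} :
      InL s φ₁ → InL s φ₂ → Ded s ((φ₁.mod m).and (φ₂.mod m)) ((φ₁.and φ₂).mod m)
  | modTru {k : ℕ} {Δ : List PTy} {P Q : PTy} {s : Sign} {m : Modality P Q} :
      ¬ m.IsInj → Ded s (Fm.tru : Fm k Δ Q) (Fm.tru.mod m)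
  | modAll {k : ℕ} {Δ : List PTy} {P Q : PTy} {s : Sign} {m : Modality P Q}
      {φ : Fm (k + 1) Δ P} :
      InL s φ.all → Ded s (φ.mod m).all (φ.all.mod m)
  | modOr {k : ℕ} {Δ : List PTy} {P Q : PTy} {s : Sign} {m : Modality P Q} {φ₁ φ₂ : Fm k Δ P} :
      InL s φ₁ → InL s φ₂ → Ded s ((φ₁.or φ₂).mod m) ((φ₁.mod m).or (φ₂.mod m))
  | modFls {k : ℕ} {Δ : List PTy} {P Q : PTy} {s : Sign} {m : Modality P Q} :
      Ded s (Fm.mod m (Fm.fls : Fm k Δ P)) .fls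
  | modEx {k : ℕ} {Δ : List PTy} {P Q : PTy} {s : Sign} {m : Modality P Q}
      {φ : Fm (k + 1) Δ P} :
      InL s φ.ex → Ded s (φ.ex.mod m) (φ.mod m).ex
  -- quantifier rules
  | exR {k : ℕ} {Δ : List PTy} {P : PTy} {s : Sign} {ψ : Fm k Δ P} {φ : Fm (k + 1) Δ P}
      (t : ItTm k) : InL s φ.ex → Ded s ψ (φ.instIt t) → Ded s ψ φ.ex
  | exL {k : ℕ} {Δ : List PTy} {P : PTy} {s : Sign} {θ ψ : Fm k Δ P} {φ : Fm (k + 1) Δ P} :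
      InL s θ → InL s φ.ex → InL s ψ → Ded s (θ.wkIt.and φ) ψ.wkIt → Ded s (θ.and φ.ex) ψ
  | exMerge {k : ℕ} {Δ : List PTy} {P : PTy} {s : Sign} {φ : Fm (k + 2) Δ P} :
      InL s φ.ex.ex → InL s φ.mergeIt.ex → Ded s φ.ex.ex φ.mergeIt.ex
  | allL {k : ℕ} {Δ : List PTy} {P : PTy} {s : Sign} {ψ : Fm k Δ P} {φ : Fm (k + 1) Δ P}
      (t : ItTm k) : InL s φ.all → Ded s (φ.instIt t) ψ → Ded s φ.all ψ
  | allR {k : ℕ} {Δ : List PTy} {P : PTy} {s : Sign} {θ ψ : Fm k Δ P} {φ : Fm (k + 1) Δ P} :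
      InL s θ → InL s φ.all → InL s ψ → Ded s ψ.wkIt (φ.or θ.wkIt) → Ded s ψ (φ.all.or θ)
  | allMerge {k : ℕ} {Δ : List PTy} {P : PTy} {s : Sign} {φ : Fm (k + 2) Δ P} :
      InL s φ.all.all → InL s φ.mergeIt.all → Ded s φ.mergeIt.all φ.all.all
  | muEx {k : ℕ} {Δ : List PTy} {P : PTy} {s : Sign} {t : ItTm k} {φ : Fm (k + 1) (P :: Δ) P} :
      InL s φ.ex → Ded s (φ.ex.mu t) (φ.mu (t.subst fun i => .var i.succ)).ex
  | nuEx {k : ℕ} {Δ : List PTy} {P : PTy} {s : Sign} {t : ItTm k} {φ : Fm (k + 1) (P :: Δ) P} :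
      InL s φ.ex → Ded s (φ.ex.nu t) (φ.nu (t.subst fun i => .var i.succ)).ex
  | muAll {k : ℕ} {Δ : List PTy} {P : PTy} {s : Sign} {t : ItTm k} {φ : Fm (k + 1) (P :: Δ) P} :
      InL s φ.all → Ded s (φ.mu (t.subst fun i => .var i.succ)).all (φ.all.mu t)
  | nuAll {k : ℕ} {Δ : List PTy} {P : PTy} {s : Sign} {t : ItTm k} {φ : Fm (k + 1) (P :: Δ) P} :
      InL s φ.all → Ded s (φ.nu (t.subst fun i => .var i.succ)).all (φ.all.nu t)
  -- bounded iteration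
  | muZero {k : ℕ} {Δ : List PTy} {P : PTy} {s : Sign} {φ : Fm k (P :: Δ) P} :
      InL s φ → Ded s (φ.mu .zero) .fls
  | muSuccL {k : ℕ} {Δ : List PTy} {P : PTy} {s : Sign} {t : ItTm k} {φ : Fm k (P :: Δ) P}
      {ψ : Fm k Δ P} : InL s φ → Ded s (φ.mu t) ψ → Ded s (φ.mu t.succ) (φ.instFp ψ)
  | muSuccR {k : ℕ} {Δ : List PTy} {P : PTy} {s : Sign} {t : ItTm k} {φ : Fm k (P :: Δ) P} :
      InL s φ → Ded s (φ.instFp (φ.mu t)) (φ.mu t.succ)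
  | muMono {k : ℕ} {Δ : List PTy} {P : PTy} {s : Sign} {t : ItTm k} {ψ φ : Fm k (P :: Δ) P} :
      Ded s ψ φ → Ded s (ψ.mu t) (φ.mu t)
  | nuZero {k : ℕ} {Δ : List PTy} {P : PTy} {s : Sign} {φ : Fm k (P :: Δ) P} :
      InL s φ → Ded s .tru (φ.nu .zero)
  | nuSuccR {k : ℕ} {Δ : List PTy} {P : PTy} {s : Sign} {t : ItTm k} {φ : Fm k (P :: Δ) P}
      {ψ : Fm k Δ P} : InL s φ → Ded s ψ (φ.nu t) → Ded s (φ.instFp ψ) (φ.nu t.succ)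
  | nuSuccL {k : ℕ} {Δ : List PTy} {P : PTy} {s : Sign} {t : ItTm k} {φ : Fm k (P :: Δ) P} :
      InL s φ → Ded s (φ.nu t.succ) (φ.instFp (φ.nu t))
  | nuMono {k : ℕ} {Δ : List PTy} {P : PTy} {s : Sign} {t : ItTm k} {ψ φ : Fm k (P :: Δ) P} :
      Ded s ψ φ → Ded s (ψ.nu t) (φ.nu t)
  -- realizability implication
  | impMono {k : ℕ} {Δ : List PTy} {P Q : PTy} {s : Sign} {ψ ψ' : Fm k [] Q} {φ φ' : Fm k [] P} :
      Ded s.opp ψ' ψ → Ded s φ φ' → Ded s (Fm.imp (Δ := Δ) ψ φ) (Fm.imp ψ' φ')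
  | wf {k : ℕ} {Δ : List PTy} {P Q : PTy} {s : Sign} {ψ : Fm (k + 1) [] Q} {φ : Fm k [] P} :
      InL s (Fm.imp (Δ := Δ) ψ.all φ) → InL s (Fm.imp (Δ := Δ) ψ φ.wkIt).ex →
      Ded s (Fm.imp (Δ := Δ) ψ.all φ) (Fm.imp ψ φ.wkIt).ex
  | cc {k : ℕ} {Δ : List PTy} {P Q : PTy} {s : Sign} {ψ : Fm k [] Q} {φ : Fm (k + 1) [] P} :
      InL .neutral ψ → InL s (Fm.imp (Δ := Δ) ψ φ.ex) →
      InL s (Fm.imp (Δ := Δ) ψ.wkIt φ).ex →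
      Ded s (Fm.imp (Δ := Δ) ψ φ.ex) (Fm.imp ψ.wkIt φ).ex
  | exImp {k : ℕ} {Δ : List PTy} {P Q : PTy} {s : Sign} {ψ : Fm (k + 1) [] Q} {φ : Fm k [] P} :
      InL s (Fm.imp (Δ := Δ) ψ φ.wkIt).all → InL s (Fm.imp (Δ := Δ) ψ.ex φ) →
      Ded s (Fm.imp (Δ := Δ) ψ φ.wkIt).all (Fm.imp ψ.ex φ)
  | impAll {k : ℕ} {Δ : List PTy} {P Q : PTy} {s : Sign} {ψ : Fm k [] Q} {φ : Fm (k + 1) [] P} :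
      InL s (Fm.imp (Δ := Δ) ψ.wkIt φ).all → InL s (Fm.imp (Δ := Δ) ψ φ.all) →
      Ded s (Fm.imp (Δ := Δ) ψ.wkIt φ).all (Fm.imp ψ φ.all)
  | impAnd {k : ℕ} {Δ : List PTy} {P Q : PTy} {s : Sign} {ψ : Fm k [] Q} {φ₁ φ₂ : Fm k [] P} :
      InL s.opp ψ → InL s φ₁ → InL s φ₂ →
      Ded s ((Fm.imp (Δ := Δ) ψ φ₁).and (Fm.imp ψ φ₂)) (Fm.imp ψ (φ₁.and φ₂))
  | impTru {k : ℕ} {Δ : List PTy} {P Q : PTy} {s : Sign} {ψ : Fm k [] Q} :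
      InL s.opp ψ → Ded s .tru (Fm.imp (Δ := Δ) (P := P) ψ .tru)
  | orImp {k : ℕ} {Δ : List PTy} {P Q : PTy} {s : Sign} {ψ₁ ψ₂ : Fm k [] Q} {φ : Fm k [] P} :
      InL s.opp ψ₁ → InL s.opp ψ₂ → InL s φ →
      Ded s ((Fm.imp (Δ := Δ) ψ₁ φ).and (Fm.imp ψ₂ φ)) (Fm.imp (ψ₁.or ψ₂) φ)
  | flsImp {k : ℕ} {Δ : List PTy} {P Q : PTy} {s : Sign} {φ : Fm k [] P} :
      InL s φ → Ded s .tru (Fm.imp (Δ := Δ) (Q := Q) .fls φ)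
  | impOr {k : ℕ} {Δ : List PTy} {P Q : PTy} {s : Sign} {δ : Fm k [] Q} {φ₁ φ₂ : Fm k [] P} :
      δ.IsConj → InL s φ₁ → InL s φ₂ →
      Ded s (Fm.imp (Δ := Δ) δ (φ₁.or φ₂)) ((Fm.imp δ φ₁).or (Fm.imp δ φ₂))
  | impFls {k : ℕ} {Δ : List PTy} {P Q : PTy} {s : Sign} {δ : Fm k [] Q} :
      Consistent δ → δ.IsConj → Ded s (Fm.imp (Δ := Δ) (P := P) δ .fls) .fls

/-- The consistency predicate. In `imps`, the family is given by a list, its subfamilies are the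
sublists, and `bad` selects those for which the first of the two alternatives holds. -/
inductive Consistent : {k : ℕ} → {P : PTy} → Fm k [] P → Prop
  | star {k : ℕ} : Consistent (Fm.star : Fm k [] .unit)
  | fold {k : ℕ} {P : Ty 1} {φ : Fm k [] P.unfold} : Consistent φ → Consistent (φ.mod .fold)
  | pair {k : ℕ} {P Q : PTy} {φ : Fm k [] P} {ψ : Fm k [] Q} :
      Consistent φ → Consistent ψ → Consistent ((φ.mod .fst).and (ψ.mod .snd))
  | inl {k : ℕ} {P Q : PTy} {φ : Fm k [] P} :
      Consistent φ → Consistent (φ.mod (.inl : Modality P (.sum P Q)))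
  | inr {k : ℕ} {P Q : PTy} {φ : Fm k [] Q} :
      Consistent φ → Consistent (φ.mod (.inr : Modality Q (.sum P Q)))
  | tru {k : ℕ} {P : PTy} : Consistent (Fm.tru : Fm k [] P)
  | ded {k : ℕ} {P : PTy} {ψ φ : Fm k [] P} :
      Consistent ψ → Ded .neutral ψ φ → φ.IsConj → Consistent φ
  | imps {k : ℕ} {P Q : PTy} (I : List (Fm k [] Q × Fm k [] P))
      (bad : List (Fm k [] Q × Fm k [] P) → Prop) :
      (∀ p ∈ I, Consistent p.1) → (∀ p ∈ I, Consistent p.2) →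
      (∀ J, J.Sublist I → bad J → Ded .neutral (Fm.bigAnd (J.map Prod.fst)) .fls) →
      (∀ J, J.Sublist I → ¬ bad J → Consistent (Fm.bigAnd (J.map Prod.snd))) →
      Consistent (Fm.bigAnd (I.map fun p => Fm.imp p.1 p.2))

end

/-! ## Semantics of formulae -/

/-- Valuations of the fixpoint variables. -/
abbrev FpVal (Δ : List PTy) : Type := ∀ P, Var Δ P → Set (dom P)

def FpVal.cons {Δ : List PTy} {P : PTy} (S : Set (dom P)) (ρ : FpVal Δ) : FpVal (P :: Δ) :=
  Var.elim S ρ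

def FpVal.nil : FpVal [] := fun _ v => nomatch v

def Modality.sem : {P Q : PTy} → Modality P Q → Set (dom P) → Set (dom Q)
  | _, _, .fst (P := P) (Q := Q), S => {x | ((prodIso P Q).symm x).1 ∈ S}
  | _, _, .snd (P := P) (Q := Q), S => {x | ((prodIso P Q).symm x).2 ∈ S}
  | _, _, .inl (P := P) (Q := Q), S => (fun x => sumIso P Q (.inl x)) '' S
  | _, _, .inr (P := P) (Q := Q), S => (fun x => sumIso P Q (.inr x)) '' S
  | _, _, .fold (P := P), S => {x | (muIso P).symm x ∈ S}

/-- The interpretation of a formula under valuations of its iteration and fixpoint variables. -/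
def Fm.sem : {k : ℕ} → {Δ : List PTy} → {P : PTy} → Fm k Δ P → (Fin k → ℕ) → FpVal Δ →
    Set (dom P)
  | _, _, _, .tru, _, _ => Set.univ
  | _, _, _, .fls, _, _ => ∅
  | _, _, _, .and φ ψ, n, ρ => φ.sem n ρ ∩ ψ.sem n ρ
  | _, _, _, .or φ ψ, n, ρ => φ.sem n ρ ∪ ψ.sem n ρ
  | _, _, _, .star, _, _ => {unitIso true}
  | _, _, _, .mod m φ, n, ρ => m.sem (φ.sem n ρ)
  | _, _, _, .fp v, _, ρ => ρ _ v
  | _, _, _, .mu t φ, n, ρ => (fun S => φ.sem n (FpVal.cons S ρ))^[t.sem n] ∅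
  | _, _, _, .nu t φ, n, ρ => (fun S => φ.sem n (FpVal.cons S ρ))^[t.sem n] Set.univ
  | _, _, _, .ex φ, n, ρ => ⋃ i : ℕ, φ.sem (Fin.cases i n) ρ
  | _, _, _, .all φ, n, ρ => ⋂ i : ℕ, φ.sem (Fin.cases i n) ρ
  | _, _, _, .imp (Q := Q) (P := P) ψ φ, n, _ =>
      {f | ∀ x ∈ ψ.sem n FpVal.nil, (arrIso Q P).symm f x ∈ φ.sem n FpVal.nil}

/-! ## Refinement types -/

/-- Refinement types with a given underlying pure type; the formulae in them are closed and
belong to one of the polarised languages. -/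
inductive RTy : PTy → Type
  | pure (P : PTy) : RTy P
  | refine {P : PTy} (φ : Fm 0 [] P) (hφ : ∃ s, InL s φ) : RTy P
  | prod {P Q : PTy} (T : RTy P) (U : RTy Q) : RTy (.prod P Q)
  | arr {Q P : PTy} (U : RTy Q) (T : RTy P) : RTy (.arr Q P)

/-- All formulae in the type belong to the conjunctive fragment. -/
def RTy.IsConj : {P : PTy} → RTy P → Prop
  | _, .pure _ => True
  | _, .refine φ _ => φ.IsConj
  | _, .prod T U => T.IsConj ∧ U.IsConj
  | _, .arr U T => U.IsConj ∧ T.IsConj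

def RTy.sem : {P : PTy} → RTy P → Set (dom P)
  | _, .pure _ => Set.univ
  | _, .refine φ _ => φ.sem Fin.elim0 FpVal.nil
  | _, .prod T U => Modality.sem .fst T.sem ∩ Modality.sem .snd U.sem
  | _, .arr (Q := Q) (P := P) U T => {f | ∀ x ∈ U.sem, (arrIso Q P).symm f x ∈ T.sem}

/-- Subtyping; `T` and `U` are equivalent if both are subtypes of each other. -/
inductive Sub : {P : PTy} → RTy P → RTy P → Prop
  | refl {P : PTy} {T : RTy P} : Sub T T
  | trans {P : PTy} {T U V : RTy P} : Sub T U → Sub U V → Sub T V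
  | toPure {P : PTy} {T : RTy P} : Sub T (.pure P)
  | pureTru {P : PTy} {h : ∃ s, InL s (Fm.tru : Fm 0 [] P)} : Sub (.pure P) (.refine .tru h)
  | ded {P : PTy} {s : Sign} {ψ φ : Fm 0 [] P} {hψ : ∃ s, InL s ψ} {hφ : ∃ s, InL s φ} :
      Ded s ψ φ → Sub (.refine ψ hψ) (.refine φ hφ)
  | prod {P Q : PTy} {T T' : RTy P} {U U' : RTy Q} :
      Sub T T' → Sub U U' → Sub (.prod T U) (.prod T' U')
  | arr {P Q : PTy} {T T' : RTy P} {U U' : RTy Q} :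
      Sub U' U → Sub T T' → Sub (.arr U T) (.arr U' T')
  | prodL {P Q : PTy} {φ : Fm 0 [] P} {ψ : Fm 0 [] Q} {hφ : ∃ s, InL s φ} {hψ : ∃ s, InL s ψ}
      {h : ∃ s, InL s ((φ.mod (.fst : Modality P (.prod P Q))).and (ψ.mod .snd))} :
      Sub (.prod (.refine φ hφ) (.refine ψ hψ)) (.refine ((φ.mod .fst).and (ψ.mod .snd)) h)
  | prodR {P Q : PTy} {φ : Fm 0 [] P} {ψ : Fm 0 [] Q} {hφ : ∃ s, InL s φ} {hψ : ∃ s, InL s ψ}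
      {h : ∃ s, InL s ((φ.mod (.fst : Modality P (.prod P Q))).and (ψ.mod .snd))} :
      Sub (.refine ((φ.mod .fst).and (ψ.mod .snd)) h) (.prod (.refine φ hφ) (.refine ψ hψ))
  | arrL {P Q : PTy} {φ : Fm 0 [] P} {ψ : Fm 0 [] Q} {hφ : ∃ s, InL s φ} {hψ : ∃ s, InL s ψ}
      {h : ∃ s, InL s (Fm.imp (Δ := []) ψ φ)} :
      Sub (.arr (.refine ψ hψ) (.refine φ hφ)) (.refine (.imp ψ φ) h)
  | arrR {P Q : PTy} {φ : Fm 0 [] P} {ψ : Fm 0 [] Q} {hφ : ∃ s, InL s φ} {hψ : ∃ s, InL s ψ}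
      {h : ∃ s, InL s (Fm.imp (Δ := []) ψ φ)} :
      Sub (.refine (.imp ψ φ) h) (.arr (.refine ψ hψ) (.refine φ hφ))

/-- Typing contexts of refinement types. -/
abbrev RCtx : Type := List ((P : PTy) × RTy P)

/-- The underlying pure context. -/
def RCtx.und (Γ : RCtx) : List PTy := List.map Sigma.fst Γ

def RCtx.IsConj (Γ : RCtx) : Prop := ∀ A ∈ Γ, A.2.IsConj

/-- Pointwise subtyping of contexts. -/
inductive CtxSub : RCtx → RCtx → Prop
  | nil : CtxSub [] []
  | cons {P : PTy} {T U : RTy P} {Γ Γ' : RCtx} :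
      Sub T U → CtxSub Γ Γ' → CtxSub (⟨P, T⟩ :: Γ) (⟨P, U⟩ :: Γ')

/-- Derivable typing judgements `Γ ⊢ M : T` of the refinement type system. -/
inductive RTyping : RCtx → Tm → {P : PTy} → RTy P → Prop
  -- basic rules
  | var {Γ : RCtx} {P : PTy} {T : RTy P} (v : Var Γ ⟨P, T⟩) : RTyping Γ (.var v.idx) T
  | lam {Γ : RCtx} {M : Tm} {P Q : PTy} {U : RTy Q} {T : RTy P} :
      RTyping (⟨Q, U⟩ :: Γ) M T → RTyping Γ (.lam M) (.arr U T)
  | app {Γ : RCtx} {M N : Tm} {P Q : PTy} {U : RTy Q} {T : RTy P} :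
      RTyping Γ M (.arr U T) → RTyping Γ N U → RTyping Γ (.app M N) T
  | pair {Γ : RCtx} {M N : Tm} {P Q : PTy} {T : RTy P} {U : RTy Q} :
      RTyping Γ M T → RTyping Γ N U → RTyping Γ (.pair M N) (.prod T U)
  | fst {Γ : RCtx} {M : Tm} {P Q : PTy} {T : RTy P} {U : RTy Q} :
      RTyping Γ M (.prod T U) → RTyping Γ (.fst M) T
  | snd {Γ : RCtx} {M : Tm} {P Q : PTy} {T : RTy P} {U : RTy Q} :
      RTyping Γ M (.prod T U) → RTyping Γ (.snd M) U
  -- pure typing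
  | pure {Γ : RCtx} {M : Tm} {P : PTy} (d : PTyping Γ.und M P) : RTyping Γ M (.pure P)
  -- subtyping
  | sub {Γ Γ' : RCtx} {M : Tm} {P : PTy} {T T' : RTy P} :
      CtxSub Γ' Γ → RTyping Γ M T → Sub T T' → RTyping Γ' M T'
  -- rules for the modalities and for fixpoints
  | star {Γ : RCtx} {h : ∃ s, InL s (Fm.star : Fm 0 [] .unit)} :
      RTyping Γ .star (.refine .star h)
  | pair₁ {Γ : RCtx} {M N : Tm} {P Q : PTy} {φ : Fm 0 [] P} {hφ : ∃ s, InL s φ}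
      {h : ∃ s, InL s (φ.mod (.fst : Modality P (.prod P Q)))} (d : PTyping Γ.und N Q) :
      RTyping Γ M (.refine φ hφ) → RTyping Γ (.pair M N) (.refine (φ.mod .fst) h)
  | pair₂ {Γ : RCtx} {M N : Tm} {P Q : PTy} {φ : Fm 0 [] Q} {hφ : ∃ s, InL s φ}
      {h : ∃ s, InL s (φ.mod (.snd : Modality Q (.prod P Q)))} (d : PTyping Γ.und M P) :
      RTyping Γ N (.refine φ hφ) → RTyping Γ (.pair M N) (.refine (φ.mod .snd) h)
  | proj₁ {Γ : RCtx} {M : Tm} {P Q : PTy} {φ : Fm 0 [] P} {hφ : ∃ s, InL s φ}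
      {h : ∃ s, InL s (φ.mod (.fst : Modality P (.prod P Q)))} :
      RTyping Γ M (.refine (φ.mod .fst) h) → RTyping Γ (.fst M) (.refine φ hφ)
  | proj₂ {Γ : RCtx} {M : Tm} {P Q : PTy} {φ : Fm 0 [] Q} {hφ : ∃ s, InL s φ}
      {h : ∃ s, InL s (φ.mod (.snd : Modality Q (.prod P Q)))} :
      RTyping Γ M (.refine (φ.mod .snd) h) → RTyping Γ (.snd M) (.refine φ hφ)
  | fold {Γ : RCtx} {M : Tm} {P : Ty 1} {φ : Fm 0 [] P.unfold} {hφ : ∃ s, InL s φ}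
      {h : ∃ s, InL s (φ.mod .fold)} :
      RTyping Γ M (.refine φ hφ) → RTyping Γ (.fold M) (.refine (φ.mod .fold) h)
  | unfold {Γ : RCtx} {M : Tm} {P : Ty 1} {φ : Fm 0 [] P.unfold} {hφ : ∃ s, InL s φ}
      {h : ∃ s, InL s (φ.mod .fold)} :
      RTyping Γ M (.refine (φ.mod .fold) h) → RTyping Γ (.unfold M) (.refine φ hφ)
  | inl {Γ : RCtx} {M : Tm} {P Q : PTy} {φ : Fm 0 [] P} {hφ : ∃ s, InL s φ}
      {h : ∃ s, InL s (φ.mod (.inl : Modality P (.sum P Q)))} :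
      RTyping Γ M (.refine φ hφ) → RTyping Γ (.inl M) (.refine (φ.mod .inl) h)
  | inr {Γ : RCtx} {M : Tm} {P Q : PTy} {φ : Fm 0 [] Q} {hφ : ∃ s, InL s φ}
      {h : ∃ s, InL s (φ.mod (.inr : Modality Q (.sum P Q)))} :
      RTyping Γ M (.refine φ hφ) → RTyping Γ (.inr M) (.refine (φ.mod .inr) h)
  | case₁ {Γ : RCtx} {M N₁ N₂ : Tm} {P₁ P₂ Q : PTy} {T : RTy Q} {ψ : Fm 0 [] P₁}
      {hψ : ∃ s, InL s ψ} {h : ∃ s, InL s (ψ.mod (.inl : Modality P₁ (.sum P₁ P₂)))} :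
      RTyping Γ M (.refine (ψ.mod .inl) h) → RTyping (⟨P₁, .refine ψ hψ⟩ :: Γ) N₁ T →
      (d : PTyping (P₂ :: Γ.und) N₂ Q) → RTyping Γ (.case M N₁ N₂) T
  | case₂ {Γ : RCtx} {M N₁ N₂ : Tm} {P₁ P₂ Q : PTy} {T : RTy Q} {ψ : Fm 0 [] P₂}
      {hψ : ∃ s, InL s ψ} {h : ∃ s, InL s (ψ.mod (.inr : Modality P₂ (.sum P₁ P₂)))} :
      RTyping Γ M (.refine (ψ.mod .inr) h) → (d : PTyping (P₁ :: Γ.und) N₁ Q) →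
      RTyping (⟨P₂, .refine ψ hψ⟩ :: Γ) N₂ T → RTyping Γ (.case M N₁ N₂) T
  | fix {Γ : RCtx} {M : Tm} {P : PTy} {ψ φ : Fm 0 [] P} {hψ : ∃ s, InL s ψ}
      {hφ : ∃ s, InL s φ} :
      RTyping Γ (.fix M) (.refine ψ hψ) → RTyping (⟨P, .refine ψ hψ⟩ :: Γ) M (.refine φ hφ) →
      RTyping Γ (.fix M) (.refine φ hφ)
  -- logical rules
  | and {Γ : RCtx} {M : Tm} {P : PTy} {φ ψ : Fm 0 [] P} {hφ : ∃ s, InL s φ}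
      {hψ : ∃ s, InL s ψ} {h : ∃ s, InL s (φ.and ψ)} :
      RTyping Γ M (.refine φ hφ) → RTyping Γ M (.refine ψ hψ) →
      RTyping Γ M (.refine (φ.and ψ) h)
  | fls {Γ₁ Γ₂ : RCtx} {M : Tm} {P Q : PTy} {T : RTy P} {h : ∃ s, InL s (Fm.fls : Fm 0 [] Q)}
      (d : PTyping (RCtx.und (Γ₁ ++ ⟨Q, .refine .fls h⟩ :: Γ₂)) M P) :
      RTyping (Γ₁ ++ ⟨Q, .refine .fls h⟩ :: Γ₂) M T
  | or {Γ₁ Γ₂ : RCtx} {M : Tm} {P Q : PTy} {T : RTy P} {ψ₁ ψ₂ : Fm 0 [] Q}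
      {h₁ : ∃ s, InL s ψ₁} {h₂ : ∃ s, InL s ψ₂} {h : ∃ s, InL s (ψ₁.or ψ₂)} :
      RTyping (Γ₁ ++ ⟨Q, .refine ψ₁ h₁⟩ :: Γ₂) M T →
      RTyping (Γ₁ ++ ⟨Q, .refine ψ₂ h₂⟩ :: Γ₂) M T →
      RTyping (Γ₁ ++ ⟨Q, .refine (ψ₁.or ψ₂) h⟩ :: Γ₂) M T

/-- The tuples of elements of the types in a context. -/
def RCtx.sem : (Γ : RCtx) → Set (ctxDom Γ.und)
  | [] => Set.univ
  | A :: Γ => {u : dom A.1 × ctxDom (RCtx.und Γ) | u.1 ∈ A.2.sem ∧ u.2 ∈ RCtx.sem Γ}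

/-- Sound judgements: the term has a typing of the underlying pure type whose interpretation takes
the tuples in `Γ` to elements of `T`. -/
def Sound (Γ : RCtx) (M : Tm) {P : PTy} (T : RTy P) : Prop :=
  ∃ d : PTyping Γ.und M P, ∀ u ∈ Γ.sem, d.sem u ∈ T.sem

end

end FPC

-- A conjunctive formula behaves like a compact element. Each closed one is either refutable, with
-- empty interpretation, or consistent, and then its interpretation is the principal filter of a
-- single element. In both cases the interpretation is Scott-open. An inclusion between
-- interpretations can therefore be tested at one point, which is what makes deduction complete:
-- every semantic inclusion between conjunctive formulae is derivable. Openness, the dichotomy and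
-- completeness of deduction are bundled in `Level` and proved together by induction on the nesting
-- depth of modalities and implications. The depth is the measure, not the type, because unfolding a
-- recursive type need not make it smaller. At each depth a formula is brought into a normal form
-- dictated by its type. Soundness of deduction is never needed: `Equi` records equality of
-- interpretations next to interderivability.
--
-- The substantial case is a finite conjunction of implications. If some premises are jointly
-- satisfiable while their conclusions are not, the conjunction is refuted by `Ded.impFls`.
-- Otherwise its least element is the step function sending `x` to the least element of the
-- conjunction of those conclusions whose premise holds at `x`. It is continuous because there are
-- finitely many premises and all are open.
--
-- For typing, a conjunctive context is either inconsistent, and then the rule for `⊥` applies, or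
-- it has a least tuple `u`, and soundness is used at `u` alone. By induction on the pure derivation
-- (`typable`), every conjunctive formula true of the value at `u` is derivable. Application, `case`
-- and `fix` need an intermediate formula, for the argument, the injected value or the previous
-- iterate. It exists because every stage of the bilimit is finite and its elements are defined by
-- conjunctive formulae, so that these formulae give a base of compact neighbourhoods
-- (`ScottOpen.exists_conj`). Finally every conjunctive refinement type is equivalent to a
-- refinement of a pure type.

namespace FPC

noncomputable section

/-! ## Scott-open sets -/

section Scott

variable {X Y : Type} [CompletePartialOrder X] [CompletePartialOrder Y]

/-- Upper sets that are inaccessible by directed suprema. -/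
structure ScottOpen (S : Set X) : Prop where
  upper : IsUpperSet S
  inacc : ∀ ⦃d : Set X⦄, d.Nonempty → DirectedOn (· ≤ ·) d → ∀ ⦃a⦄, IsLUB d a → a ∈ S →
    ∃ x ∈ d, x ∈ S

theorem ScottOpen.univ : ScottOpen (Set.univ : Set X) :=
  ⟨isUpperSet_univ, fun _ hne _ _ _ _ => ⟨hne.some, hne.some_mem, trivial⟩⟩

theorem ScottOpen.empty : ScottOpen (∅ : Set X) :=
  ⟨isUpperSet_empty, fun _ _ _ _ _ h => h.elim⟩

theorem ScottOpen.inter {S T : Set X} (hS : ScottOpen S) (hT : ScottOpen T) :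
    ScottOpen (S ∩ T) := by
  refine ⟨hS.upper.inter hT.upper, fun d hne hd a ha h => ?_⟩
  obtain ⟨x, hx, hxS⟩ := hS.inacc hne hd ha h.1
  obtain ⟨y, hy, hyT⟩ := hT.inacc hne hd ha h.2
  obtain ⟨z, hz, hxz, hyz⟩ := hd x hx y hy
  exact ⟨z, hz, hS.upper hxz hxS, hT.upper hyz hyT⟩

theorem ScottOpen.preimage {S : Set Y} (hS : ScottOpen S) (f : SHom X Y) :
    ScottOpen {x | f x ∈ S} := by
  refine ⟨fun x y h hx => hS.upper (f.mono h) hx, fun d hne hd a ha h => ?_⟩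
  have hd' : DirectedOn (· ≤ ·) (f '' d) := by
    rintro _ ⟨x, hx, rfl⟩ _ ⟨y, hy, rfl⟩
    obtain ⟨z, hz, hxz, hyz⟩ := hd x hx y hy
    exact ⟨f z, ⟨z, hz, rfl⟩, f.mono hxz, f.mono hyz⟩
  obtain ⟨_, ⟨x, hx, rfl⟩, hxS⟩ := hS.inacc (hne.image _) hd' (f.cont hne hd ha) h
  exact ⟨x, hx, hxS⟩

theorem ScottOpen.ici_true : ScottOpen ({true} : Set Bool) := by
  refine ⟨?_, fun d hne hd a ha h => ?_⟩
  · rintro a b hab rfl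
    revert hab; cases b <;> simp
  · obtain rfl : a = true := h
    by_contra! hcon
    have : (true : Bool) ≤ false := ha.2 fun x hx => by
      cases x
      · exact le_rfl
      · exact (hcon true hx rfl).elim
    exact absurd this (by decide)

open Classical in
/-- The characteristic function of a Scott-open set. -/
def ScottOpen.char {S : Set X} (hS : ScottOpen S) : SHom X Bool where
  toFun x := decide (x ∈ S)
  cont := by
    intro d hne hd a ha
    refine ⟨?_, fun b hb => ?_⟩
    · rintro _ ⟨x, hx, rfl⟩
      by_cases h : x ∈ S
      · simp [h, hS.upper (ha.1 hx) h]
      · simp [h]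
    · by_cases h : a ∈ S
      · obtain ⟨x, hx, hxS⟩ := hS.inacc hne hd ha h
        have := hb ⟨x, hx, rfl⟩
        simpa [h, hxS] using this
      · simp [h]

/-- The image is the preimage of `{true}` under the strict copairing of the characteristic function
of `S` with the constant `⊥`, so openness comes from continuity of a map into `Bool`. -/
theorem ScottOpen.image_inl {S : Set X} (hS : ScottOpen S) :
    ScottOpen ((LSum.inl : X → LSum X Y) '' S) := by
  convert ScottOpen.ici_true.preimage (SHom.copair hS.char (SHom.const Y ⊥)) using 1
  ext a
  cases a with
  | bot => simp [SHom.copair, LSum.elim]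
  | inl x => simp [SHom.copair, LSum.elim, ScottOpen.char]
  | inr y => simp [SHom.copair, LSum.elim, SHom.const]

theorem ScottOpen.image_inr {S : Set Y} (hS : ScottOpen S) :
    ScottOpen ((LSum.inr : Y → LSum X Y) '' S) := by
  convert ScottOpen.ici_true.preimage (SHom.copair (SHom.const X ⊥) hS.char) using 1
  ext a
  cases a with
  | bot => simp [SHom.copair, LSum.elim]
  | inr x => simp [SHom.copair, LSum.elim, ScottOpen.char]
  | inl y => simp [SHom.copair, LSum.elim, SHom.const]

theorem ScottOpen.image_iso {S : Set X} (hS : ScottOpen S) (e : X ≃o Y) : ScottOpen (e '' S) := by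
  convert hS.preimage (SHom.ofIso e.symm) using 1
  ext y
  constructor
  · rintro ⟨x, hx, rfl⟩
    simpa [SHom.ofIso] using hx
  · intro h
    exact ⟨e.symm y, h, e.apply_symm_apply y⟩

end Scott

/-! ## Closed formulae -/

/-- The interpretation of a closed formula. -/
abbrev Fm.den {P : PTy} (φ : Fm 0 [] P) : Set (dom P) := φ.sem Fin.elim0 FpVal.nil

section den

variable {P Q : PTy}

theorem Fm.den_tru : (Fm.tru : Fm 0 [] P).den = Set.univ := rfl
theorem Fm.den_and (φ ψ : Fm 0 [] P) : (φ.and ψ).den = φ.den ∩ ψ.den := rfl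
theorem Fm.den_star : (Fm.star : Fm 0 [] .unit).den = {unitIso true} := rfl
theorem Fm.mem_fst {φ : Fm 0 [] P} {x : dom (.prod P Q)} :
    x ∈ (φ.mod .fst).den ↔ ((prodIso P Q).symm x).1 ∈ φ.den := Iff.rfl
theorem Fm.mem_snd {φ : Fm 0 [] Q} {x : dom (.prod P Q)} :
    x ∈ (φ.mod .snd).den ↔ ((prodIso P Q).symm x).2 ∈ φ.den := Iff.rfl
theorem Fm.den_inl {φ : Fm 0 [] P} :
    (φ.mod (.inl : Modality P (.sum P Q))).den = (fun x => sumIso P Q (.inl x)) '' φ.den := rfl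
theorem Fm.den_inr {φ : Fm 0 [] Q} :
    (φ.mod (.inr : Modality Q (.sum P Q))).den = (fun x => sumIso P Q (.inr x)) '' φ.den := rfl
theorem Fm.mem_fold {P : Ty 1} {φ : Fm 0 [] P.unfold} {x : dom (.mu P)} :
    x ∈ (φ.mod .fold).den ↔ (muIso P).symm x ∈ φ.den := Iff.rfl
theorem Fm.mem_imp {ψ : Fm 0 [] Q} {φ : Fm 0 [] P} {f : dom (.arr Q P)} :
    f ∈ (Fm.imp (Δ := []) ψ φ).den ↔ ∀ x ∈ ψ.den, (arrIso Q P).symm f x ∈ φ.den := Iff.rfl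

theorem Fm.mem_bigAnd {l : List (Fm 0 [] P)} {x : dom P} :
    x ∈ (Fm.bigAnd l).den ↔ ∀ φ ∈ l, x ∈ φ.den := by
  induction l with
  | nil => simp [Fm.bigAnd, Fm.den_tru]
  | cons φ l ih => simp [Fm.bigAnd, Fm.den_and, ih]

end den

/-- Polarities only restrict quantifiers, and there are none here. The sign is generalised because
an implication reverses it on the left. This discharges the language side conditions of all
deduction rules below. -/
theorem InL.of_isConj {k : ℕ} {Δ : List PTy} {P : PTy} {φ : Fm k Δ P} (h : φ.IsConj) (s : Sign) :
    InL s φ := by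
  induction φ generalizing s with
  | tru => exact .tru
  | fls => exact .fls
  | and φ ψ h1 h2 => exact .and (h1 h.1 s) (h2 h.2 s)
  | star => exact .star
  | mod m φ ih => exact .mod (ih h s)
  | imp ψ φ h1 h2 => exact .imp (h1 h.1 _) (h2 h.2 _)
  | _ => exact h.elim

/-- Conjunctive closed formulae with at most `n` nested modalities and implications. -/
inductive ConjD : ℕ → {P : PTy} → Fm 0 [] P → Prop
  | tru {n : ℕ} {P : PTy} : ConjD n (Fm.tru : Fm 0 [] P)
  | fls {n : ℕ} {P : PTy} : ConjD n (Fm.fls : Fm 0 [] P)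
  | and {n : ℕ} {P : PTy} {φ ψ : Fm 0 [] P} : ConjD n φ → ConjD n ψ → ConjD n (φ.and ψ)
  | star {n : ℕ} : ConjD (n + 1) (Fm.star : Fm 0 [] .unit)
  | mod {n : ℕ} {P Q : PTy} {m : Modality P Q} {φ : Fm 0 [] P} :
      ConjD n φ → ConjD (n + 1) (φ.mod m)
  | imp {n : ℕ} {P Q : PTy} {ψ : Fm 0 [] Q} {φ : Fm 0 [] P} :
      ConjD n ψ → ConjD n φ → ConjD (n + 1) (Fm.imp (Δ := []) ψ φ)

theorem ConjD.isConj {n : ℕ} {P : PTy} {φ : Fm 0 [] P} (h : ConjD n φ) : φ.IsConj := by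
  induction h with
  | tru => exact trivial
  | fls => exact trivial
  | and _ _ h1 h2 => exact ⟨h1, h2⟩
  | star => exact trivial
  | mod _ ih => exact ih
  | imp _ _ h1 h2 => exact ⟨h1, h2⟩

theorem ConjD.inL {n : ℕ} {P : PTy} {φ : Fm 0 [] P} (h : ConjD n φ) {s : Sign} : InL s φ :=
  InL.of_isConj h.isConj s

theorem ConjD.mono {n m : ℕ} (hnm : n ≤ m) {P : PTy} {φ : Fm 0 [] P} (h : ConjD n φ) :
    ConjD m φ := by
  induction h generalizing m with
  | tru => exact .tru
  | fls => exact .fls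
  | and _ _ h1 h2 => exact .and (h1 hnm) (h2 hnm)
  | star => obtain ⟨m, rfl⟩ := Nat.exists_eq_add_of_le' (Nat.succ_le_of_lt hnm); exact .star
  | mod _ ih =>
    obtain ⟨m, rfl⟩ := Nat.exists_eq_succ_of_ne_zero (Nat.ne_of_gt (Nat.lt_of_lt_of_le (Nat.succ_pos _) hnm))
    exact .mod (ih (Nat.le_of_succ_le_succ hnm))
  | imp _ _ h1 h2 =>
    obtain ⟨m, rfl⟩ := Nat.exists_eq_succ_of_ne_zero (Nat.ne_of_gt (Nat.lt_of_lt_of_le (Nat.succ_pos _) hnm))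
    exact .imp (h1 (Nat.le_of_succ_le_succ hnm)) (h2 (Nat.le_of_succ_le_succ hnm))

theorem ConjD.bigAnd {n : ℕ} {P : PTy} {l : List (Fm 0 [] P)} (h : ∀ φ ∈ l, ConjD n φ) :
    ConjD n (Fm.bigAnd l) := by
  induction l with
  | nil => exact .tru
  | cons φ l ih =>
    exact .and (h φ (by simp)) (ih fun ψ hψ => h ψ (by simp [hψ]))

/-- Induction on an indexed family needs free indices, so closedness enters as two equations and the
casts vanish after `subst`. -/
theorem Fm.IsConj.exists_conjD {k : ℕ} {Δ : List PTy} {P : PTy} {φ : Fm k Δ P} (h : φ.IsConj)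
    (hk : k = 0) (hΔ : Δ = []) : ∃ n, ConjD n (hΔ ▸ hk ▸ φ) := by
  induction φ with
  | tru => subst hk hΔ; exact ⟨0, .tru⟩
  | fls => subst hk hΔ; exact ⟨0, .fls⟩
  | and φ ψ h1 h2 =>
    subst hk hΔ
    obtain ⟨n, hn⟩ := h1 h.1 rfl rfl
    obtain ⟨m, hm⟩ := h2 h.2 rfl rfl
    exact ⟨max n m, .and (hn.mono (le_max_left _ _)) (hm.mono (le_max_right _ _))⟩
  | star => subst hk hΔ; exact ⟨1, .star⟩
  | mod m φ ih =>
    subst hk hΔ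
    obtain ⟨n, hn⟩ := ih h rfl rfl
    exact ⟨n + 1, .mod hn⟩
  | imp ψ φ h1 h2 =>
    subst hk hΔ
    obtain ⟨n, hn⟩ := h1 h.1 rfl rfl
    obtain ⟨m, hm⟩ := h2 h.2 rfl rfl
    exact ⟨max n m + 1, .imp (hn.mono (le_max_left _ _)) (hm.mono (le_max_right _ _))⟩
  | _ => exact h.elim

/-! ## Provable equivalence -/

/-- Entailment between closed formulae of the neutral language. -/
abbrev Ent {P : PTy} (φ ψ : Fm 0 [] P) : Prop := Ded .neutral φ ψ

/-- Provable equivalence, together with equality of the interpretations. -/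
structure Equi {P : PTy} (φ ψ : Fm 0 [] P) : Prop where
  mp : Ent φ ψ
  mpr : Ent ψ φ
  den : φ.den = ψ.den

section Equi

variable {n : ℕ} {P Q : PTy} {φ φ' ψ ψ' θ : Fm 0 [] P}

/-- The depth hypothesis is there for the language side condition of the identity rule. -/
theorem Equi.refl (h : ConjD n φ) : Equi φ φ := ⟨.id h.inL, .id h.inL, rfl⟩
theorem Equi.symm (h : Equi φ ψ) : Equi ψ φ := ⟨h.mpr, h.mp, h.den.symm⟩
theorem Equi.trans (h : Equi φ ψ) (h' : Equi ψ θ) : Equi φ θ :=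
  ⟨h.mp.cut h'.mp, h'.mpr.cut h.mpr, h.den.trans h'.den⟩

theorem Ent.andMono (hφ : InL .neutral φ) (hψ : InL .neutral ψ) (h : Ent φ φ') (h' : Ent ψ ψ') :
    Ent (φ.and ψ) (φ'.and ψ') := .andR (.andL₁ hψ h) (.andL₂ hφ h')

theorem Equi.and {m : ℕ} (hφ : ConjD n φ) (hψ : ConjD n ψ) (hφ' : ConjD m φ') (hψ' : ConjD m ψ')
    (h : Equi φ φ') (h' : Equi ψ ψ') : Equi (φ.and ψ) (φ'.and ψ') :=
  ⟨Ent.andMono hφ.inL hψ.inL h.mp h'.mp, Ent.andMono hφ'.inL hψ'.inL h.mpr h'.mpr, by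
    rw [Fm.den_and, Fm.den_and, h.den, h'.den]⟩

theorem Ent.bigAndL {l : List (Fm 0 [] P)} (h : ∀ φ ∈ l, ConjD n φ) (hφ : φ ∈ l) :
    Ent (Fm.bigAnd l) φ := by
  induction l with
  | nil => cases hφ
  | cons χ l ih =>
    have h' : ∀ φ ∈ l, ConjD n φ := fun ψ hψ => h ψ (by simp [hψ])
    rcases List.mem_cons.1 hφ with rfl | hφ
    · exact .andL₁ (ConjD.bigAnd h').inL (.id (h _ (by simp)).inL)
    · exact .andL₂ (h χ (by simp)).inL (ih h' hφ)

theorem Ent.bigAndR {l : List (Fm 0 [] P)} (hψ : InL .neutral ψ) (h : ∀ φ ∈ l, Ent ψ φ) :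
    Ent ψ (Fm.bigAnd l) := by
  induction l with
  | nil => exact .truR hψ
  | cons χ l ih => exact .andR (h χ (by simp)) (ih fun φ hφ => h φ (by simp [hφ]))

theorem Ent.fls_elim (h : Ent φ .fls) (hψ : ConjD n ψ) : Ent φ ψ := h.cut (.flsL hψ.inL)

end Equi

theorem Equi.modFls {P Q : PTy} (m : Modality P Q) :
    Equi (Fm.mod m (Fm.fls : Fm 0 [] P)) .fls :=
  ⟨.modFls, .flsL (.mod .fls), by
    cases m <;> ext x <;> simp [Fm.sem, Modality.sem]⟩

theorem Equi.modAnd {n : ℕ} {P Q : PTy} (m : Modality P Q) {φ ψ : Fm 0 [] P} (hφ : ConjD n φ)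
    (hψ : ConjD n ψ) : Equi ((φ.mod m).and (ψ.mod m)) ((φ.and ψ).mod m) :=
  ⟨.modAnd hφ.inL hψ.inL, .andR (.modMono (.andL₁ hψ.inL (.id hφ.inL)))
      (.modMono (.andL₂ hφ.inL (.id hψ.inL))), by
    cases m
    · rfl
    · rfl
    -- Images under the injections commute with intersections because the injections are injective.
    · exact (Set.image_inter fun x y h => LSum.inl.inj ((sumIso _ _).injective h)).symm
    · exact (Set.image_inter fun x y h => LSum.inr.inj ((sumIso _ _).injective h)).symm
    · rfl⟩

/-! ## Normal forms of conjunctive formulae -/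

section NormalForm

variable {n : ℕ} {P Q : PTy}

theorem Equi.tru_and {φ : Fm 0 [] P} (h : ConjD n φ) : Equi (Fm.tru.and φ) φ :=
  ⟨.andL₂ .tru (.id h.inL), .andR (.truR h.inL) (.id h.inL), Set.univ_inter _⟩

theorem Equi.and_comm {φ ψ : Fm 0 [] P} (hφ : ConjD n φ) (hψ : ConjD n ψ) :
    Equi (φ.and ψ) (ψ.and φ) :=
  ⟨.andR (.andL₂ hφ.inL (.id hψ.inL)) (.andL₁ hψ.inL (.id hφ.inL)),
    .andR (.andL₂ hψ.inL (.id hφ.inL)) (.andL₁ hφ.inL (.id hψ.inL)), Set.inter_comm _ _⟩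

theorem Equi.and_tru {φ : Fm 0 [] P} (h : ConjD n φ) : Equi (φ.and .tru) φ :=
  (Equi.and_comm h .tru).trans (Equi.tru_and h)

theorem Equi.fls_and {φ : Fm 0 [] P} (h : ConjD n φ) : Equi (Fm.fls.and φ) .fls :=
  ⟨.andL₁ h.inL (.id .fls), .andR (.id .fls) (.flsL h.inL), Set.empty_inter _⟩

theorem Equi.and_self {φ : Fm 0 [] P} (h : ConjD n φ) : Equi (φ.and φ) φ :=
  ⟨.andL₁ h.inL (.id h.inL), .andR (.id h.inL) (.id h.inL), Set.inter_self _⟩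

theorem Equi.fls_of_ent {φ : Fm 0 [] P} (h : ConjD n φ) (h1 : Ent φ .fls) (h2 : φ.den = ∅) :
    Equi φ .fls := ⟨h1, .flsL h.inL, h2⟩

/-- Injections are excluded because the new least element of a sum satisfies `⊤` but lies in neither
summand. -/
theorem Equi.modTru {m : Modality P Q} (hm : ¬ m.IsInj) : Equi (Fm.tru : Fm 0 [] Q) (Fm.tru.mod m) :=
  ⟨.modTru hm, .truR (.mod .tru), by
    cases m <;> first | rfl | exact (hm trivial).elim⟩

/-- Atoms of `Unit`, modalities and implications all cost one level, so depth `0` leaves only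
conjunctions of the two constants. -/
theorem ConjD.nf_zero {φ : Fm 0 [] P} : ConjD 0 φ → Equi φ .tru ∨ Equi φ .fls
  | .tru => .inl (.refl (n := 0) .tru)
  | .fls => .inr (.refl (n := 0) .fls)
  | .and h1 h2 => by
    rcases ConjD.nf_zero h1 with e1 | e1 <;> rcases ConjD.nf_zero h2 with e2 | e2
    · exact .inl ((Equi.and (m := 0) h1 h2 .tru .tru e1 e2).trans (.tru_and (n := 0) .tru))
    · exact .inr ((Equi.and (m := 0) h1 h2 .tru .fls e1 e2).trans (.tru_and (n := 0) .fls))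
    · exact .inr ((Equi.and (m := 0) h1 h2 .fls .tru e1 e2).trans (.fls_and (n := 0) .tru))
    · exact .inr ((Equi.and (m := 0) h1 h2 .fls .fls e1 e2).trans (.fls_and (n := 0) .fls))

/-- No modality has `Unit` as its target, so only conjunctions of the three atoms occur, and these
collapse. -/
theorem ConjD.nf_unit {φ : Fm 0 [] .unit} : ConjD (n + 1) φ → Equi φ .tru ∨ Equi φ .fls ∨ Equi φ .star
  | .tru => .inl (.refl (n := 0) .tru)
  | .fls => .inr (.inl (.refl (n := 0) .fls))
  | .star => .inr (.inr (.refl (n := 1) .star))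
  | .and h1 h2 => by
    rcases ConjD.nf_unit h2 with e2 | e2 | e2
    · have e := (Equi.and h1 h2 h1 .tru (.refl h1) e2).trans (.and_tru h1)
      rcases ConjD.nf_unit h1 with e1 | e1 | e1
      · exact .inl (e.trans e1)
      · exact .inr (.inl (e.trans e1))
      · exact .inr (.inr (e.trans e1))
    · exact .inr (.inl ((Equi.and h1 h2 h1 .fls (.refl h1) e2).trans
        ((Equi.and_comm h1 .fls).trans (.fls_and h1))))
    · rcases ConjD.nf_unit h1 with e1 | e1 | e1
      · exact .inr (.inr ((Equi.and (m := 1) h1 h2 .tru .star e1 e2).trans (.tru_and (n := 1) .star)))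
      · exact .inr (.inl ((Equi.and (m := 1) h1 h2 .fls .star e1 e2).trans (.fls_and (n := 1) .star)))
      · exact .inr (.inr ((Equi.and (m := 1) h1 h2 .star .star e1 e2).trans (.and_self (n := 1) .star)))

/-- A missing component is filled in by `⟨m⟩⊤`, which is provable for projections; conjunctions
merge componentwise because modalities commute with `∧`. -/
theorem ConjD.nf_prod {φ : Fm 0 [] (.prod P Q)} : ConjD (n + 1) φ →
    ∃ φ₁ φ₂, ConjD n φ₁ ∧ ConjD n φ₂ ∧ Equi φ ((φ₁.mod .fst).and (φ₂.mod .snd))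
  | .tru => ⟨.tru, .tru, .tru, .tru, (Equi.and_tru (n := 1) .tru).symm.trans
      (.and (n := 1) (m := 1) .tru .tru (.mod .tru) (.mod .tru) (.modTru id) (.modTru id))⟩
  | .fls => ⟨.fls, .fls, .fls, .fls, (Equi.and_self (n := 1) .fls).symm.trans
      (.and (n := 1) (m := 1) .fls .fls (.mod .fls) (.mod .fls) (Equi.modFls _).symm
        (Equi.modFls _).symm)⟩
  | .mod (m := .fst) h => ⟨_, .tru, h, .tru, (Equi.and_tru h.mod).symm.trans
      (.and h.mod .tru h.mod (.mod .tru) (.refl h.mod) (.modTru id))⟩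
  | .mod (m := .snd) h => ⟨.tru, _, .tru, h, (Equi.tru_and h.mod).symm.trans
      (.and .tru h.mod (.mod .tru) h.mod (.modTru id) (.refl h.mod))⟩
  | .and h1 h2 => by
    obtain ⟨φ₁, φ₂, a1, a2, e⟩ := ConjD.nf_prod h1
    obtain ⟨ψ₁, ψ₂, b1, b2, e'⟩ := ConjD.nf_prod h2
    refine ⟨φ₁.and ψ₁, φ₂.and ψ₂, a1.and b1, a2.and b2, ?_⟩
    refine (Equi.and h1 h2 (a1.mod.and a2.mod) (b1.mod.and b2.mod) e e').trans ?_
    -- What remains is the exchange of the two middle conjuncts, after which each projection absorbs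
    -- its own pair.
    refine Equi.trans ?_ (.and (a1.mod.and b1.mod) (a2.mod.and b2.mod) (a1.and b1).mod
      (a2.and b2).mod (.modAnd _ a1 b1) (.modAnd _ a2 b2))
    have i1 : InL .neutral (φ₁.mod (.fst : Modality P (.prod P Q))) := .mod a1.inL
    have i2 : InL .neutral (φ₂.mod (.snd : Modality Q (.prod P Q))) := .mod a2.inL
    have j1 : InL .neutral (ψ₁.mod (.fst : Modality P (.prod P Q))) := .mod b1.inL
    have j2 : InL .neutral (ψ₂.mod (.snd : Modality Q (.prod P Q))) := .mod b2.inL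
    refine ⟨.andR ?_ ?_, .andR ?_ ?_, Set.inter_inter_inter_comm _ _ _ _⟩
    · exact Ent.andMono (.and i1 i2) (.and j1 j2) (.andL₁ i2 (.id i1)) (.andL₁ j2 (.id j1))
    · exact Ent.andMono (.and i1 i2) (.and j1 j2) (.andL₂ i1 (.id i2)) (.andL₂ j1 (.id j2))
    · exact Ent.andMono (.and i1 j1) (.and i2 j2) (.andL₁ j1 (.id i1)) (.andL₁ j2 (.id i2))
    · exact Ent.andMono (.and i1 j1) (.and i2 j2) (.andL₂ i1 (.id j1)) (.andL₂ i2 (.id j2))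

theorem ConjD.nf_mu {P : Ty 1} {φ : Fm 0 [] (.mu P)} : ConjD (n + 1) φ →
    ∃ φ' : Fm 0 [] P.unfold, ConjD n φ' ∧ Equi φ (φ'.mod .fold)
  | .tru => ⟨.tru, .tru, .modTru id⟩
  | .fls => ⟨.fls, .fls, (Equi.modFls _).symm⟩
  | .mod (m := .fold) h => ⟨_, h, .refl h.mod⟩
  | .and h1 h2 => by
    obtain ⟨φ', a, e⟩ := ConjD.nf_mu h1
    obtain ⟨ψ', b, e'⟩ := ConjD.nf_mu h2
    exact ⟨φ'.and ψ', a.and b, (Equi.and h1 h2 a.mod b.mod e e').trans (.modAnd _ a b)⟩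

/-- The contradiction is written `⟨in₁⟩⊥` and not `⊥` so as to fit the second shape in
`ConjD.nf_sum`, which has no separate case for `⊥`. -/
theorem Equi.injDisj {φ : Fm 0 [] P} {ψ : Fm 0 [] Q} (hφ : ConjD n φ) (hψ : ConjD n ψ) :
    Equi ((φ.mod .inl).and (ψ.mod .inr)) (Fm.fls.mod (.inl : Modality P (.sum P Q))) := by
  refine Equi.trans ?_ (Equi.modFls _).symm
  refine Equi.fls_of_ent (n := n + 1) (hφ.mod.and hψ.mod) (.injDisj hφ.inL hψ.inL) ?_
  rw [Fm.den_and, Fm.den_inl, Fm.den_inr, Set.eq_empty_iff_forall_notMem]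
  rintro _ ⟨⟨x, _, rfl⟩, y, _, h⟩
  cases (sumIso P Q).injective h

/-- `⊤` stays a shape of its own, as it holds at the new least element. Two conjuncts under
different injections contradict each other. -/
theorem ConjD.nf_sum {φ : Fm 0 [] (.sum P Q)} : ConjD (n + 1) φ →
    Equi φ .tru ∨ (∃ φ', ConjD n φ' ∧ Equi φ (φ'.mod .inl)) ∨
      ∃ φ', ConjD n φ' ∧ Equi φ (φ'.mod .inr)
  | .tru => .inl (.refl (n := 0) .tru)
  | .fls => .inr (.inl ⟨.fls, .fls, (Equi.modFls _).symm⟩)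
  | .mod (m := .inl) h => .inr (.inl ⟨_, h, .refl h.mod⟩)
  | .mod (m := .inr) h => .inr (.inr ⟨_, h, .refl h.mod⟩)
  | .and h1 h2 => by
    rcases ConjD.nf_sum h1 with e | ⟨φ', a, e⟩ | ⟨φ', a, e⟩ <;>
      rcases ConjD.nf_sum h2 with e' | ⟨ψ', b, e'⟩ | ⟨ψ', b, e'⟩
    · exact .inl ((Equi.and (m := 0) h1 h2 .tru .tru e e').trans (.tru_and (n := 0) .tru))
    · exact .inr (.inl ⟨_, b, (Equi.and h1 h2 .tru b.mod e e').trans (.tru_and b.mod)⟩)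
    · exact .inr (.inr ⟨_, b, (Equi.and h1 h2 .tru b.mod e e').trans (.tru_and b.mod)⟩)
    · exact .inr (.inl ⟨_, a, (Equi.and h1 h2 a.mod .tru e e').trans (.and_tru a.mod)⟩)
    · exact .inr (.inl ⟨_, a.and b, (Equi.and h1 h2 a.mod b.mod e e').trans (.modAnd _ a b)⟩)
    · exact .inr (.inl ⟨_, .fls, (Equi.and h1 h2 a.mod b.mod e e').trans (.injDisj a b)⟩)
    · exact .inr (.inr ⟨_, a, (Equi.and h1 h2 a.mod .tru e e').trans (.and_tru a.mod)⟩)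
    · exact .inr (.inl ⟨_, .fls, (Equi.and h1 h2 a.mod b.mod e e').trans
        ((Equi.and_comm a.mod b.mod).trans (.injDisj b a))⟩)
    · exact .inr (.inr ⟨_, a.and b, (Equi.and h1 h2 a.mod b.mod e e').trans (.modAnd _ a b)⟩)

/-- The conjunction of a family of implications. -/
abbrev imps (I : List (Fm 0 [] Q × Fm 0 [] P)) : Fm 0 [] (.arr Q P) :=
  Fm.bigAnd (I.map fun p => Fm.imp p.1 p.2)

/-- All premises and conclusions have depth at most `n`. -/
def ConjDs (n : ℕ) (I : List (Fm 0 [] Q × Fm 0 [] P)) : Prop :=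
  ∀ p ∈ I, ConjD n p.1 ∧ ConjD n p.2

theorem ConjDs.imps {I : List (Fm 0 [] Q × Fm 0 [] P)} (h : ConjDs n I) : ConjD (n + 1) (imps I) := by
  refine ConjD.bigAnd fun φ hφ => ?_
  obtain ⟨p, hp, rfl⟩ := List.mem_map.1 hφ
  exact .imp (h p hp).1 (h p hp).2

theorem ConjDs.premises {I : List (Fm 0 [] Q × Fm 0 [] P)} (h : ConjDs n I) :
    ConjD n (Fm.bigAnd (I.map Prod.fst)) := by
  refine ConjD.bigAnd fun φ hφ => ?_
  obtain ⟨p, hp, rfl⟩ := List.mem_map.1 hφ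
  exact (h p hp).1

theorem ConjDs.conclusions {I : List (Fm 0 [] Q × Fm 0 [] P)} (h : ConjDs n I) :
    ConjD n (Fm.bigAnd (I.map Prod.snd)) := by
  refine ConjD.bigAnd fun φ hφ => ?_
  obtain ⟨p, hp, rfl⟩ := List.mem_map.1 hφ
  exact (h p hp).2

theorem ConjDs.sublist {I J : List (Fm 0 [] Q × Fm 0 [] P)} (h : ConjDs n I) (hJ : J.Sublist I) :
    ConjDs n J := fun p hp => h p (hJ.subset hp)

theorem ConjDs.imps_ent {I : List (Fm 0 [] Q × Fm 0 [] P)} (h : ConjDs n I)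
    {p : Fm 0 [] Q × Fm 0 [] P} (hp : p ∈ I) : Ent (FPC.imps I) (Fm.imp p.1 p.2) := by
  refine Ent.bigAndL (n := n + 1) (fun φ hφ => ?_) (List.mem_map.2 ⟨p, hp, rfl⟩)
  obtain ⟨q, hq, rfl⟩ := List.mem_map.1 hφ
  exact .imp (h q hq).1 (h q hq).2

theorem mem_imps {I : List (Fm 0 [] Q × Fm 0 [] P)} {f : dom (.arr Q P)} :
    f ∈ (imps I).den ↔ ∀ p ∈ I, ∀ x ∈ p.1.den, (arrIso Q P).symm f x ∈ p.2.den := by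
  rw [Fm.mem_bigAnd, List.forall_mem_map]
  rfl

/-- Conjunctions of families are concatenations; the constants need the empty family and a
one-element family. -/
theorem ConjD.nf_arr {φ : Fm 0 [] (.arr Q P)} : ConjD (n + 1) φ →
    ∃ I : List (Fm 0 [] Q × Fm 0 [] P), ConjDs n I ∧ Equi φ (imps I)
  | .tru => ⟨[], by simp [ConjDs], .refl (n := 0) .tru⟩
  | .fls => by
    have hc : ConjDs n [((.tru : Fm 0 [] Q), (.fls : Fm 0 [] P))] := by
      intro p hp
      obtain rfl := List.mem_singleton.1 hp
      exact ⟨.tru, .fls⟩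
    -- `⊥` is represented by `⊤ ⇒ ⊥`. It is refuted by `Ded.impFls` since `⊤` is consistent;
    -- semantically, no function has a value at `⊥` lying in `∅`.
    refine ⟨[(.tru, .fls)], hc, .flsL hc.imps.inL, ?_, ?_⟩
    · exact (hc.imps_ent (List.mem_singleton.2 rfl)).cut (.impFls .tru trivial)
    · refine (Set.eq_empty_iff_forall_notMem.2 fun f hf => ?_).symm
      exact mem_imps.1 hf _ (List.mem_singleton.2 rfl) ⊥ trivial
  | .imp (ψ := ψ) (φ := φ) h1 h2 => by
    refine ⟨[(ψ, φ)], ?_, (Equi.and_tru (h1.imp h2)).symm⟩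
    intro p hp
    obtain rfl := List.mem_singleton.1 hp
    exact ⟨h1, h2⟩
  | .and h1 h2 => by
    obtain ⟨I, a, e⟩ := ConjD.nf_arr h1
    obtain ⟨J, b, e'⟩ := ConjD.nf_arr h2
    have hIJ : ConjDs n (I ++ J) := fun p hp => (List.mem_append.1 hp).elim (a p) (b p)
    refine ⟨I ++ J, hIJ, (Equi.and h1 h2 a.imps b.imps e e').trans ⟨?_, ?_, ?_⟩⟩
    · refine Ent.bigAndR (a.imps.and b.imps).inL fun χ hχ => ?_
      obtain ⟨p, hp, rfl⟩ := List.mem_map.1 hχ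
      rcases List.mem_append.1 hp with hp | hp
      · exact .andL₁ b.imps.inL (a.imps_ent hp)
      · exact .andL₂ a.imps.inL (b.imps_ent hp)
    · refine .andR (Ent.bigAndR hIJ.imps.inL fun χ hχ => ?_)
        (Ent.bigAndR hIJ.imps.inL fun χ hχ => ?_) <;>
      obtain ⟨p, hp, rfl⟩ := List.mem_map.1 hχ
      · exact hIJ.imps_ent (List.mem_append_left _ hp)
      · exact hIJ.imps_ent (List.mem_append_right _ hp)
    · ext f
      rw [Fm.den_and, Set.mem_inter_iff, mem_imps, mem_imps, mem_imps, ← List.forall_mem_append]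

end NormalForm

/-! ## The dichotomy and the completeness of deduction -/

/-- A formula is either refutable and empty, or consistent and a principal filter. -/
def Decided {P : PTy} (φ : Fm 0 [] P) : Prop :=
  (Ent φ .fls ∧ φ.den = ∅) ∨ (Consistent φ ∧ ∃ c, φ.den = Set.Ici c)

/-- The properties of the formulae of depth at most `n` that are proved by induction on `n`. -/
structure Level (n : ℕ) : Prop where
  scottOpen : ∀ {P : PTy} {φ : Fm 0 [] P}, ConjD n φ → ScottOpen φ.den
  decided : ∀ {P : PTy} {φ : Fm 0 [] P}, ConjD n φ → Decided φ
  complete : ∀ {P : PTy} {φ ψ : Fm 0 [] P}, ConjD n φ → ConjD n ψ → φ.den ⊆ ψ.den → Ent φ ψ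

section Level

variable {n : ℕ} {P Q : PTy}

/-- Consistency passes along a derivation only into the conjunctive fragment, which is what `hφ`
guarantees. -/
theorem Decided.of_equi {φ ψ : Fm 0 [] P} (hφ : ConjD n φ) (e : Equi φ ψ) (h : Decided ψ) :
    Decided φ := by
  rcases h with ⟨h1, h2⟩ | ⟨h1, c, hc⟩
  · exact .inl ⟨e.mp.cut h1, e.den.trans h2⟩
  · exact .inr ⟨h1.ded e.mpr hφ.isConj, c, e.den.trans hc⟩

theorem Decided.fls : Decided (Fm.fls : Fm 0 [] P) := .inl ⟨.id .fls, rfl⟩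

theorem Decided.tru : Decided (Fm.tru : Fm 0 [] P) :=
  .inr ⟨.tru, ⊥, Set.Ici_bot.symm⟩

/-- The dichotomy turns semantics into derivations: a principal filter is never empty, so emptiness
leaves only the refutable alternative. -/
theorem Decided.fls_of_empty {φ : Fm 0 [] P} (h : Decided φ) (he : φ.den = ∅) : Ent φ .fls := by
  rcases h with h | ⟨_, c, hc⟩
  · exact h.1
  · rw [hc] at he
    exact (Set.nonempty_Ici.ne_empty he).elim

theorem Decided.consistent {φ : Fm 0 [] P} (h : Decided φ) (hne : φ.den.Nonempty) :
    Consistent φ ∧ ∃ c, φ.den = Set.Ici c := by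
  rcases h with h | h
  · exact (hne.ne_empty h.2).elim
  · exact h

/-- Completeness only has to be checked for normal forms. -/
theorem Equi.complete {φ φ' ψ ψ' : Fm 0 [] P} (e : Equi φ φ') (e' : Equi ψ ψ')
    (h : φ'.den ⊆ ψ'.den → Ent φ' ψ') (hs : φ.den ⊆ ψ.den) : Ent φ ψ :=
  e.mp.cut ((h (by rwa [← e.den, ← e'.den])).cut e'.mpr)

/-! ### Function spaces -/

theorem Ent.tru_imp {ψ : Fm 0 [] Q} {φ : Fm 0 [] P} (hφ : ConjD n φ) (h : Ent ψ .fls) :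
    Ent .tru (Fm.imp ψ φ) :=
  (Ded.flsImp hφ.inL).cut (.impMono h (.id hφ.inL))

/-- Contravariance replaces every premise by `ψ`, and implications with a common premise merge by
`Ded.impAnd`; `Ded.impTru` covers the empty family. -/
theorem ConjDs.imps_ent_imp {I : List (Fm 0 [] Q × Fm 0 [] P)} (hI : ConjDs n I)
    {ψ : Fm 0 [] Q} (hψ : ConjD n ψ) (h : ∀ p ∈ I, Ent ψ p.1) :
    Ent (FPC.imps I) (Fm.imp ψ (Fm.bigAnd (I.map Prod.snd))) := by
  induction I with
  | nil => exact .impTru hψ.inL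
  | cons p I ih =>
    have hI' : ConjDs n I := hI.sublist (List.sublist_cons_self p I)
    have hp := hI p (by simp)
    refine (Ent.andMono (.imp hp.1.inL hp.2.inL) hI'.imps.inL
      (.impMono (h p (by simp)) (.id hp.2.inL))
      (ih hI' fun q hq => h q (by simp [hq]))).cut ?_
    exact .impAnd hψ.inL hp.2.inL hI'.conclusions.inL

/-- Jointly satisfiable premises have jointly satisfiable conclusions. -/
def Coherent (I : List (Fm 0 [] Q × Fm 0 [] P)) : Prop :=
  ∀ J : List (Fm 0 [] Q × Fm 0 [] P), J.Sublist I → (Fm.bigAnd (J.map Prod.fst)).den.Nonempty →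
    (Fm.bigAnd (J.map Prod.snd)).den.Nonempty

/-- Incoherence yields a subfamily `J` whose premises have a common point while its conclusions have
none. The joint premise is then consistent and the joint conclusion refutable, so the family entails
`δ ⇒ ⊥` with `δ` consistent. Semantically, a member would send the common point into `∅`. -/
theorem Level.not_coherent (L : Level n) {I : List (Fm 0 [] Q × Fm 0 [] P)} (hI : ConjDs n I)
    (h : ¬ Coherent I) : Ent (imps I) .fls ∧ (imps I).den = ∅ := by
  unfold Coherent at h
  push Not at h
  obtain ⟨J, hJ, hne, he⟩ := h
  have hJ' := hI.sublist hJ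
  have hc := (L.decided hJ'.premises).consistent hne
  have hf := (L.decided hJ'.conclusions).fls_of_empty he
  constructor
  · have h1 : Ent (imps I) (imps J) := by
      refine Ent.bigAndR hI.imps.inL fun χ hχ => ?_
      obtain ⟨p, hp, rfl⟩ := List.mem_map.1 hχ
      exact hI.imps_ent (hJ.subset hp)
    have h2 : Ent (imps J) (Fm.imp (Fm.bigAnd (J.map Prod.fst)) .fls) := by
      refine (hJ'.imps_ent_imp hJ'.premises fun p hp => ?_).cut
        (.impMono (.id hJ'.premises.inL) hf)
      refine Ent.bigAndL (n := n) (fun φ hφ => ?_) (List.mem_map.2 ⟨p, hp, rfl⟩)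
      obtain ⟨q, hq, rfl⟩ := List.mem_map.1 hφ
      exact (hJ' q hq).1
    exact (h1.cut h2).cut (.impFls hc.1 hJ'.premises.isConj)
  · refine Set.eq_empty_iff_forall_notMem.2 fun f hf => ?_
    obtain ⟨x, hx⟩ := hne
    rw [Fm.mem_bigAnd, List.forall_mem_map] at hx
    have : (arrIso Q P).symm f x ∈ (Fm.bigAnd (J.map Prod.snd)).den := by
      rw [Fm.mem_bigAnd, List.forall_mem_map]
      exact fun p hp => mem_imps.1 hf p (hJ.subset hp) x (hx p hp)
    rw [he] at this
    exact this

open Classical in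
/-- The implications whose premise holds at `x`. -/
def active (I : List (Fm 0 [] Q × Fm 0 [] P)) (x : dom Q) : List (Fm 0 [] Q × Fm 0 [] P) :=
  I.filter fun p => x ∈ p.1.den

theorem mem_active {I : List (Fm 0 [] Q × Fm 0 [] P)} {x : dom Q} {p : Fm 0 [] Q × Fm 0 [] P} :
    p ∈ active I x ↔ p ∈ I ∧ x ∈ p.1.den := by
  simp [active]

theorem active_sublist (I : List (Fm 0 [] Q × Fm 0 [] P)) (x : dom Q) : (active I x).Sublist I :=
  List.filter_sublist

/-- Each premise true at `a` is open, hence already true at some element of `d`. There are finitely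
many, so directedness provides one element for all of them. -/
theorem Level.exists_mem_active_eq (L : Level n) {I : List (Fm 0 [] Q × Fm 0 [] P)}
    (hI : ConjDs n I) {d : Set (dom Q)} (hne : d.Nonempty) (hd : DirectedOn (· ≤ ·) d) {a : dom Q}
    (ha : IsLUB d a) : ∃ x ∈ d, ∀ p ∈ I, a ∈ p.1.den → x ∈ p.1.den := by
  induction I with
  | nil => exact ⟨hne.some, hne.some_mem, fun _ h => by simp at h⟩
  | cons p I ih =>
    obtain ⟨x, hx, h⟩ := ih (hI.sublist (List.sublist_cons_self p I))
    have hup : ∀ q ∈ p :: I, IsUpperSet q.1.den := fun q hq => (L.scottOpen (hI q hq).1).upper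
    by_cases hp : a ∈ p.1.den
    · obtain ⟨y, hy, hyp⟩ := (L.scottOpen (hI p (by simp)).1).inacc hne hd ha hp
      obtain ⟨z, hz, hxz, hyz⟩ := hd x hx y hy
      refine ⟨z, hz, fun q hq hqa => ?_⟩
      rcases List.mem_cons.1 hq with rfl | hq'
      · exact hup _ hq hyz hyp
      · exact hup _ hq hxz (h q hq' hqa)
    · refine ⟨x, hx, fun q hq hqa => ?_⟩
      rcases List.mem_cons.1 hq with rfl | hq'
      · exact (hp hqa).elim
      · exact h q hq' hqa

/-- The least element is a step function: its value at `x` is the least element of the conjunction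
of the conclusions active at `x`. Coherence applies to the active subfamily because `x` itself
satisfies all its premises. -/
theorem Level.imps_least (L : Level n) {I : List (Fm 0 [] Q × Fm 0 [] P)} (hI : ConjDs n I)
    (hc : Coherent I) : ∃ f : SHom (dom Q) (dom P), (imps I).den = Set.Ici (arrIso Q P f) ∧
      ∀ x, (Fm.bigAnd ((active I x).map Prod.snd)).den = Set.Ici (f x) := by
  have key : ∀ x, ∃ c, (Fm.bigAnd ((active I x).map Prod.snd)).den = Set.Ici c := by
    intro x
    refine ((L.decided (hI.sublist (active_sublist I x)).conclusions).consistent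
      (hc _ (active_sublist I x) ⟨x, ?_⟩)).2
    rw [Fm.mem_bigAnd, List.forall_mem_map]
    exact fun p hp => (mem_active.1 hp).2
  choose f hf using key
  -- This characterisation of `f` yields its monotonicity, its continuity and its minimality.
  have hmem : ∀ x y, f x ≤ y ↔ ∀ p ∈ I, x ∈ p.1.den → y ∈ p.2.den := by
    intro x y
    rw [← Set.mem_Ici, ← hf, Fm.mem_bigAnd, List.forall_mem_map]
    simp only [mem_active, and_imp]
  have hle : ∀ {x a}, (∀ p ∈ I, x ∈ p.1.den → a ∈ p.1.den) → f x ≤ f a := by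
    intro x a h
    rw [hmem]
    exact fun p hp hx => (hmem a (f a)).1 le_rfl p hp (h p hp hx)
  have hcont : ScottContinuous f := by
    intro d hne hd a ha
    refine ⟨?_, fun b hb => ?_⟩
    · rintro _ ⟨x, hx, rfl⟩
      exact hle fun p hp => (L.scottOpen (hI p hp).1).upper (ha.1 hx)
    -- Every premise active at the supremum is already active at this `x` in `d`, so `f a ≤ f x`.
    · obtain ⟨x, hx, h⟩ := L.exists_mem_active_eq hI hne hd ha
      exact (hle h).trans (hb ⟨x, hx, rfl⟩)
  refine ⟨⟨f, hcont⟩, ?_, hf⟩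
  ext g
  rw [mem_imps, Set.mem_Ici, ← OrderIso.le_symm_apply]
  constructor
  · intro h x
    exact (hmem x _).2 fun p hp hx => h p hp x hx
  · intro h p hp x hx
    exact (hmem x _).1 (h x) p hp hx

open Classical in
-- The rule for families demands consistent premises. Implications with an unsatisfiable premise are
-- therefore dropped first and recovered at the end: they follow from `⊤`, and consistency is
-- preserved by deduction.
theorem Level.imps_consistent (L : Level n) {I : List (Fm 0 [] Q × Fm 0 [] P)} (hI : ConjDs n I)
    (hc : Coherent I) : Consistent (imps I) := by
  let I' := I.filter fun p => p.1.den.Nonempty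
  have hs : I'.Sublist I := List.filter_sublist
  have hI' : ConjDs n I' := hI.sublist hs
  have hmem : ∀ {p}, p ∈ I' ↔ p ∈ I ∧ p.1.den.Nonempty := by simp [I']
  have h1 : Consistent (imps I') := by
    -- The alternative for `J` is decided by whether its premises are jointly unsatisfiable; the
    -- dichotomy converts this into the refutation that the rule requires.
    refine .imps I' (fun J => (Fm.bigAnd (J.map Prod.fst)).den = ∅) (fun p hp => ?_)
      (fun p hp => ?_) (fun J hJ hb => ?_) fun J hJ hb => ?_
    · exact ((L.decided (hI' p hp).1).consistent (hmem.1 hp).2).1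
    · refine ((L.decided (hI' p hp).2).consistent ?_).1
      obtain ⟨x, hx⟩ := (hmem.1 hp).2
      -- Coherence of the one-element subfamily: a satisfiable premise has a satisfiable conclusion.
      obtain ⟨y, hy⟩ := hc [p] (List.singleton_sublist.2 (hmem.1 hp).1) ⟨x, hx, trivial⟩
      exact ⟨y, hy.1⟩
    · exact (L.decided (hI'.sublist hJ).premises).fls_of_empty hb
    · exact ((L.decided (hI'.sublist hJ).conclusions).consistent
        (hc J (hJ.trans hs) (Set.nonempty_iff_ne_empty.2 hb))).1
  refine h1.ded (Ent.bigAndR hI'.imps.inL fun χ hχ => ?_) hI.imps.isConj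
  obtain ⟨p, hp, rfl⟩ := List.mem_map.1 hχ
  by_cases hne : p.1.den.Nonempty
  · exact hI'.imps_ent (hmem.2 ⟨hp, hne⟩)
  · exact (Ded.truR hI'.imps.inL).cut (Ent.tru_imp (hI p hp).2
      ((L.decided (hI p hp).1).fls_of_empty (Set.not_nonempty_iff_eq_empty.1 hne)))

theorem Level.imps_decided (L : Level n) {I : List (Fm 0 [] Q × Fm 0 [] P)} (hI : ConjDs n I) :
    Decided (imps I) := by
  by_cases hc : Coherent I
  · obtain ⟨f, hf, _⟩ := L.imps_least hI hc
    exact .inr ⟨L.imps_consistent hI hc, _, hf⟩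
  · exact .inl (L.not_coherent hI hc)

/-- The inclusion is tested at the least element `f` of the left side. For a target `q` whose
premise is the filter of `a`, it gives `f a` in the conclusion of `q`. The left implications active
at `a` then suffice: their premises contain `a`, hence follow from that of `q`, and the joint
conclusion is the filter of `f a`, hence entails that of `q`. Both entailments have depth `n`. -/
theorem Level.imps_complete (L : Level n) {I J : List (Fm 0 [] Q × Fm 0 [] P)} (hI : ConjDs n I)
    (hJ : ConjDs n J) (hs : (imps I).den ⊆ (imps J).den) : Ent (imps I) (imps J) := by
  by_cases hc : Coherent I
  · obtain ⟨f, hf, hfx⟩ := L.imps_least hI hc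
    refine Ent.bigAndR hI.imps.inL fun χ hχ => ?_
    obtain ⟨q, hq, rfl⟩ := List.mem_map.1 hχ
    obtain ⟨hq1, hq2⟩ := hJ q hq
    rcases L.decided hq1 with h | ⟨_, a, ha⟩
    -- An implication with a refutable premise is derivable from `⊤`.
    · exact (Ded.truR hI.imps.inL).cut (Ent.tru_imp hq2 h.1)
    · have hfa : f a ∈ q.2.den := by
        have := mem_imps.1 (hs (hf.ge (Set.mem_Ici.2 le_rfl))) q hq a (ha.ge Set.self_mem_Ici)
        rwa [OrderIso.symm_apply_apply] at this
      have hA := hI.sublist (active_sublist I a)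
      have h1 : Ent (imps I) (imps (active I a)) := by
        refine Ent.bigAndR hI.imps.inL fun χ hχ => ?_
        obtain ⟨p, hp, rfl⟩ := List.mem_map.1 hχ
        exact hI.imps_ent ((active_sublist I a).subset hp)
      refine (h1.cut (hA.imps_ent_imp hq1 fun p hp => ?_)).cut (.impMono (.id hq1.inL) ?_)
      · refine L.complete hq1 (hA p hp).1 ?_
        rw [ha]
        exact fun x hx => (L.scottOpen (hA p hp).1).upper hx (mem_active.1 hp).2
      · refine L.complete hA.conclusions hq2 ?_
        rw [hfx]
        exact fun x hx => (L.scottOpen hq2).upper hx hfa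
  · exact (L.not_coherent hI hc).1.fls_elim hJ.imps

/-! ### Products, sums and recursive types -/

theorem Level.prod_decided (L : Level n) {φ : Fm 0 [] P} {ψ : Fm 0 [] Q} (hφ : ConjD n φ)
    (hψ : ConjD n ψ) : Decided ((φ.mod .fst).and (ψ.mod .snd)) := by
  have iφ : InL .neutral (φ.mod (.fst : Modality P (.prod P Q))) := .mod hφ.inL
  have iψ : InL .neutral (ψ.mod (.snd : Modality Q (.prod P Q))) := .mod hψ.inL
  rcases L.decided hφ with ⟨h1, h2⟩ | ⟨h1, c, hc⟩
  · refine .inl ⟨.andL₁ iψ ((Ded.modMono h1).cut .modFls), ?_⟩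
    exact Set.eq_empty_iff_forall_notMem.2 fun x hx => h2.le (Fm.mem_fst.1 hx.1)
  rcases L.decided hψ with ⟨h1', h2⟩ | ⟨h1', c', hc'⟩
  · refine .inl ⟨.andL₂ iφ ((Ded.modMono h1').cut .modFls), ?_⟩
    exact Set.eq_empty_iff_forall_notMem.2 fun x hx => h2.le (Fm.mem_snd.1 hx.2)
  refine .inr ⟨.pair h1 h1', prodIso P Q (c, c'), ?_⟩
  ext x
  rw [Fm.den_and, Set.mem_inter_iff, Fm.mem_fst, Fm.mem_snd, hc, hc', Set.mem_Ici,
    Set.mem_Ici, Set.mem_Ici, ← OrderIso.le_symm_apply]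
  rfl

/-- An inclusion of products splits into its factors only if both factors on the left are inhabited;
an empty factor makes the left side refutable. -/
theorem Level.prod_complete (L : Level n) {φ φ' : Fm 0 [] P} {ψ ψ' : Fm 0 [] Q}
    (hφ : ConjD n φ) (hψ : ConjD n ψ) (hφ' : ConjD n φ') (hψ' : ConjD n ψ')
    (hs : ((φ.mod .fst).and (ψ.mod .snd)).den ⊆ ((φ'.mod .fst).and (ψ'.mod .snd)).den) :
    Ent ((φ.mod .fst).and (ψ.mod .snd)) ((φ'.mod .fst).and (ψ'.mod .snd)) := by
  have hd : ConjD (n + 1) ((φ'.mod (.fst : Modality P (.prod P Q))).and (ψ'.mod .snd)) :=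
    .and hφ'.mod hψ'.mod
  have iφ : InL .neutral (φ.mod (.fst : Modality P (.prod P Q))) := .mod hφ.inL
  have iψ : InL .neutral (ψ.mod (.snd : Modality Q (.prod P Q))) := .mod hψ.inL
  have hmem : ∀ x ∈ φ.den, ∀ y ∈ ψ.den, x ∈ φ'.den ∧ y ∈ ψ'.den := by
    intro x hx y hy
    have h : prodIso P Q (x, y) ∈ ((φ.mod .fst).and (ψ.mod .snd)).den := by
      rw [Fm.den_and, Set.mem_inter_iff, Fm.mem_fst, Fm.mem_snd, OrderIso.symm_apply_apply]
      exact ⟨hx, hy⟩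
    have := hs h
    rwa [Fm.den_and, Set.mem_inter_iff, Fm.mem_fst, Fm.mem_snd,
      OrderIso.symm_apply_apply] at this
  rcases Set.eq_empty_or_nonempty φ.den with he | ⟨x, hx⟩
  · exact Ent.fls_elim (.andL₁ iψ
      ((Ded.modMono ((L.decided hφ).fls_of_empty he)).cut .modFls)) hd
  rcases Set.eq_empty_or_nonempty ψ.den with he | ⟨y, hy⟩
  · exact Ent.fls_elim (.andL₂ iφ
      ((Ded.modMono ((L.decided hψ).fls_of_empty he)).cut .modFls)) hd
  exact Ent.andMono iφ iψ (.modMono (L.complete hφ hφ' fun z hz => (hmem z hz y hy).1))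
    (.modMono (L.complete hψ hψ' fun z hz => (hmem x hx z hz).2))

theorem Level.fold_decided (L : Level n) {P : Ty 1} {φ : Fm 0 [] P.unfold} (hφ : ConjD n φ) :
    Decided (φ.mod .fold) := by
  rcases L.decided hφ with ⟨h1, h2⟩ | ⟨h1, c, hc⟩
  · refine .inl ⟨(Ded.modMono h1).cut .modFls, ?_⟩
    exact Set.eq_empty_iff_forall_notMem.2 fun x hx => h2.le (Fm.mem_fold.1 hx)
  · refine .inr ⟨.fold h1, muIso P c, ?_⟩
    ext x
    rw [Fm.mem_fold, hc, Set.mem_Ici, Set.mem_Ici, OrderIso.le_symm_apply]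

theorem Level.inl_decided (L : Level n) {φ : Fm 0 [] P} (hφ : ConjD n φ) :
    Decided (φ.mod (.inl : Modality P (.sum P Q))) := by
  rcases L.decided hφ with ⟨h1, h2⟩ | ⟨h1, c, hc⟩
  · exact .inl ⟨(Ded.modMono h1).cut .modFls, by rw [Fm.den_inl, h2, Set.image_empty]⟩
  · refine .inr ⟨.inl h1, sumIso P Q (.inl c), ?_⟩
    ext y
    rw [Fm.den_inl, hc, Set.mem_Ici, ← OrderIso.le_symm_apply, LSum.inl_le]
    constructor
    · rintro ⟨x, hx, rfl⟩
      exact ⟨x, OrderIso.symm_apply_apply _ _, hx⟩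
    · rintro ⟨x, h, hx⟩
      exact ⟨x, hx, ((sumIso P Q).symm_apply_eq.1 h).symm⟩

theorem Level.inr_decided (L : Level n) {φ : Fm 0 [] Q} (hφ : ConjD n φ) :
    Decided (φ.mod (.inr : Modality Q (.sum P Q))) := by
  rcases L.decided hφ with ⟨h1, h2⟩ | ⟨h1, c, hc⟩
  · exact .inl ⟨(Ded.modMono h1).cut .modFls, by rw [Fm.den_inr, h2, Set.image_empty]⟩
  · refine .inr ⟨.inr h1, sumIso P Q (.inr c), ?_⟩
    ext y
    rw [Fm.den_inr, hc, Set.mem_Ici, ← OrderIso.le_symm_apply, LSum.inr_le]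
    constructor
    · rintro ⟨x, hx, rfl⟩
      exact ⟨x, OrderIso.symm_apply_apply _ _, hx⟩
    · rintro ⟨x, h, hx⟩
      exact ⟨x, hx, ((sumIso P Q).symm_apply_eq.1 h).symm⟩

/-- Separates `⊤` from the injection formulae in `Level.complete_succ`. -/
theorem sum_bot_notMem_inl {φ : Fm 0 [] P} :
    sumIso P Q .bot ∉ (φ.mod (.inl : Modality P (.sum P Q))).den := by
  rintro ⟨x, _, h⟩
  cases (sumIso P Q).injective h

theorem sum_bot_notMem_inr {φ : Fm 0 [] Q} :
    sumIso P Q .bot ∉ (φ.mod (.inr : Modality Q (.sum P Q))).den := by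
  rintro ⟨x, _, h⟩
  cases (sumIso P Q).injective h

theorem mem_inl {φ : Fm 0 [] P} {s : LSum (dom P) (dom Q)} :
    sumIso P Q s ∈ (φ.mod (.inl : Modality P (.sum P Q))).den ↔ ∃ x ∈ φ.den, s = .inl x := by
  constructor
  · rintro ⟨x, hx, h⟩
    exact ⟨x, hx, ((sumIso P Q).injective h).symm⟩
  · rintro ⟨x, hx, rfl⟩
    exact ⟨x, hx, rfl⟩

theorem mem_inr {φ : Fm 0 [] Q} {s : LSum (dom P) (dom Q)} :
    sumIso P Q s ∈ (φ.mod (.inr : Modality Q (.sum P Q))).den ↔ ∃ x ∈ φ.den, s = .inr x := by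
  constructor
  · rintro ⟨x, hx, h⟩
    exact ⟨x, hx, ((sumIso P Q).injective h).symm⟩
  · rintro ⟨x, hx, rfl⟩
    exact ⟨x, hx, rfl⟩

/-! ### The induction -/

/-- The delicate constructor is implication, an intersection over all points of the premise. The
dichotomy makes it trivial if the premise is empty; otherwise, by monotonicity, it reduces to
evaluation at the least element of the premise. -/
theorem Level.scottOpen_succ (L : Level n) {R : PTy} {φ : Fm 0 [] R} :
    ConjD (n + 1) φ → ScottOpen φ.den
  | .tru => .univ
  | .fls => .empty
  | .and h1 h2 => (L.scottOpen_succ h1).inter (L.scottOpen_succ h2)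
  | .star => by
    convert ScottOpen.ici_true.image_iso unitIso using 1
    exact Set.image_singleton.symm
  | .mod (m := .fst) h =>
    (L.scottOpen h).preimage (SHom.comp SHom.fst (SHom.ofIso (prodIso _ _).symm))
  | .mod (m := .snd) h =>
    (L.scottOpen h).preimage (SHom.comp SHom.snd (SHom.ofIso (prodIso _ _).symm))
  | .mod (m := .inl) h => by
    convert ((L.scottOpen h).image_inl).image_iso (sumIso _ _) using 1
    rw [Set.image_image]
    rfl
  | .mod (m := .inr) h => by
    convert ((L.scottOpen h).image_inr).image_iso (sumIso _ _) using 1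
    rw [Set.image_image]
    rfl
  | .mod (m := .fold) h => (L.scottOpen h).preimage (SHom.ofIso (muIso _).symm)
  | .imp (P := P) (Q := Q) (ψ := ψ) (φ := φ) h1 h2 => by
    rcases L.decided h1 with ⟨_, he⟩ | ⟨_, c, hc⟩
    · convert ScottOpen.univ using 1
      refine Set.eq_univ_of_forall fun f => Fm.mem_imp.2 fun x hx => ?_
      rw [he] at hx
      exact hx.elim
    · convert (L.scottOpen h2).preimage
        (SHom.comp ⟨_, SHom.cont_apply c⟩ (SHom.ofIso (arrIso Q P).symm)) using 1
      ext f
      rw [Fm.mem_imp, hc]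
      exact ⟨fun h => h c Set.self_mem_Ici, fun h x hx =>
        (L.scottOpen h2).upper (((arrIso Q P).symm f).mono hx) h⟩

/-- The normal form at each type exposes components of depth `n`. For a recursive type these live at
`P.unfold`, where only the depth has decreased. -/
theorem Level.decided_succ (L : Level n) {R : PTy} {φ : Fm 0 [] R} (h : ConjD (n + 1) φ) :
    Decided φ := by
  match R, φ, h with
  | .unit, φ, h =>
    rcases h.nf_unit with e | e | e
    · exact Decided.of_equi h e .tru
    · exact Decided.of_equi h e .fls
    · refine Decided.of_equi h e (.inr ⟨.star, unitIso true, ?_⟩)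
      ext x
      obtain ⟨b, rfl⟩ := unitIso.surjective x
      rw [Fm.den_star, Set.mem_singleton_iff, Set.mem_Ici, unitIso.le_iff_le,
        unitIso.injective.eq_iff]
      cases b <;> simp
  | .prod P Q, φ, h =>
    obtain ⟨φ₁, φ₂, h1, h2, e⟩ := h.nf_prod
    exact Decided.of_equi h e (L.prod_decided h1 h2)
  | .arr Q P, φ, h =>
    obtain ⟨I, hI, e⟩ := h.nf_arr
    exact Decided.of_equi h e (L.imps_decided hI)
  | .sum P Q, φ, h =>
    rcases h.nf_sum with e | ⟨φ', h', e⟩ | ⟨φ', h', e⟩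
    · exact Decided.of_equi h e .tru
    · exact Decided.of_equi h e (L.inl_decided h')
    · exact Decided.of_equi h e (L.inr_decided h')
  | .mu P, φ, h =>
    obtain ⟨φ', h', e⟩ := h.nf_mu
    exact Decided.of_equi h e (L.fold_decided h')

/-- When the two normal forms have different shapes, the right side is provable, the left side is
empty and hence refutable, or the inclusion fails at the least element. -/
theorem Level.complete_succ (L : Level n) {R : PTy} {φ ψ : Fm 0 [] R} (hφ : ConjD (n + 1) φ)
    (hψ : ConjD (n + 1) ψ) (hs : φ.den ⊆ ψ.den) : Ent φ ψ := by
  match R, φ, ψ, hφ, hψ, hs with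
  | .unit, φ, ψ, hφ, hψ, hs =>
    have hne : unitIso false ≠ unitIso true := fun h => by
      cases unitIso.injective h
    rcases hψ.nf_unit with e' | e' | e'
    · exact (Ded.truR hφ.inL).cut e'.mpr
    · exact Ent.fls_elim ((L.decided_succ hφ).fls_of_empty
        (Set.subset_empty_iff.1 (hs.trans e'.den.le))) hψ
    · rcases hφ.nf_unit with e | e | e
      -- The least element satisfies `⊤` but not `⟨⟩`, so the assumed inclusion is absurd.
      · have : unitIso false ∈ (Fm.star : Fm 0 [] .unit).den :=
          e'.den.le (hs (e.den.ge trivial))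
        exact (hne this).elim
      · exact e.mp.fls_elim hψ
      · exact e.mp.cut e'.mpr
  | .prod P Q, φ, ψ, hφ, hψ, hs =>
    obtain ⟨φ₁, φ₂, h1, h2, e⟩ := hφ.nf_prod
    obtain ⟨ψ₁, ψ₂, h1', h2', e'⟩ := hψ.nf_prod
    exact e.complete e' (L.prod_complete h1 h2 h1' h2') hs
  | .arr Q P, φ, ψ, hφ, hψ, hs =>
    obtain ⟨I, hI, e⟩ := hφ.nf_arr
    obtain ⟨J, hJ, e'⟩ := hψ.nf_arr
    exact e.complete e' (L.imps_complete hI hJ) hs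
  | .sum P Q, φ, ψ, hφ, hψ, hs =>
    rcases hψ.nf_sum with e' | ⟨ψ', h', e'⟩ | ⟨ψ', h', e'⟩
    · exact (Ded.truR hφ.inL).cut e'.mpr
    · rcases hφ.nf_sum with e | ⟨φ', h, e⟩ | ⟨φ', h, e⟩
      · exact (sum_bot_notMem_inl (e'.den.le (hs (e.den.ge trivial)))).elim
      · refine e.complete e' (fun hs => .modMono (L.complete h h' fun x hx => ?_)) hs
        obtain ⟨y, hy, hxy⟩ := mem_inl.1 (hs (mem_inl.2 ⟨x, hx, rfl⟩))
        cases hxy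
        exact hy
      -- The injections have disjoint images, so the inclusion forces the left component to be
      -- empty, hence refutable.
      · refine e.complete e' (fun hs => Ent.fls_elim ((Ded.modMono
          ((L.decided h).fls_of_empty ?_)).cut .modFls) h'.mod) hs
        refine Set.eq_empty_iff_forall_notMem.2 fun x hx => ?_
        obtain ⟨y, hy, hxy⟩ := mem_inl.1 (hs (mem_inr.2 ⟨x, hx, rfl⟩))
        cases hxy
    · rcases hφ.nf_sum with e | ⟨φ', h, e⟩ | ⟨φ', h, e⟩
      · exact (sum_bot_notMem_inr (e'.den.le (hs (e.den.ge trivial)))).elim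
      · refine e.complete e' (fun hs => Ent.fls_elim ((Ded.modMono
          ((L.decided h).fls_of_empty ?_)).cut .modFls) h'.mod) hs
        refine Set.eq_empty_iff_forall_notMem.2 fun x hx => ?_
        obtain ⟨y, hy, hxy⟩ := mem_inr.1 (hs (mem_inl.2 ⟨x, hx, rfl⟩))
        cases hxy
      · refine e.complete e' (fun hs => .modMono (L.complete h h' fun x hx => ?_)) hs
        obtain ⟨y, hy, hxy⟩ := mem_inr.1 (hs (mem_inr.2 ⟨x, hx, rfl⟩))
        cases hxy
        exact hy
  | .mu P, φ, ψ, hφ, hψ, hs =>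
    obtain ⟨φ', h, e⟩ := hφ.nf_mu
    obtain ⟨ψ', h', e'⟩ := hψ.nf_mu
    refine e.complete e' (fun hs => .modMono (L.complete h h' fun x hx => ?_)) hs
    have : muIso P x ∈ (φ'.mod .fold).den := by
      rw [Fm.mem_fold, OrderIso.symm_apply_apply]
      exact hx
    have := hs this
    rwa [Fm.mem_fold, OrderIso.symm_apply_apply] at this

theorem Level.zero : Level 0 where
  scottOpen h := by
    rcases h.nf_zero with e | e
    · rw [e.den]; exact .univ
    · rw [e.den]; exact .empty
  decided h := by
    rcases h.nf_zero with e | e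
    · exact Decided.of_equi h e .tru
    · exact Decided.of_equi h e .fls
  complete hφ hψ hs := by
    rcases hφ.nf_zero with e | e
    · rcases hψ.nf_zero with e' | e'
      · exact e.mp.cut e'.mpr
      -- Every domain has a least element, so `⊤` is not included in `⊥`.
      · exact (e'.den.le (hs (e.den.ge (Set.mem_univ ⊥)))).elim
    · exact e.mp.fls_elim hψ

theorem level (n : ℕ) : Level n := by
  induction n with
  | zero => exact .zero
  | succ n L => exact ⟨L.scottOpen_succ, L.decided_succ, L.complete_succ⟩

end Level

-- The conjunctive fragment without depth bounds

section Conj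

variable {P : PTy} {φ ψ : Fm 0 [] P}

theorem Fm.IsConj.depth (h : φ.IsConj) : ∃ n, ConjD n φ := h.exists_conjD rfl rfl

theorem Fm.IsConj.scottOpen (h : φ.IsConj) : ScottOpen φ.den := by
  obtain ⟨n, hn⟩ := h.depth
  exact (level n).scottOpen hn

theorem Fm.IsConj.decided (h : φ.IsConj) : Decided φ := by
  obtain ⟨n, hn⟩ := h.depth
  exact (level n).decided hn

/-- Deduction is complete for the conjunctive fragment. -/
theorem Fm.IsConj.complete (hφ : φ.IsConj) (hψ : ψ.IsConj) (hs : φ.den ⊆ ψ.den) : Ent φ ψ := by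
  obtain ⟨n, hn⟩ := hφ.depth
  obtain ⟨m, hm⟩ := hψ.depth
  exact (level (max n m)).complete (hn.mono (le_max_left _ _)) (hm.mono (le_max_right _ _)) hs

end Conj

/-! ## Definability of the finite approximations -/

/-- Embedding is left adjoint to projection, so a lower bound on the `n`-th projection defines a
principal filter of the bilimit. -/
theorem Lim.emb_le_iff {C : Chain} {n : ℕ} {a : C.X n} {y : Lim C} :
    Lim.emb C n a ≤ y ↔ a ≤ y.seq n := by
  constructor
  · intro h
    have := h n
    rwa [Lim.proj_emb] at this
  · intro h
    exact ((Lim.emb C n).mono h).trans (Lim.emb_proj_le C n y)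

/-- Finiteness lets the graph of a function between stages be listed by a finite conjunction of
implications. -/
instance finite_approx : ∀ (n : ℕ) (P : PTy), Finite (approx n P)
  | 0, _ => inferInstanceAs (Finite PUnit)
  | _ + 1, .unit => inferInstanceAs (Finite Bool)
  | n + 1, .prod P Q =>
    have := finite_approx n P
    have := finite_approx n Q
    inferInstanceAs (Finite (approx n P × approx n Q))
  | n + 1, .arr Q P =>
    have := finite_approx n P
    have := finite_approx n Q
    Finite.of_injective (β := approx n Q → approx n P) SHom.toFun
      fun _ _ h => SHom.ext fun x => congrFun h x
  | n + 1, .sum P Q =>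
    have := finite_approx n P
    have := finite_approx n Q
    Finite.of_surjective (α := Option (approx n P ⊕ approx n Q))
      (fun | none => LSum.bot | some (.inl x) => LSum.inl x | some (.inr y) => LSum.inr y)
      (fun
        | .bot => ⟨none, rfl⟩
        | .inl x => ⟨some (.inl x), rfl⟩
        | .inr y => ⟨some (.inr y), rfl⟩)
  | n + 1, .mu P => finite_approx n P.unfold

theorem Fm.IsConj.bigAnd {P : PTy} {l : List (Fm 0 [] P)} (h : ∀ φ ∈ l, φ.IsConj) :
    (Fm.bigAnd l).IsConj := by
  induction l with
  | nil => trivial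
  | cons φ l ih => exact ⟨h φ (by simp), ih fun ψ hψ => h ψ (by simp [hψ])⟩

/-- Each element of a finite approximation is defined by a conjunctive formula. -/
theorem exists_conj_def : ∀ (n : ℕ) (P : PTy) (a : approx n P),
    ∃ φ : Fm 0 [] P, φ.IsConj ∧ ∀ y : dom P, y ∈ φ.den ↔ a ≤ y.seq n
  | 0, _, _ => ⟨.tru, trivial, fun _ => ⟨fun _ => trivial, fun _ => trivial⟩⟩
  | _ + 1, .unit, false => ⟨.tru, trivial, fun _ => ⟨fun _ => bot_le, fun _ => trivial⟩⟩
  | _ + 1, .unit, true => by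
    refine ⟨.star, trivial, fun y => ?_⟩
    obtain ⟨b, rfl⟩ := unitIso.surjective y
    rw [Fm.den_star, Set.mem_singleton_iff, unitIso.injective.eq_iff]
    exact top_le_iff.symm
  | n + 1, .prod P Q, a => by
    obtain ⟨φ, hφ, h1⟩ := exists_conj_def n P a.1
    obtain ⟨ψ, hψ, h2⟩ := exists_conj_def n Q a.2
    refine ⟨(φ.mod .fst).and (ψ.mod .snd), ⟨hφ, hψ⟩, fun y => ?_⟩
    rw [Fm.den_and, Set.mem_inter_iff, Fm.mem_fst, Fm.mem_snd, h1, h2]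
    rfl
  | n + 1, .arr Q P, a => by
    choose φ hφ hφ' using exists_conj_def n P
    choose ψ hψ hψ' using exists_conj_def n Q
    have := Fintype.ofFinite (approx n Q)
    -- One implication for each argument `x` of the finite stage: inputs above `x` are sent above `a
    -- x`.
    let l : List (Fm 0 [] Q × Fm 0 [] P) :=
      (Finset.univ : Finset (approx n Q)).toList.map fun x => (ψ x, φ (SHom.toFun a x))
    refine ⟨imps l, ?_, fun y => ?_⟩
    · refine Fm.IsConj.bigAnd fun χ hχ => ?_
      simp only [l, List.map_map, List.mem_map] at hχ
      obtain ⟨x, _, rfl⟩ := hχ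
      exact ⟨hψ x, hφ _⟩
    · obtain ⟨g, rfl⟩ := (arrIso Q P).surjective y
      -- By construction of the bilimit, the projection of `g` to stage `n + 1` embeds an argument
      -- from stage `n`, applies `g` and projects the value back.
      have : a ≤ (arrIso Q P g).seq (n + 1) ↔
          ∀ x, SHom.toFun a x ≤ (g (Lim.emb (tyChain Q) n x)).seq n := Iff.rfl
      rw [mem_imps, this, OrderIso.symm_apply_apply]
      simp only [l, List.forall_mem_map, Finset.mem_toList, Finset.mem_univ, true_imp_iff,
        hφ', hψ']
      -- One direction tests each implication at the embedded `x`, the least point of its premise;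
      -- the other is monotonicity of `g`.
      exact ⟨fun h x => h x _ (Lim.emb_le_iff (C := tyChain Q).1 le_rfl), fun h x z hz =>
        (h x).trans (g.mono (Lim.emb_le_iff.2 hz) n)⟩
  | n + 1, .sum P Q, .bot => ⟨.tru, trivial, fun _ => ⟨fun _ => trivial, fun _ => trivial⟩⟩
  | n + 1, .sum P Q, .inl a => by
    obtain ⟨φ, hφ, h1⟩ := exists_conj_def n P a
    refine ⟨φ.mod .inl, hφ, fun y => ?_⟩
    obtain ⟨s, rfl⟩ := (sumIso P Q).surjective y
    rw [mem_inl]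
    cases s with
    | bot => exact ⟨fun ⟨_, _, h⟩ => (by cases h), fun h => h.elim⟩
    | inl x => exact ⟨fun ⟨_, hx, h⟩ => (by cases h; exact (h1 x).1 hx),
        fun h => ⟨x, (h1 x).2 h, rfl⟩⟩
    | inr x => exact ⟨fun ⟨_, _, h⟩ => (by cases h), fun h => h.elim⟩
  | n + 1, .sum P Q, .inr a => by
    obtain ⟨φ, hφ, h1⟩ := exists_conj_def n Q a
    refine ⟨φ.mod .inr, hφ, fun y => ?_⟩
    obtain ⟨s, rfl⟩ := (sumIso P Q).surjective y
    rw [mem_inr]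
    cases s with
    | bot => exact ⟨fun ⟨_, _, h⟩ => (by cases h), fun h => h.elim⟩
    | inr x => exact ⟨fun ⟨_, hx, h⟩ => (by cases h; exact (h1 x).1 hx),
        fun h => ⟨x, (h1 x).2 h, rfl⟩⟩
    | inl x => exact ⟨fun ⟨_, _, h⟩ => (by cases h), fun h => h.elim⟩
  -- Stage `n + 1` at a recursive type is stage `n` at its unfolding, so the recursion descends on
  -- the stage.
  | n + 1, .mu P, a => by
    obtain ⟨φ, hφ, h1⟩ := exists_conj_def n P.unfold a
    refine ⟨φ.mod .fold, hφ, fun y => ?_⟩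
    rw [Fm.mem_fold, h1]
    rfl

/-- A Scott-open neighbourhood of `x` contains the least element of a conjunctive formula that
holds at `x`. -/
theorem ScottOpen.exists_conj {P : PTy} {S : Set (dom P)} (hS : ScottOpen S) {x : dom P}
    (hx : x ∈ S) : ∃ φ : Fm 0 [] P, φ.IsConj ∧ x ∈ φ.den ∧ ∃ c ∈ S, φ.den = Set.Ici c := by
  obtain ⟨_, ⟨n, rfl⟩, h⟩ := hS.inacc (Set.range_nonempty _)
    (Lim.emb_proj_mono x).directed_le.directedOn_range (Lim.isLUB_emb_proj x) hx
  obtain ⟨φ, hφ, hd⟩ := exists_conj_def n P (x.seq n)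
  exact ⟨φ, hφ, (hd x).2 le_rfl, _, h, Set.ext fun y => (hd y).trans Lim.emb_le_iff.symm⟩

/-! ## Contexts of conjunctive formulae -/

/-- A conjunctive formula for each variable of a pure context. -/
inductive FCtx : List PTy → Type
  | nil : FCtx []
  | cons {P : PTy} {Δ : List PTy} (φ : Fm 0 [] P) (hφ : φ.IsConj) (Ψ : FCtx Δ) : FCtx (P :: Δ)

/-- The refinement of a pure type by a conjunctive formula. -/
abbrev conjTy {P : PTy} (φ : Fm 0 [] P) (hφ : φ.IsConj) : RTy P :=
  .refine φ ⟨.neutral, InL.of_isConj hφ _⟩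

def FCtx.toRCtx : {Δ : List PTy} → FCtx Δ → RCtx
  | _, .nil => []
  | _, .cons (P := P) φ hφ Ψ => ⟨P, conjTy φ hφ⟩ :: Ψ.toRCtx

theorem FCtx.und_toRCtx {Δ : List PTy} (Ψ : FCtx Δ) : Ψ.toRCtx.und = Δ := by
  induction Ψ with
  | nil => rfl
  | cons φ hφ Ψ ih => exact congrArg (List.cons _) ih

/-- The components of `u` are the least elements of the formulae in the context. -/
def FCtx.Least : {Δ : List PTy} → FCtx Δ → ctxDom Δ → Prop
  | _, .nil, _ => True
  | _, .cons (P := P) (Δ := Δ) φ _ Ψ, u =>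
    let u' : dom P × ctxDom Δ := u
    φ.den = Set.Ici u'.1 ∧ Ψ.Least u'.2

/-- The occurrences belong to different lists, so they are matched through their positions. -/
theorem FCtx.exists_var {Δ : List PTy} {P : PTy} (v : Var Δ P) (Ψ : FCtx Δ) (u : ctxDom Δ)
    (hu : Ψ.Least u) : ∃ (φ : Fm 0 [] P) (hφ : φ.IsConj) (w : Var Ψ.toRCtx ⟨P, conjTy φ hφ⟩),
      w.idx = v.idx ∧ φ.den = Set.Ici (v.sem u) := by
  induction v with
  | zero =>
    cases Ψ with
    | cons φ hφ Ψ => exact ⟨φ, hφ, .zero, rfl, hu.1⟩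
  | succ v ih =>
    cases Ψ with
    | cons φ hφ Ψ =>
      obtain ⟨χ, hχ, w, hw, h⟩ := ih Ψ _ hu.2
      exact ⟨χ, hχ, .succ w, congrArg (· + 1) hw, h⟩

/-! ## Completeness of typing -/

section Typing

variable {P Q : PTy}

theorem CtxSub.refl (Γ : RCtx) : CtxSub Γ Γ := by
  induction Γ with
  | nil => exact .nil
  | cons A Γ ih => exact .cons .refl ih

theorem CtxSub.und_eq {Γ Γ' : RCtx} (h : CtxSub Γ Γ') : Γ.und = Γ'.und := by
  induction h with
  | nil => rfl
  | cons _ _ ih => exact congrArg (List.cons _) ih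

theorem RTyping.weaken {Γ : RCtx} {M : Tm} {φ ψ : Fm 0 [] P} {hφ : ∃ s, InL s φ}
    {hψ : ∃ s, InL s ψ} (h : RTyping Γ M (.refine φ hφ)) (e : Ent φ ψ) :
    RTyping Γ M (.refine ψ hψ) :=
  .sub (.refl Γ) h (.ded e)

theorem RTyping.of_tru {Γ : RCtx} {M : Tm} {φ : Fm 0 [] P} {hφ : ∃ s, InL s φ}
    (d : PTyping Γ.und M P) (e : Ent .tru φ) : RTyping Γ M (.refine φ hφ) :=
  .sub (.refl Γ) (.pure d) (.trans (.pureTru (h := ⟨.neutral, .tru⟩)) (.ded e))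

/-- A formula that holds at the least element is provable. -/
theorem Fm.IsConj.tru_ent {φ : Fm 0 [] P} (hφ : φ.IsConj) (h : ⊥ ∈ φ.den) : Ent .tru φ :=
  Fm.IsConj.complete (φ := .tru) trivial hφ fun _ _ => hφ.scottOpen.upper bot_le h

/-- The pure derivation is needed for the empty conjunction, which only pure typing and subtyping
provide. -/
theorem RTyping.bigAnd {Γ : RCtx} {M : Tm} {l : List (Fm 0 [] P)} {hl : ∃ s, InL s (Fm.bigAnd l)}
    (d : PTyping Γ.und M P) (h : ∀ φ ∈ l, ∃ hφ : φ.IsConj, RTyping Γ M (conjTy φ hφ)) :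
    RTyping Γ M (.refine (Fm.bigAnd l) hl) := by
  induction l with
  | nil => exact .of_tru d (.id .tru)
  | cons φ l ih =>
    have hc : (Fm.bigAnd l).IsConj :=
      .bigAnd fun φ hφ => (h φ (List.mem_cons_of_mem _ hφ)).1
    exact .and (h φ (by simp)).2
      (ih (hl := ⟨.neutral, InL.of_isConj hc _⟩) fun χ hχ => h χ (by simp [hχ]))

end Typing

-- Least fixpoints and Scott-open sets

section Fixpoint

variable {X : Type} [CompletePartialOrder X]

theorem SHom.iter_mono (X : Type) [CompletePartialOrder X] : Monotone (SHom.iter X) := by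
  refine monotone_nat_of_le_succ fun n => ?_
  induction n with
  | zero => exact fun f => bot_le
  | succ n ih => exact fun f => f.mono (ih f)

/-- The least fixpoint is the supremum of the iterates at the least element. -/
theorem SHom.isLUB_lfp (f : SHom X X) :
    IsLUB (Set.range fun n => SHom.iter X n f) (SHom.lfp X f) := by
  have hd := (SHom.iter_mono X).directed_le.directedOn_range
  have h : SHom.lfp X f = sSup _ := SHom.sSup_apply hd f
  rw [h, ← Set.range_comp]
  have h' := (SHom.directed_apply hd f).isLUB_sSup
  rw [← Set.range_comp] at h'
  exact h'

/-- An open property of the least fixpoint already holds at a finite iterate; this bounds the number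
of uses of the typing rule for `fix`. -/
theorem ScottOpen.exists_iter {S : Set X} (hS : ScottOpen S) {f : SHom X X}
    (h : SHom.lfp X f ∈ S) : ∃ n, SHom.iter X n f ∈ S := by
  have hm : Monotone fun n => SHom.iter X n f := fun _ _ h => SHom.iter_mono X h f
  obtain ⟨_, ⟨n, rfl⟩, hn⟩ := hS.inacc (Set.range_nonempty _) hm.directed_le.directedOn_range
    (SHom.isLUB_lfp f) h
  exact ⟨n, hn⟩

end Fixpoint

theorem Fm.IsConj.depth_succ {P : PTy} {φ : Fm 0 [] P} (h : φ.IsConj) : ∃ n, ConjD (n + 1) φ := by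
  obtain ⟨n, hn⟩ := h.depth
  exact ⟨n, hn.mono n.le_succ⟩

/-- The typing of `M` that is asserted by the completeness theorem. -/
def Typable {Δ : List PTy} {M : Tm} {P : PTy} (d : PTyping Δ M P) : Prop :=
  ∀ (Ψ : FCtx Δ) (u : ctxDom Δ), Ψ.Least u → ∀ (φ : Fm 0 [] P) (hφ : φ.IsConj),
    d.sem u ∈ φ.den → RTyping Ψ.toRCtx M (conjTy φ hφ)

-- Typability for each term constructor

section Typable

variable {Δ : List PTy} {M N : Tm} {P Q : PTy}

/-- A premise about an extended context holds for some conjunctive formula true at `x`. -/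
theorem Typable.exists_premise {d : PTyping (Q :: Δ) M P} (h : Typable d) {Ψ : FCtx Δ}
    {u : ctxDom Δ} (hu : Ψ.Least u) {x : dom Q} {φ : Fm 0 [] P} (hφ : φ.IsConj)
    (hx : d.sem ((x, u) : dom Q × ctxDom Δ) ∈ φ.den) :
    ∃ (ψ : Fm 0 [] Q) (hψ : ψ.IsConj), x ∈ ψ.den ∧
      RTyping (⟨Q, conjTy ψ hψ⟩ :: Ψ.toRCtx) M (conjTy φ hφ) := by
  let g : SHom (dom Q × ctxDom Δ) (dom P) := d.sem
  -- The arguments for which the body satisfies `φ` form an open set. It contains the least element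
  -- `c` of `ψ`, so `(c, u)` is the least tuple of the extended context and the hypothesis applies
  -- there.
  obtain ⟨ψ, hψ, hxψ, c, hc, hd⟩ :=
    (hφ.scottOpen.preimage (SHom.curry g u)).exists_conj (x := x) hx
  exact ⟨ψ, hψ, hxψ, h (.cons ψ hψ Ψ) ((c, u) : dom Q × ctxDom Δ) ⟨hd, hu⟩ φ hφ hc⟩

/-- The underlying context of `Ψ.toRCtx` is only propositionally `Δ`. The derivation is transported,
and its mere existence suffices since its interpretation plays no role afterwards. -/
theorem FCtx.typing (Ψ : FCtx Δ) (d : PTyping Δ M P) : Nonempty (PTyping Ψ.toRCtx.und M P) := by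
  rw [Ψ.und_toRCtx]
  exact ⟨d⟩

theorem FCtx.typing_cons (Ψ : FCtx Δ) (d : PTyping (Q :: Δ) M P) :
    Nonempty (PTyping (Q :: Ψ.toRCtx.und) M P) := by
  rw [Ψ.und_toRCtx]
  exact ⟨d⟩

theorem Typable.pair {d : PTyping Δ M P} {d' : PTyping Δ N Q} (h : Typable d) (h' : Typable d') :
    Typable (d.pair d') := by
  intro Ψ u hu φ hφ hm
  obtain ⟨n, hn⟩ := hφ.depth_succ
  obtain ⟨φ₁, φ₂, h1, h2, e⟩ := hn.nf_prod
  obtain ⟨p⟩ := Ψ.typing d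
  obtain ⟨p'⟩ := Ψ.typing d'
  rw [e.den] at hm
  have hm1 : ((prodIso P Q).symm (prodIso P Q (d.sem u, d'.sem u))).1 ∈ φ₁.den := hm.1
  have hm2 : ((prodIso P Q).symm (prodIso P Q (d.sem u, d'.sem u))).2 ∈ φ₂.den := hm.2
  rw [OrderIso.symm_apply_apply] at hm1 hm2
  refine RTyping.weaken (hφ := ⟨.neutral, .and (.mod h1.inL) (.mod h2.inL)⟩)
    (.and (hφ := ⟨.neutral, .mod h1.inL⟩) (hψ := ⟨.neutral, .mod h2.inL⟩) ?_ ?_) e.mpr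
  · exact .pair₁ p' (h Ψ u hu φ₁ h1.isConj hm1)
  · exact .pair₂ p (h' Ψ u hu φ₂ h2.isConj hm2)

/-- The normal form splits the goal into single implications. One with a refutable premise is
provable; for one whose premise is the filter of `c`, the body is typed with the least tuple
extended by `c`. -/
theorem Typable.lam {d : PTyping (Q :: Δ) M P} (h : Typable d) : Typable d.lam := by
  intro Ψ u hu φ hφ hm
  obtain ⟨n, hn⟩ := hφ.depth_succ
  obtain ⟨I, hI, e⟩ := hn.nf_arr
  obtain ⟨p⟩ := Ψ.typing d.lam
  refine RTyping.weaken (hφ := ⟨.neutral, hI.imps.inL⟩) (.bigAnd p fun χ hχ => ?_) e.mpr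
  obtain ⟨q, hq, rfl⟩ := List.mem_map.1 hχ
  obtain ⟨hq1, hq2⟩ := hI q hq
  refine ⟨⟨hq1.isConj, hq2.isConj⟩, ?_⟩
  rcases hq1.isConj.decided with ⟨hf, _⟩ | ⟨_, c, hc⟩
  · exact .of_tru p (Ent.tru_imp hq2 hf)
  · have hm' := mem_imps.1 (e.den.le hm) q hq c (hc.ge Set.self_mem_Ici)
    let g : SHom (dom Q × ctxDom Δ) (dom P) := d.sem
    have hl : (arrIso Q P).symm (d.lam.sem u) = SHom.curry g u :=
      OrderIso.symm_apply_apply _ _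
    rw [hl] at hm'
    have := h (.cons q.1 hq1.isConj Ψ) ((c, u) : dom Q × ctxDom Δ) ⟨hc, hu⟩ q.2 hq2.isConj hm'
    exact .sub (.refl _) (.lam this) .arrL

/-- By continuity of the function value, some conjunctive `ψ` true of the argument has its least
element sent into `φ`. The function then satisfies `ψ ⇒ φ`, so `ψ` interpolates between the two
premises. -/
theorem Typable.app {d : PTyping Δ M (.arr Q P)} {d' : PTyping Δ N Q} (h : Typable d)
    (h' : Typable d') : Typable (d.app d') := by
  intro Ψ u hu φ hφ hm
  have hm' : (arrIso Q P).symm (d.sem u) (d'.sem u) ∈ φ.den := hm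
  obtain ⟨ψ, hψ, hx, c, hc, hd⟩ :=
    (hφ.scottOpen.preimage ((arrIso Q P).symm (d.sem u))).exists_conj hm'
  have h1 : d.sem u ∈ (Fm.imp (Δ := []) ψ φ).den := Fm.mem_imp.2 fun x hx => by
    rw [hd] at hx
    exact hφ.scottOpen.upper (((arrIso Q P).symm (d.sem u)).mono hx) hc
  exact .app (.sub (.refl _) (h Ψ u hu (.imp ψ φ) ⟨hψ, hφ⟩ h1) .arrR) (h' Ψ u hu ψ hψ hx)

/-- Openness moves `φ` from the fixpoint to a finite iterate, and the rule for `fix` is applied once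
per iterate. At `⊥` the formula follows from `⊤`, so pure typing suffices. -/
theorem Typable.fix {d : PTyping (P :: Δ) M P} (h : Typable d) : Typable d.fix := by
  intro Ψ u hu φ hφ hm
  obtain ⟨p⟩ := Ψ.typing d.fix
  let g : SHom (dom P × ctxDom Δ) (dom P) := d.sem
  have hm' : SHom.lfp (dom P) (SHom.curry g u) ∈ φ.den := hm
  obtain ⟨n, hn⟩ := hφ.scottOpen.exists_iter hm'
  -- Only membership of the iterate is kept: the formula `ψ` found for the previous iterate is known
  -- to hold there.
  clear hm hm'
  induction n generalizing φ with
  | zero => exact .of_tru p (hφ.tru_ent hn)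
  | succ n ih =>
    obtain ⟨ψ, hψ, hx, ht⟩ := h.exists_premise hu hφ (x := SHom.iter (dom P) n (SHom.curry g u)) hn
    exact .fix (ih ψ hψ hx) ht

theorem Typable.case {L₁ L₂ : Tm} {R : PTy} {d : PTyping Δ M (.sum P Q)}
    {d₁ : PTyping (P :: Δ) L₁ R} {d₂ : PTyping (Q :: Δ) L₂ R} (h : Typable d) (h₁ : Typable d₁)
    (h₂ : Typable d₂) : Typable (d.case d₁ d₂) := by
  intro Ψ u hu φ hφ hm
  obtain ⟨p⟩ := Ψ.typing (d.case d₁ d₂)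
  obtain ⟨p₁⟩ := Ψ.typing_cons d₁
  obtain ⟨p₂⟩ := Ψ.typing_cons d₂
  let g₁ : SHom (dom P × ctxDom Δ) (dom R) := d₁.sem
  let g₂ : SHom (dom Q × ctxDom Δ) (dom R) := d₂.sem
  have hm' : LSum.elim (SHom.curry g₁ u) (SHom.curry g₂ u) ((sumIso P Q).symm (d.sem u)) ∈
    φ.den := hm
  cases hs : (sumIso P Q).symm (d.sem u) with
  | bot =>
    rw [hs] at hm'
    -- An undefined scrutinee gives the value `⊥`, and a formula true at `⊥` is provable.
    exact .of_tru p (hφ.tru_ent hm')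
  | inl x =>
    rw [hs] at hm'
    obtain ⟨ψ, hψ, hx, ht⟩ := h₁.exists_premise hu hφ (x := x) hm'
    exact .case₁ (h Ψ u hu (ψ.mod .inl) hψ ⟨x, hx, ((sumIso P Q).symm_apply_eq.1 hs).symm⟩) ht p₂
  | inr x =>
    rw [hs] at hm'
    obtain ⟨ψ, hψ, hx, ht⟩ := h₂.exists_premise hu hφ (x := x) hm'
    exact .case₂ (h Ψ u hu (ψ.mod .inr) hψ ⟨x, hx, ((sumIso P Q).symm_apply_eq.1 hs).symm⟩) p₁ ht

theorem Typable.inl {d : PTyping Δ M P} (h : Typable d) : Typable (d.inl (Q := Q)) := by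
  intro Ψ u hu φ hφ hm
  obtain ⟨n, hn⟩ := hφ.depth_succ
  obtain ⟨p⟩ := Ψ.typing (d.inl (Q := Q))
  rcases hn.nf_sum with e | ⟨φ', h', e⟩ | ⟨φ', h', e⟩
  · exact .of_tru p e.mpr
  · obtain ⟨y, hy, hxy⟩ := mem_inl.1 (e.den.le hm)
    cases hxy
    exact .weaken (hφ := ⟨.neutral, .mod h'.inL⟩) (.inl (h Ψ u hu φ' h'.isConj hy)) e.mpr
  · obtain ⟨y, hy, hxy⟩ := mem_inr.1 (e.den.le hm)
    cases hxy

theorem Typable.inr {d : PTyping Δ M Q} (h : Typable d) : Typable (d.inr (P := P)) := by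
  intro Ψ u hu φ hφ hm
  obtain ⟨n, hn⟩ := hφ.depth_succ
  obtain ⟨p⟩ := Ψ.typing (d.inr (P := P))
  rcases hn.nf_sum with e | ⟨φ', h', e⟩ | ⟨φ', h', e⟩
  · exact .of_tru p e.mpr
  · obtain ⟨y, hy, hxy⟩ := mem_inl.1 (e.den.le hm)
    cases hxy
  · obtain ⟨y, hy, hxy⟩ := mem_inr.1 (e.den.le hm)
    cases hxy
    exact .weaken (hφ := ⟨.neutral, .mod h'.inL⟩) (.inr (h Ψ u hu φ' h'.isConj hy)) e.mpr

theorem Typable.fold {P : Ty 1} {d : PTyping Δ M P.unfold} (h : Typable d) : Typable d.fold := by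
  intro Ψ u hu φ hφ hm
  obtain ⟨n, hn⟩ := hφ.depth_succ
  obtain ⟨φ', h', e⟩ := hn.nf_mu
  have hm' : (muIso P).symm (muIso P (d.sem u)) ∈ φ'.den := Fm.mem_fold.1 (e.den.le hm)
  rw [OrderIso.symm_apply_apply] at hm'
  exact .weaken (hφ := ⟨.neutral, .mod h'.inL⟩) (.fold (h Ψ u hu φ' h'.isConj hm')) e.mpr

theorem Typable.var (v : Var Δ P) : Typable (.var v) := by
  intro Ψ u hu φ hφ hm
  obtain ⟨ψ, hψ, w, hw, hd⟩ := FCtx.exists_var v Ψ u hu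
  rw [← hw]
  refine .weaken (.var w) (hψ.complete hφ ?_)
  rw [hd]
  exact fun x hx => hφ.scottOpen.upper hx hm

theorem Typable.star : Typable (.star : PTyping Δ .star .unit) := by
  intro Ψ u hu φ hφ hm
  refine .weaken (.star (h := ⟨.neutral, .star⟩)) (Fm.IsConj.complete (φ := .star) trivial hφ ?_)
  rw [Fm.den_star, Set.singleton_subset_iff]
  exact hm

theorem typable {Δ : List PTy} {M : Tm} {P : PTy} (d : PTyping Δ M P) : Typable d := by
  induction d with
  | var v => exact .var v
  | star => exact .star
  | pair _ _ h h' => exact h.pair h'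
  | fst _ h => exact fun Ψ u hu φ hφ hm => .proj₁ (h Ψ u hu (φ.mod .fst) hφ hm)
  | snd _ h => exact fun Ψ u hu φ hφ hm => .proj₂ (h Ψ u hu (φ.mod .snd) hφ hm)
  | lam _ h => exact h.lam
  | app _ _ h h' => exact h.app h'
  | fix _ h => exact h.fix
  | fold _ h => exact h.fold
  | unfold _ h => exact fun Ψ u hu φ hφ hm => .unfold (h Ψ u hu (φ.mod .fold) hφ hm)
  | inl _ h => exact h.inl
  | inr _ h => exact h.inr
  | case _ _ _ h h₁ h₂ => exact h.case h₁ h₂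

end Typable

/-! ## Reduction to refinements of pure types -/

/-- A refinement type in the conjunctive fragment is equivalent to a refinement of a pure type. -/
theorem RTy.IsConj.exists_conjTy {P : PTy} {T : RTy P} (hT : T.IsConj) :
    ∃ (φ : Fm 0 [] P) (hφ : φ.IsConj),
      Sub T (conjTy φ hφ) ∧ Sub (conjTy φ hφ) T ∧ T.sem = φ.den := by
  induction T with
  | pure P => exact ⟨.tru, trivial, .pureTru, .toPure, rfl⟩
  | refine φ h => exact ⟨φ, hT, .refl, .refl, rfl⟩
  | prod T U h1 h2 =>
    obtain ⟨φ, hφ, a, b, c⟩ := h1 hT.1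
    obtain ⟨ψ, hψ, a', b', c'⟩ := h2 hT.2
    refine ⟨(φ.mod .fst).and (ψ.mod .snd), ⟨hφ, hψ⟩, (Sub.prod a a').trans .prodL,
      Sub.trans .prodR (.prod b b'), ?_⟩
    show Modality.sem .fst T.sem ∩ Modality.sem .snd U.sem = _
    rw [c, c']
    rfl
  | arr U T h1 h2 =>
    obtain ⟨ψ, hψ, a, b, c⟩ := h1 hT.1
    obtain ⟨φ, hφ, a', b', c'⟩ := h2 hT.2
    refine ⟨.imp ψ φ, ⟨hψ, hφ⟩, (Sub.arr b a').trans .arrL, Sub.trans .arrR (.arr a b'), ?_⟩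
    ext f
    show (∀ x ∈ U.sem, _ ∈ T.sem) ↔ _
    rw [c, c']
    rfl

/-- A context in the conjunctive fragment either is inconsistent or has a least tuple. -/
theorem RCtx.IsConj.decided {Γ : RCtx} (hΓ : Γ.IsConj) :
    (∃ (Γ₁ : RCtx) (Q : PTy) (Γ₂ : RCtx),
      CtxSub Γ (Γ₁ ++ ⟨Q, conjTy (.fls : Fm 0 [] Q) trivial⟩ :: Γ₂)) ∨
    ∃ (Ψ : FCtx Γ.und) (u : ctxDom Γ.und), Ψ.Least u ∧ CtxSub Γ Ψ.toRCtx ∧ u ∈ Γ.sem := by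
  induction Γ with
  | nil => exact .inr ⟨.nil, PUnit.unit, trivial, .nil, trivial⟩
  | cons A Γ ih =>
    obtain ⟨P, T⟩ := A
    obtain ⟨φ, hφ, hs, _, hd⟩ := RTy.IsConj.exists_conjTy (hΓ ⟨P, T⟩ (by simp))
    rcases hφ.decided with ⟨hf, _⟩ | ⟨_, c, hc⟩
    -- A refutable type is a subtype of `{P | ⊥}`, so subtyping of contexts brings the entry into
    -- the form required by the rule for `⊥`.
    · exact .inl ⟨[], P, Γ, .cons (hs.trans (.ded hf)) (.refl Γ)⟩
    rcases ih fun A hA => hΓ A (by simp [hA]) with ⟨Γ₁, Q, Γ₂, h⟩ | ⟨Ψ, u, hu, h, hm⟩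
    · exact .inl ⟨⟨P, conjTy φ hφ⟩ :: Γ₁, Q, Γ₂, .cons hs h⟩
    · refine .inr ⟨.cons φ hφ Ψ, ((c, u) : dom P × ctxDom (RCtx.und Γ)), ⟨hc, hu⟩, .cons hs h,
        ?_, hm⟩
      show c ∈ T.sem
      rw [hd, hc]
      exact Set.self_mem_Ici

end
end FPC

-- Completeness for conjunctive judgements

theorem mainTheorem2 (Γ : FPC.RCtx) (M : FPC.Tm) {P : FPC.PTy} (T : FPC.RTy P)
    (hΓ : FPC.RCtx.IsConj Γ) (hT : T.IsConj) (h : FPC.Sound Γ M T) : FPC.RTyping Γ M T := by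
  obtain ⟨d, hd⟩ := h
  rcases hΓ.decided with ⟨Γ₁, Q, Γ₂, hs⟩ | ⟨Ψ, u, hu, hs, hm⟩
  -- In an inconsistent context the pure typing alone is enough; it is transported along equality of
  -- the underlying contexts.
  · exact .sub hs (.fls (hs.und_eq ▸ d)) .refl
  · obtain ⟨φ, hφ, _, hφT, he⟩ := hT.exists_conjTy
    -- Soundness is applied only to the least tuple `u`, which represents the whole context.
    exact .sub hs (FPC.typable d Ψ u hu φ hφ (he ▸ hd u hm)) hφT
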